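/- Let $k$ be a field of characteristic $0$ with algebraic closure $\overline{k}$, and let $E$ be an elliptic curve over $k$ with identity $\mathcal{O}$. For $P \in E(\overline{k})$ write $\tau_P : E \to E$, $Q \mapsto Q+P$, for translation by $P$. For an integer $n \ge 1$ let $$\Theta_n(\overline{k}) = \{ (f,T) \in \overline{k}(E)^\times \times E[n](\overline{k}) \mid \operatorname{div}(f) = \tau_T^*(n.\mathcal{O}) - n.\mathcal{O} \},$$ a group under $(f,S) * (g,T) = ((\tau_T^* f)\, g,\, S+T)$. It acts on the Riemann--Roch space $\mathcal{L}(n.\mathcal{O})$ by $(f,T) : h \mapsto \tau_{-T}^*(h/f)$, and hence on the dual space $V_n = \mathcal{L}(n.\mathcal{O})^*$. The Heisenberg group $H_n$ is the closed $k$-subgroup scheme of $\operatorname{SL}(V_n)$ whose group of $\overline{k}$-points is the group of those $(f,T) \in \Theta_n(\overline{k})$ that act on $V_n$ with determinant $1$ (here $V_n$ has its natural $k$-structure, and, as $k$ has characteristic $0$, $H_n$ is reduced). **Proposition.** Let $m$ and $n$ be coprime positive integers. Then there is an isomorphism of $k$-group schemes $$ H_m \times H_n \;\cong\; H_{mn}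 $$ given on $\overline{k}$-points by $$ ((f,S),(g,T)) \;\longmapsto\; (f^n,S) * (g^m,T). $$ In particular $(f^n,S)*(g^m,T)$ lies in $H_{mn}(\overline{k})$ for all $(f,S) \in H_m(\overline{k})$ and $(g,T) \in H_n(\overline{k})$. -/

import Mathlib

universe u

namespace EllHeis
noncomputable section

open scoped Classical
set_option linter.unusedSectionVars false

/-! ### The curve over an extension field, its coordinate ring and its function field -/

section

open WeierstrassCurve WeierstrassCurve.Affine Polynomial
open scoped Polynomial.Bivariate nonZeroDivisors

section FunctionField

variable {k : Type u} [Field k] (E : WeierstrassCurve k) (F : Type u) [Field F] [Algebra k F]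

/-- The group `E(F)`. -/
abbrev Pts : Type u := (E.toAffine.baseChange F).Point

/-- The affine coordinate ring `F[E] = F[X, Y]/(W)`: functions regular away from the origin. -/
abbrev CRing : Type u := (E.toAffine.baseChange F).CoordinateRing

/-- The function field `F(E)`. -/
abbrev FF : Type u := (E.toAffine.baseChange F).FunctionField


/-- The coordinate function `x`. -/
def xR : CRing E F := CoordinateRing.mk _ (C X)

/-- The coordinate function `y`. -/
def yR : CRing E F := CoordinateRing.mk _ X

/-- The coordinate function `x`, as a rational function. -/
def xF : FF E F := algebraMap (CRing E F) (FF E F) (xR E F)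

/-- The coordinate function `y`, as a rational function. -/
def yF : FF E F := algebraMap (CRing E F) (FF E F) (yR E F)

lemma smul_one_eq (p : F[X]) : p • (1 : CRing E F) = aeval (xR E F) p := by
  rw [Algebra.smul_def, mul_one]
  have : (aeval (xR E F) : F[X] →ₐ[F] CRing E F) = IsScalarTower.toAlgHom F F[X] (CRing E F) := by
    ext
    simp [xR]
  rw [this]
  rfl

/-- Every regular function is uniquely `p(x) + q(x) y`. -/
lemma exists_eq (r : CRing E F) : ∃ p q : F[X], r = aeval (xR E F) p + aeval (xR E F) q * yR E F := by
  obtain ⟨p, q, h⟩ := CoordinateRing.exists_smul_basis_eq r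
  refine ⟨p, q, ?_⟩
  rw [← h, ← smul_one_eq, ← smul_one_eq]
  simp [yR]

lemma equation_R : (yR E F) ^ 2 + algebraMap k _ E.a₁ * xR E F * yR E F + algebraMap k _ E.a₃ * yR E F =
    xR E F ^ 3 + algebraMap k _ E.a₂ * xR E F ^ 2 + algebraMap k _ E.a₄ * xR E F + algebraMap k _ E.a₆ := by
  have h : CoordinateRing.mk (E.toAffine.baseChange F) (E.toAffine.baseChange F).polynomial = 0 := AdjoinRoot.mk_self
  simp only [WeierstrassCurve.Affine.polynomial] at h
  simp only [map_sub, map_add, map_mul, map_pow] at h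
  have h2 := sub_eq_zero.mp h
  have h3 : CoordinateRing.mk (E.toAffine.baseChange F) X ^ 2 + (algebraMap k (CRing E F) E.a₁ * CoordinateRing.mk _ (C X) + algebraMap k _ E.a₃) * CoordinateRing.mk _ X
    = CoordinateRing.mk _ (C X) ^ 3 + algebraMap k _ E.a₂ * CoordinateRing.mk _ (C X) ^ 2 + algebraMap k _ E.a₄ * CoordinateRing.mk _ (C X) + algebraMap k _ E.a₆ := h2
  rw [xR, yR, ← h3]
  ring

lemma equation_gen : ((E.toAffine.baseChange (FF E F))).Equation (xF E F) (yF E F) := by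
  rw [equation_iff]
  have h := congrArg (algebraMap (CRing E F) (FF E F)) (equation_R E F)
  simp only [map_add, map_mul, map_pow, ← IsScalarTower.algebraMap_apply] at h
  exact h

instance [E.IsElliptic] : (E.toAffine.baseChange F).IsElliptic :=
  inferInstanceAs (E.map (algebraMap k F)).IsElliptic

variable [E.IsElliptic]

/-- The generic point `(x, y)` of `E`, a point of `E` over its function field. -/
def gen : Pts E (FF E F) :=
  .some (xF E F) (yF E F) (equation_iff_nonsingular.mp (equation_gen E F))

end FunctionField

section Hom

variable {k : Type u} [Field k] {E : WeierstrassCurve k} {F : Type u} [Field F] [Algebra k F]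
  {L : Type u} [Field L] [DecidableEq L] [Algebra k L]

lemma xF_ne_const (a : F) : xF E F ≠ algebraMap F _ a := by
  intro h
  rw [IsScalarTower.algebraMap_apply F (CRing E F) (FF E F)] at h
  have h := IsFractionRing.injective (CRing E F) (FF E F) h
  have := CoordinateRing.XClass_ne_zero (W' := E.toAffine.baseChange F) a
  apply this
  rw [CoordinateRing.XClass, C_sub, map_sub, sub_eq_zero]
  exact h

/-- A homomorphism out of the function field is determined by its values on constants and on the
coordinate functions. -/
lemma hom_ext' {φ ψ : FF E F →ₐ[k] L} (hc : ∀ a : F, φ (algebraMap F _ a) = ψ (algebraMap F _ a))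
    (hx : φ (xF E F) = ψ (xF E F)) (hy : φ (yF E F) = ψ (yF E F)) : φ = ψ := by
  have key : ∀ r : CRing E F, φ (algebraMap _ _ r) = ψ (algebraMap _ _ r) := by
    intro r
    have hp : ∀ p : F[X], φ (algebraMap (CRing E F) _ (aeval (xR E F) p)) = ψ (algebraMap (CRing E F) _ (aeval (xR E F) p)) := by
      intro p
      induction p using Polynomial.induction_on' with
      | add p q hp hq => simp only [map_add, hp, hq]
      | monomial n a =>
        rw [aeval_monomial, map_mul, map_mul, map_mul, ← IsScalarTower.algebraMap_apply, hc, map_pow, map_pow, map_pow]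
        congr 2
    obtain ⟨p, q, rfl⟩ := exists_eq E F r
    rw [map_add, map_add, map_add, map_mul, map_mul, map_mul, hp, hp]
    congr 2
  apply AlgHom.coe_ringHom_injective
  apply IsLocalization.ringHom_ext (CRing E F)⁰
  exact RingHom.ext key

lemma hom_ext [E.IsElliptic] {φ ψ : FF E F →ₐ[k] L} (hc : ∀ a : F, φ (algebraMap F _ a) = ψ (algebraMap F _ a))
    (hg : Point.map φ (gen E F) = Point.map ψ (gen E F)) : φ = ψ := by
  rw [gen, Point.map_some, Point.map_some] at hg
  have := (Point.some.injEq ..).mp hg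
  exact hom_ext' hc this.1 this.2

/-- The homomorphism out of the function field with prescribed values on constants and on the
generic point, the latter being sent to a point that is not constant. -/
lemma exists_hom [IsAlgClosed F] [E.IsElliptic] (c : F →ₐ[k] L) (P : Pts E L)
    (hP : P ∉ Set.range (Point.map (W' := E.toAffine) c)) :
    ∃ φ : FF E F →ₐ[k] L, (∀ a : F, φ (algebraMap F _ a) = c a) ∧ Point.map φ (gen E F) = P := by
  rcases P with _ | ⟨x, y, h⟩
  · exact absurd ⟨0, rfl⟩ hP
  have heq := h.1
  rw [equation_iff] at heq
  have hx : ∀ a, c a ≠ x := by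
    rintro a rfl
    -- `y` is a root of a monic quadratic with coefficients in `c F`
    obtain ⟨b, hb⟩ : ∃ b, c b = y := by
      set u := algebraMap k F E.a₁ * a + algebraMap k F E.a₃ with hu
      set v := a ^ 3 + algebraMap k F E.a₂ * a ^ 2 + algebraMap k F E.a₄ * a + algebraMap k F E.a₆ with hv
      obtain ⟨b, hb⟩ := IsAlgClosed.exists_root (X ^ 2 + (C u * X - C v) : F[X]) (by
        have : (X ^ 2 + (C u * X - C v) : F[X]).degree = 2 := by compute_degree!
        rw [this]; decide)
      have hb' : b ^ 2 + u * b - v = 0 := by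
        simpa [IsRoot, add_sub_assoc] using hb
      have hb2 := congrArg c hb'
      have hu2 := congrArg c hu
      have hv2 := congrArg c hv
      simp only [map_sub, map_add, map_mul, map_pow, map_zero, AlgHom.commutes] at hb2 hu2 hv2
      have h3 : y ^ 2 + algebraMap k L E.a₁ * c a * y + algebraMap k L E.a₃ * y = c a ^ 3 + algebraMap k L E.a₂ * c a ^ 2 + algebraMap k L E.a₄ * c a + algebraMap k L E.a₆ := heq
      have h4 : (c b - y) * (c (-b - u) - y) = 0 := by
        simp only [map_sub, map_neg]
        linear_combination h3 - hb2 - hv2 + hu2 * y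
      rcases mul_eq_zero.mp h4 with h5 | h5
      · exact ⟨_, sub_eq_zero.mp h5⟩
      · exact ⟨_, sub_eq_zero.mp h5⟩
    subst hb
    have hQ := (E.toAffine.baseChange_nonsingular (f := c) c.injective a b).mp h
    exact hP ⟨.some a b hQ, rfl⟩
  -- the homomorphism on the coordinate ring
  have hev : (E.toAffine.baseChange F).polynomial.eval₂ (eval₂RingHom (c : F →+* L) x) y = 0 := by
    simp only [WeierstrassCurve.Affine.polynomial, eval₂_sub, eval₂_add, eval₂_mul, eval₂_pow, eval₂_C, eval₂_X,
      coe_eval₂RingHom]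
    have h3 : y ^ 2 + algebraMap k L E.a₁ * x * y + algebraMap k L E.a₃ * y = x ^ 3 + algebraMap k L E.a₂ * x ^ 2 + algebraMap k L E.a₄ * x + algebraMap k L E.a₆ := heq
    have e : ∀ a : k, (c : F →+* L) (algebraMap k F a) = algebraMap k L a := c.commutes
    simp only [WeierstrassCurve.Affine.baseChange_a₁, WeierstrassCurve.Affine.baseChange_a₂, WeierstrassCurve.Affine.baseChange_a₃, WeierstrassCurve.Affine.baseChange_a₄, WeierstrassCurve.Affine.baseChange_a₆, e]
    linear_combination h3
  let f : CRing E F →+* L := AdjoinRoot.lift (eval₂RingHom (c : F →+* L) x) y hev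
  have hfC : ∀ p : F[X], f (algebraMap F[X] _ p) = p.eval₂ (c : F →+* L) x := fun p =>
    AdjoinRoot.lift_of hev
  have hfc : ∀ a : F, f (algebraMap F _ a) = c a := by
    intro a
    rw [IsScalarTower.algebraMap_apply F F[X] (CRing E F), hfC]
    simp
  have hfx : f (xR E F) = x := by
    have := hfC X
    rw [eval₂_X] at this
    exact this
  have hfy : f (yR E F) = y := AdjoinRoot.lift_root hev
  have hinj : Function.Injective f := by
    rw [injective_iff_map_eq_zero]
    intro r hr
    by_contra hr0
    have := Module.Finite.of_basis (CoordinateRing.basis (E.toAffine.baseChange F))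
    have hN : Algebra.norm F[X] r ≠ 0 := Algebra.norm_ne_zero_iff.mpr hr0
    obtain ⟨s, hs⟩ : r ∣ algebraMap F[X] _ (Algebra.norm F[X] r) := by
      obtain ⟨p, q, rfl⟩ := CoordinateRing.exists_smul_basis_eq r
      have h1 := CoordinateRing.coe_norm_smul_basis (W' := E.toAffine.baseChange F) p q
      rw [map_mul] at h1
      refine ⟨_, h1.trans (congrArg (· * CoordinateRing.mk (E.toAffine.baseChange F) _) ?_)⟩
      simp [CoordinateRing.smul]
    have h0 : (Algebra.norm F[X] r).eval₂ (c : F →+* L) x = 0 := by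
      rw [← hfC, hs, map_mul, hr, zero_mul]
    rw [(IsAlgClosed.splits (Algebra.norm F[X] r)).eq_prod_roots, eval₂_mul, eval₂_C, mul_eq_zero] at h0
    rcases h0 with h0 | h0
    · exact hN (leadingCoeff_eq_zero.mp (c.injective (h0.trans (map_zero c).symm)))
    · rw [eval₂_multiset_prod, Multiset.prod_eq_zero_iff, Multiset.map_map, Multiset.mem_map] at h0
      obtain ⟨a, -, ha⟩ := h0
      simp only [Function.comp, eval₂_sub, eval₂_X, eval₂_C] at ha
      exact hx a (sub_eq_zero.mp ha).symm
  let φ₀ : FF E F →+* L := IsFractionRing.lift (K := FF E F) hinj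
  have hφ : ∀ r, φ₀ (algebraMap _ _ r) = f r := IsFractionRing.lift_algebraMap hinj
  let φ : FF E F →ₐ[k] L :=
    { φ₀ with
      commutes' := fun a => by
        change φ₀ _ = _
        rw [IsScalarTower.algebraMap_apply k F (FF E F), IsScalarTower.algebraMap_apply F (CRing E F) (FF E F), hφ, hfc, c.commutes] }
  refine ⟨φ, fun a => ?_, ?_⟩
  · change φ₀ _ = _
    rw [IsScalarTower.algebraMap_apply F (CRing E F) (FF E F), hφ, hfc]
  · rw [gen, Point.map_some]
    congr 1
    · exact (hφ _).trans hfx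
    · exact (hφ _).trans hfy

end Hom

end

/-! ### Translations and the Galois action on the function field -/

section

open WeierstrassCurve WeierstrassCurve.Affine Polynomial
open scoped Polynomial.Bivariate nonZeroDivisors

section Translation

variable {k : Type u} [Field k] {E : WeierstrassCurve k} {F : Type u} [Field F] [Algebra k F]

/-- A point of `E(F)` regarded as a (constant) point over the function field. -/
def const : Pts E F →+ Pts E (FF E F) := Point.map (IsScalarTower.toAlgHom k F (FF E F))

variable [E.IsElliptic]

lemma gen_notMem (c : F →ₐ[k] FF E F) (hc : ∀ a, ∃ b, c a = algebraMap F _ b) :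
    gen E F ∉ Set.range (Point.map (W' := E.toAffine) c) := by
  rintro ⟨_ | ⟨x, y, h⟩, hQ⟩
  · exact Point.some_ne_zero _ hQ.symm
  · rw [gen, Point.map_some] at hQ
    obtain ⟨b, hb⟩ := hc x
    exact xF_ne_const b (((Point.some.injEq ..).mp hQ).1.symm.trans hb)

variable [IsAlgClosed F]

lemma exists_transl (T : Pts E F) : ∃ φ : FF E F →ₐ[F] FF E F,
    Point.map (φ.restrictScalars k) (gen E F) = gen E F + const T := by
  obtain ⟨φ, h1, h2⟩ := exists_hom (E := E) (IsScalarTower.toAlgHom k F (FF E F)) (gen E F + const T) (by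
    rintro ⟨Q, hQ⟩
    refine gen_notMem (E := E) (IsScalarTower.toAlgHom k F (FF E F)) (fun a => ⟨a, rfl⟩) ⟨Q - T, ?_⟩
    rw [map_sub, hQ]
    exact add_sub_cancel_right _ _)
  refine ⟨{ φ with commutes' := h1 }, ?_⟩
  exact h2

/-- The pull-back `τ_T^*` of rational functions along the translation `τ_T : P ↦ P + T`: it fixes
the constants and takes the generic point `(x, y)` to `(x, y) + T`. -/
def transl (T : Pts E F) : FF E F →ₐ[F] FF E F := (exists_transl T).choose

lemma transl_gen (T : Pts E F) :
    Point.map ((transl T).restrictScalars k) (gen E F) = gen E F + const T :=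
  (exists_transl T).choose_spec

lemma map_const (φ : FF E F →ₐ[k] FF E F) (σ : F →ₐ[k] F)
    (h : ∀ a, φ (algebraMap F _ a) = algebraMap F _ (σ a)) (T : Pts E F) :
    Point.map φ (const T) = const (Point.map σ T) := by
  rw [const, Point.map_map, Point.map_map]
  congr 2
  ext a
  exact h a

lemma transl_const (S T : Pts E F) :
    Point.map ((transl S).restrictScalars k) (const T) = const T := by
  rw [map_const _ (AlgHom.id k F) (fun a => (transl S).commutes a)]
  congr 1
  cases T <;> rfl

lemma transl_unique {T : Pts E F} {φ : FF E F →ₐ[F] FF E F}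
    (h : Point.map (φ.restrictScalars k) (gen E F) = gen E F + const T) : φ = transl T := by
  have : φ.restrictScalars k = (transl T).restrictScalars k :=
    hom_ext (fun a => (φ.commutes a).trans ((transl T).commutes a).symm) (h.trans (transl_gen T).symm)
  exact AlgHom.ext fun f => (DFunLike.congr_fun this f : _)

lemma transl_zero : transl (0 : Pts E F) = AlgHom.id F _ := by
  symm
  apply transl_unique
  rw [map_zero, add_zero]
  rfl

lemma transl_add (S T : Pts E F) : transl (S + T) = (transl S).comp (transl T) := by
  symm
  apply transl_unique
  have : ((transl S).comp (transl T)).restrictScalars k = ((transl S).restrictScalars k).comp ((transl T).restrictScalars k) := rfl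
  rw [this, ← Point.map_map, transl_gen, map_add, transl_gen, transl_const, map_add, add_assoc]

lemma transl_transl (S T : Pts E F) (f : FF E F) : transl S (transl T f) = transl (S + T) f := by
  rw [transl_add]; rfl

/-- The action of `σ` on points. -/
def galPt (σ : F ≃ₐ[k] F) : Pts E F →+ Pts E F := Point.map (σ : F →ₐ[k] F)

lemma exists_galFF (σ : F ≃ₐ[k] F) : ∃ φ : FF E F →ₐ[k] FF E F,
    (∀ a, φ (algebraMap F _ a) = algebraMap F _ (σ a)) ∧ Point.map φ (gen E F) = gen E F :=
  exists_hom (E := E) ((IsScalarTower.toAlgHom k F (FF E F)).comp (σ : F →ₐ[k] F)) (gen E F)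
    (gen_notMem _ (fun a => ⟨σ a, rfl⟩))

/-- The action of `σ` on rational functions, through their coefficients: it is `σ` on the constants
and fixes the coordinate functions. -/
def galFF (σ : F ≃ₐ[k] F) : FF E F →ₐ[k] FF E F := (exists_galFF σ).choose

lemma galFF_const (σ : F ≃ₐ[k] F) (a : F) :
    galFF (E := E) σ (algebraMap F _ a) = algebraMap F _ (σ a) := (exists_galFF σ).choose_spec.1 a

lemma galFF_gen (σ : F ≃ₐ[k] F) : Point.map (galFF (E := E) σ) (gen E F) = gen E F :=
  (exists_galFF σ).choose_spec.2

lemma galFF_xF (σ : F ≃ₐ[k] F) : galFF σ (xF E F) = xF E F := by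
  have h := galFF_gen (E := E) σ
  rw [gen, Point.map_some] at h
  exact ((Point.some.injEq ..).mp h).1

lemma galFF_yF (σ : F ≃ₐ[k] F) : galFF σ (yF E F) = yF E F := by
  have h := galFF_gen (E := E) σ
  rw [gen, Point.map_some] at h
  exact ((Point.some.injEq ..).mp h).2

lemma galFF_smul (σ : F ≃ₐ[k] F) (a : F) (f : FF E F) : galFF σ (a • f) = σ a • galFF σ f := by
  rw [Algebra.smul_def, Algebra.smul_def, map_mul, galFF_const]

lemma galFF_mul (σ τ : F ≃ₐ[k] F) (f : FF E F) : galFF (σ * τ) f = galFF σ (galFF τ f) := by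
  have : galFF (E := E) (σ * τ) = (galFF σ).comp (galFF τ) := by
    apply hom_ext
    · intro a
      rw [AlgHom.comp_apply, galFF_const, galFF_const, galFF_const]; rfl
    · rw [← Point.map_map, galFF_gen, galFF_gen, galFF_gen]
  rw [this]; rfl

lemma galFF_one (f : FF E F) : galFF (1 : F ≃ₐ[k] F) f = f := by
  have : galFF (E := E) (1 : F ≃ₐ[k] F) = AlgHom.id k _ := by
    apply hom_ext
    · intro a
      rw [galFF_const]; rfl
    · rw [galFF_gen]; rfl
  rw [this]; rfl

lemma galPt_mul (σ τ : F ≃ₐ[k] F) (T : Pts E F) : galPt (σ * τ) T = galPt σ (galPt τ T) := by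
  cases T <;> rfl

lemma galPt_one (T : Pts E F) : galPt (1 : F ≃ₐ[k] F) T = T := by
  cases T <;> rfl

lemma galFF_transl (σ : F ≃ₐ[k] F) (T : Pts E F) (f : FF E F) :
    galFF σ (transl T f) = transl (galPt σ T) (galFF σ f) := by
  have : (galFF (E := E) σ).comp ((transl T).restrictScalars k) =
      ((transl (galPt σ T)).restrictScalars k).comp (galFF σ) := by
    apply hom_ext
    · intro a
      change galFF σ (transl T _) = transl _ (galFF σ _)
      rw [AlgHom.commutes, galFF_const, AlgHom.commutes]
    · rw [← Point.map_map, ← Point.map_map, transl_gen, galFF_gen, map_add, galFF_gen, transl_gen,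
        map_const _ (σ : F →ₐ[k] F) (galFF_const σ)]
      rfl
  exact DFunLike.congr_fun this f

end Translation

end

/-! ### The affine coordinate ring is a Dedekind domain -/

section

open WeierstrassCurve WeierstrassCurve.Affine Polynomial
open scoped Polynomial.Bivariate nonZeroDivisors

section Dedekind

variable {k : Type u} [Field k] (E : WeierstrassCurve k) {F : Type u} [Field F] [Algebra k F]

/-- The ideal of functions vanishing at the affine point `(a, b)`. -/
abbrev ptIdeal (a b : F) : Ideal (CRing E F) := CoordinateRing.XYIdeal (E.toAffine.baseChange F) a (C b)

lemma ptIdeal_eq (a b : F) : ptIdeal E a b =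
    Ideal.span {xR E F - algebraMap F _ a, yR E F - algebraMap F _ b} := by
  rw [ptIdeal, CoordinateRing.XYIdeal, CoordinateRing.XClass, CoordinateRing.YClass, C_sub, map_sub, map_sub]
  rfl

variable {E} in
lemma ptIdeal_isMaximal {a b : F} (h : (E.toAffine.baseChange F).Equation a b) :
    (ptIdeal E a b).IsMaximal := by
  have h' : (eval (C b) (E.toAffine.baseChange F).polynomial).eval a = 0 := h
  exact Ideal.Quotient.maximal_of_isField _
    ((CoordinateRing.quotientXYIdealEquiv h').toMulEquiv.isField (Field.toIsField F))

variable {E} in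
lemma ptIdeal_ne_bot {a b : F} : ptIdeal E a b ≠ ⊥ := by
  intro h
  have : CoordinateRing.XClass (E.toAffine.baseChange F) a ∈ ptIdeal E a b := Ideal.subset_span (by simp)
  rw [h] at this
  exact CoordinateRing.XClass_ne_zero (W' := E.toAffine.baseChange F) a this

instance finite_CRing : Module.Finite F[X] (CRing E F) :=
  Module.Finite.of_basis (CoordinateRing.basis (E.toAffine.baseChange F))

instance noeth_CRing : IsNoetherianRing (CRing E F) := IsNoetherianRing.of_finite F[X] _

variable {E} in
/-- Over an algebraically closed field the maximal ideals are the points. -/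
lemma exists_pt [IsAlgClosed F] (I : Ideal (CRing E F)) [hI : I.IsMaximal] :
    ∃ a b : F, (E.toAffine.baseChange F).Equation a b ∧ I = ptIdeal E a b := by
  let _ := Ideal.Quotient.field I
  have hft : Algebra.FiniteType F (CRing E F ⧸ I) := inferInstance
  have hfin : Module.Finite F (CRing E F ⧸ I) := finite_of_finite_type_of_isJacobsonRing F _
  have hbij := IsAlgClosed.algebraMap_bijective_of_isIntegral (k := F) (K := CRing E F ⧸ I)
  obtain ⟨a, ha⟩ := hbij.2 (Ideal.Quotient.mk I (xR E F))
  obtain ⟨b, hb⟩ := hbij.2 (Ideal.Quotient.mk I (yR E F))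
  have hab : (E.toAffine.baseChange F).Equation a b := by
    rw [equation_iff]
    apply hbij.1
    have h := congrArg (Ideal.Quotient.mk I) (equation_R E F)
    have e : ∀ c : k, Ideal.Quotient.mk I (algebraMap k (CRing E F) c) =
        algebraMap F _ (algebraMap k F c) := fun c => rfl
    simp only [map_add, map_mul, map_pow, ← ha, ← hb, e] at h
    simp only [map_add, map_mul, map_pow]
    exact h
  refine ⟨a, b, hab, ((ptIdeal_isMaximal hab).eq_of_le hI.ne_top ?_).symm⟩
  rw [ptIdeal_eq, Ideal.span_le]
  rintro r (rfl | rfl)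
  · exact Ideal.Quotient.eq.mp ha.symm
  · exact Ideal.Quotient.eq.mp hb.symm

instance dimLE_CRing : Ring.DimensionLEOne (CRing E F) where
  maximalOfPrime {p} hp0 hp := by
    obtain ⟨r, hr, hr0⟩ := Submodule.exists_mem_ne_zero_of_ne_bot hp0
    have hint : Algebra.IsIntegral F[X] (CRing E F) := inferInstance
    have hc : p.comap (algebraMap F[X] (CRing E F)) ≠ ⊥ :=
      Ideal.comap_ne_bot_of_integral_mem hr0 hr (hint.isIntegral r)
    have : (p.comap (algebraMap F[X] (CRing E F))).IsMaximal :=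
      IsPrime.to_maximal_ideal hc
    exact Ideal.isMaximal_of_isIntegral_of_isMaximal_comap p this

lemma isPrincipal_of_mul {A : Type u} [CommRing A] [IsDomain A] [IsLocalRing A] {I J : Ideal A} {d : A}
    (hd : d ≠ 0) (h : J * I = Ideal.span {d}) : I.IsPrincipal := by
  apply Ideal.IsPrincipal.of_finite_maximals_of_isUnit
  · refine Set.Finite.subset (Set.finite_singleton (IsLocalRing.maximalIdeal A)) ?_
    intro J hJ
    exact IsLocalRing.eq_maximalIdeal hJ
  · have h3 := congrArg (fun J : Ideal A => (J : FractionalIdeal A⁰ (FractionRing A))) h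
    rw [FractionalIdeal.coeIdeal_mul] at h3
    refine IsUnit.of_mul_eq_one ((J : FractionalIdeal A⁰ (FractionRing A)) *
      FractionalIdeal.spanSingleton A⁰ (algebraMap A (FractionRing A) d)⁻¹) ?_
    rw [← mul_assoc, mul_comm (I : FractionalIdeal A⁰ (FractionRing A)), h3, FractionalIdeal.coeIdeal_span_singleton,
      FractionalIdeal.spanSingleton_mul_spanSingleton, mul_inv_cancel₀, FractionalIdeal.spanSingleton_one]
    intro h0
    exact hd (IsFractionRing.injective A (FractionRing A) (h0.trans (map_zero _).symm))

lemma integrallyClosed_of_principal {A : Type u} [CommRing A] [IsDomain A] [IsLocalRing A] [IsNoetherianRing A]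
    (h : (IsLocalRing.maximalIdeal A).IsPrincipal) : IsIntegrallyClosed A := by
  have : IsPrincipalIdealRing A := ((tfae_of_isNoetherianRing_of_isLocalRing_of_isDomain A).out 4 0).mp h
  infer_instance

variable [IsAlgClosed F] [E.IsElliptic]

instance dedekind_CRing : IsDedekindDomain (CRing E F) := by
  have hic : IsIntegrallyClosed (CRing E F) := by
    refine IsIntegrallyClosed.of_localization_maximal fun I _ hI => ?_
    obtain ⟨a, b, hab, rfl⟩ := exists_pt I
    have hns := equation_iff_nonsingular.mp hab
    have hmul := CoordinateRing.XYIdeal_neg_mul hns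
    have hinjA : Function.Injective (algebraMap (CRing E F) (Localization.AtPrime (ptIdeal E a b))) :=
      IsLocalization.injective _ (ptIdeal E a b).primeCompl_le_nonZeroDivisors
    have h2 := congrArg (Ideal.map (algebraMap (CRing E F) (Localization.AtPrime (ptIdeal E a b)))) hmul
    rw [Ideal.map_mul, CoordinateRing.XIdeal, Ideal.map_span, Set.image_singleton,
      Localization.AtPrime.map_eq_maximalIdeal] at h2
    have : IsNoetherianRing (Localization.AtPrime (ptIdeal E a b)) :=
      IsLocalization.isNoetherianRing (ptIdeal E a b).primeCompl _ inferInstance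
    have : IsDomain (Localization.AtPrime (ptIdeal E a b)) := inferInstance
    refine integrallyClosed_of_principal (isPrincipal_of_mul ?_ h2)
    intro h0
    exact CoordinateRing.XClass_ne_zero (W' := E.toAffine.baseChange F) a (hinjA (h0.trans (map_zero _).symm))
  exact { }

/-- The closed point of the affine curve given by `(a, b)`. -/
def ptSpec {a b : F} (h : (E.toAffine.baseChange F).Nonsingular a b) :
    IsDedekindDomain.HeightOneSpectrum (CRing E F) where
  asIdeal := ptIdeal E a b
  isPrime := (ptIdeal_isMaximal h.1).isPrime
  ne_bot := ptIdeal_ne_bot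

end Dedekind

end

/-! ### Orders of vanishing -/

section

open WeierstrassCurve WeierstrassCurve.Affine Polynomial
open scoped Polynomial.Bivariate nonZeroDivisors
open scoped WithZero

section Order

variable {k : Type u} [Field k] (E : WeierstrassCurve k) {F : Type u} [Field F] [Algebra k F]

/-- The order of the pole at the origin of a regular function: the degree of its norm to `F[x]`,
so that `x` and `y` have poles of order 2 and 3. -/
def poleDeg (r : CRing E F) : ℕ := (Algebra.norm F[X] r).natDegree

variable {E} in
lemma norm_degree (p q : F[X]) : (Algebra.norm F[X] (aeval (xR E F) p + aeval (xR E F) q * yR E F)).degree =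
    max (2 • p.degree) (2 • q.degree + 3) := by
  rw [← CoordinateRing.degree_norm_smul_basis (W' := E.toAffine.baseChange F) p q]
  congr 3
  · exact (smul_one_eq E F p).symm
  · rw [← smul_one_eq, smul_mul_assoc, one_mul]; rfl

lemma norm_ne_zero {r : CRing E F} (hr : r ≠ 0) : Algebra.norm F[X] r ≠ 0 :=
  Algebra.norm_ne_zero_iff.mpr hr

lemma poleDeg_mul {r s : CRing E F} (hr : r ≠ 0) (hs : s ≠ 0) :
    poleDeg E (r * s) = poleDeg E r + poleDeg E s := by
  rw [poleDeg, map_mul, natDegree_mul (norm_ne_zero E hr) (norm_ne_zero E hs)]; rfl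

lemma norm_degree_add_le (r s : CRing E F) : (Algebra.norm F[X] (r + s)).degree ≤
    max (Algebra.norm F[X] r).degree (Algebra.norm F[X] s).degree := by
  obtain ⟨p, q, rfl⟩ := exists_eq E F r
  obtain ⟨p', q', rfl⟩ := exists_eq E F s
  have : aeval (xR E F) p + aeval (xR E F) q * yR E F + (aeval (xR E F) p' + aeval (xR E F) q' * yR E F) =
    aeval (xR E F) (p + p') + aeval (xR E F) (q + q') * yR E F := by
    simp only [map_add]; ring
  rw [this, norm_degree, norm_degree, norm_degree]
  have h1 := degree_add_le p p'
  have h2 := degree_add_le q q'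
  refine max_le ?_ ?_
  · rcases le_max_iff.mp h1 with h | h
    · exact (nsmul_le_nsmul_right h 2).trans ((le_max_left _ _).trans (le_max_left _ _))
    · exact (nsmul_le_nsmul_right h 2).trans ((le_max_left _ _).trans (le_max_right _ _))
  · rcases le_max_iff.mp h2 with h | h
    · exact (add_le_add_left (nsmul_le_nsmul_right h 2) 3).trans ((le_max_right _ _).trans (le_max_left _ _))
    · exact (add_le_add_left (nsmul_le_nsmul_right h 2) 3).trans ((le_max_right _ _).trans (le_max_right _ _))

lemma poleDeg_add_le {r s : CRing E F} (hr : r ≠ 0) (hs : s ≠ 0) (hrs : r + s ≠ 0) :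
    poleDeg E (r + s) ≤ max (poleDeg E r) (poleDeg E s) := by
  have h := norm_degree_add_le E r s
  rw [degree_eq_natDegree (norm_ne_zero E hr), degree_eq_natDegree (norm_ne_zero E hs),
    degree_eq_natDegree (norm_ne_zero E hrs)] at h
  have h' : ((poleDeg E (r + s) : ℕ) : WithBot ℕ) ≤ max ((poleDeg E r : ℕ) : WithBot ℕ) ((poleDeg E s : ℕ) : WithBot ℕ) := h
  rcases le_max_iff.mp h' with h | h
  · exact le_max_of_le_left (by exact_mod_cast h)
  · exact le_max_of_le_right (by exact_mod_cast h)

/-- The valuation at the origin, on regular functions. -/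
def infValR : Valuation (CRing E F) ℤᵐ⁰ where
  toFun r := if r = 0 then 0 else WithZero.exp (poleDeg E r : ℤ)
  map_zero' := if_pos rfl
  map_one' := by
    rw [if_neg one_ne_zero, poleDeg, map_one, natDegree_one]; rfl
  map_mul' r s := by
    by_cases hr : r = 0
    · simp [hr]
    by_cases hs : s = 0
    · simp [hs]
    rw [if_neg hr, if_neg hs, if_neg (mul_ne_zero hr hs), poleDeg_mul E hr hs, ← WithZero.exp_add]
    push_cast
    rfl
  map_add_le_max' r s := by
    by_cases hr : r = 0
    · simp [hr]
    by_cases hs : s = 0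
    · simp [hs]
    by_cases hrs : r + s = 0
    · simp [hrs]
    rw [if_neg hr, if_neg hs, if_neg hrs]
    rcases le_max_iff.mp (poleDeg_add_le E hr hs hrs) with h | h
    · exact le_max_of_le_left (WithZero.exp_le_exp.mpr (by exact_mod_cast h))
    · exact le_max_of_le_right (WithZero.exp_le_exp.mpr (by exact_mod_cast h))

lemma infValR_apply {r : CRing E F} (hr : r ≠ 0) : infValR E r = WithZero.exp (poleDeg E r : ℤ) := if_neg hr

lemma infValR_supp : (CRing E F)⁰ ≤ (infValR E (F := F)).supp.primeCompl := by
  intro r hr h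
  rw [SetLike.mem_coe, Valuation.mem_supp_iff, infValR_apply E (nonZeroDivisors.ne_zero hr)] at h
  exact WithZero.exp_ne_zero h

/-- The valuation of the function field at the origin. -/
def infVal : Valuation (FF E F) ℤᵐ⁰ := (infValR E (F := F)).extendToLocalization (infValR_supp E) (FF E F)

lemma infVal_apply (r : CRing E F) : infVal E (algebraMap _ (FF E F) r) = infValR E r :=
  Valuation.extendToLocalization_apply_map_apply (infValR E) (infValR_supp E) (FF E F) r

variable {E}

lemma infVal_x : infVal E (xF E F) = WithZero.exp 2 := by
  have h : xR E F = aeval (xR E F) (X : F[X]) + aeval (xR E F) (0 : F[X]) * yR E F := by simp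
  have h2 := norm_degree (E := E) (X : F[X]) 0
  rw [← h] at h2
  have h0 : xR E F ≠ 0 := fun h => xF_ne_const (E := E) (0 : F) (by rw [xF, h, map_zero, map_zero])
  rw [xF, infVal_apply, infValR_apply E h0, poleDeg, natDegree_eq_of_degree_eq_some (n := 2)]
  · rfl
  · rw [h2]; simp

lemma infVal_y : infVal E (yF E F) = WithZero.exp 3 := by
  have h : yR E F = aeval (xR E F) (0 : F[X]) + aeval (xR E F) (1 : F[X]) * yR E F := by simp
  have h2 := norm_degree (E := E) (0 : F[X]) 1
  rw [← h] at h2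
  have h0 : yR E F ≠ 0 := by
    intro h0
    rw [h0, Algebra.norm_zero] at h2
    simp at h2
  rw [yF, infVal_apply, infValR_apply E h0, poleDeg, natDegree_eq_of_degree_eq_some (n := 3)]
  · rfl
  · rw [h2]; simp

lemma infVal_const {a : F} (ha : a ≠ 0) : infVal E (algebraMap F (FF E F) a) = 1 := by
  have h0 : algebraMap F (CRing E F) a ≠ 0 := by
    rw [Ne, FaithfulSMul.algebraMap_eq_zero_iff]; exact ha
  rw [IsScalarTower.algebraMap_apply F (CRing E F), infVal_apply, infValR_apply E h0, poleDeg,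
    IsScalarTower.algebraMap_apply F F[X] (CRing E F), Algebra.norm_algebraMap]
  simp

lemma infVal_const_le (a : F) : infVal E (algebraMap F (FF E F) a) ≤ 1 := by
  by_cases ha : a = 0
  · simp [ha]
  · exact (infVal_const ha).le

variable (E) [IsAlgClosed F] [E.IsElliptic]

/-- The normalised valuation of the function field at a point of `E`. -/
def ptVal : Pts E F → Valuation (FF E F) ℤᵐ⁰
  | .zero => infVal E
  | .some _ _ h => (ptSpec E h).valuation (FF E F)

variable {E}

/-- The order of vanishing of a (nonzero) rational function at a point. -/
def ord (P : Pts E F) (f : FF E F) : ℤ := -(ptVal E P f).log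

/-- The divisor of a (nonzero) rational function. -/
def div (f : FF E F) : Pts E F → ℤ := fun P => ord P f

lemma ord_mul (P : Pts E F) {f g : FF E F} (hf : f ≠ 0) (hg : g ≠ 0) : ord P (f * g) = ord P f + ord P g := by
  rw [ord, map_mul, WithZero.log_mul ((Valuation.ne_zero_iff _).mpr hf) ((Valuation.ne_zero_iff _).mpr hg), ord, ord]
  ring

lemma ord_inv (P : Pts E F) (f : FF E F) : ord P f⁻¹ = - ord P f := by
  rw [ord, map_inv₀, WithZero.log_inv, ord]

lemma ord_one (P : Pts E F) : ord P (1 : FF E F) = 0 := by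
  rw [ord, map_one, WithZero.log_one, neg_zero]

lemma exists_infVal_transl (T : Pts E F) : ∃ f : FF E F, infVal E (transl T f) = WithZero.exp (-1) := by
  refine ⟨transl (-T) (xF E F / yF E F), ?_⟩
  rw [transl_transl, add_neg_cancel, transl_zero, AlgHom.id_apply, map_div₀, infVal_x, infVal_y, ← WithZero.exp_sub]
  rfl

lemma mul_lt_one_aux {a b : ℤᵐ⁰} (ha : a ≤ 1) (hb : b < 1) : a * b < 1 :=
  (mul_le_of_le_one_left' ha).trans_lt hb

/-- A valuation that is trivial on constants, takes the value `exp (-1)`, and in which the coordinates tend to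
`(a, b)` is the valuation at `(a, b)`. -/
lemma eq_ptVal (v : Valuation (FF E F) ℤᵐ⁰) (hc : ∀ a : F, a ≠ 0 → v (algebraMap F _ a) = 1)
    (hs : ∃ f, v f = WithZero.exp (-1)) {a b : F} (h : (E.toAffine.baseChange F).Nonsingular a b)
    (hx : v (xF E F - algebraMap F _ a) < 1) (hy : v (yF E F - algebraMap F _ b) < 1) :
    v = (ptSpec E h).valuation (FF E F) := by
  have hc' : ∀ a : F, v (algebraMap F _ a) ≤ 1 := by
    intro a
    by_cases ha : a = 0
    · simp [ha]
    · exact (hc a ha).le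
  have hx1 : v (xF E F) ≤ 1 := by
    have := v.map_add (xF E F - algebraMap F _ a) (algebraMap F _ a)
    rw [sub_add_cancel] at this
    exact this.trans (max_le hx.le (hc' a))
  have hy1 : v (yF E F) ≤ 1 := by
    have := v.map_add (yF E F - algebraMap F _ b) (algebraMap F _ b)
    rw [sub_add_cancel] at this
    exact this.trans (max_le hy.le (hc' b))
  have hR : ∀ r : CRing E F, v (algebraMap _ _ r) ≤ 1 := by
    intro r
    have hp : ∀ p : F[X], v (algebraMap (CRing E F) _ (aeval (xR E F) p)) ≤ 1 := by
      intro p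
      induction p using Polynomial.induction_on' with
      | add p q hp hq =>
        rw [map_add, map_add]
        exact (v.map_add _ _).trans (max_le hp hq)
      | monomial n a =>
        rw [aeval_monomial, map_mul, map_mul, ← IsScalarTower.algebraMap_apply, map_pow, map_pow]
        exact mul_le_one' (hc' a) (pow_le_one' hx1 n)
    obtain ⟨p, q, rfl⟩ := exists_eq E F r
    rw [map_add, map_mul]
    refine (v.map_add _ _).trans (max_le (hp p) ?_)
    rw [map_mul]
    exact mul_le_one' (hp q) hy1
  have hm : ∀ r ∈ ptIdeal E a b, v (algebraMap _ _ r) < 1 := by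
    intro r hr
    rw [ptIdeal_eq, Ideal.mem_span_pair] at hr
    obtain ⟨s, t, rfl⟩ := hr
    rw [map_add, map_mul, map_mul, map_sub, map_sub, ← IsScalarTower.algebraMap_apply, ← IsScalarTower.algebraMap_apply]
    refine (v.map_add _ _).trans_lt (max_lt ?_ ?_)
    · rw [map_mul]; exact mul_lt_one_aux (hR s) hx
    · rw [map_mul]; exact mul_lt_one_aux (hR t) hy
  have hn : ∀ r ∉ ptIdeal E a b, v (algebraMap _ _ r) = 1 := by
    intro r hr
    have hmax := ptIdeal_isMaximal (E := E) h.1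
    obtain ⟨s, t, ht, hst⟩ := hmax.exists_inv hr
    have hst' := congrArg (fun z => v (algebraMap _ (FF E F) z)) hst
    simp only [map_add, map_mul, map_one] at hst'
    by_contra hne
    have hlt := lt_of_le_of_ne (hR r) hne
    have : v (algebraMap _ (FF E F) s * algebraMap _ (FF E F) r + algebraMap _ (FF E F) t) < 1 := by
      refine (v.map_add _ _).trans_lt (max_lt ?_ (hm t ht))
      rw [map_mul]
      exact mul_lt_one_aux (hR s) hlt
    exact this.ne hst'
  set w := (ptSpec E h).valuation (FF E F) with hw
  have hle : ∀ f, w f ≤ 1 → v f ≤ 1 := by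
    intro f hf
    obtain ⟨s, t, hst⟩ := (ptSpec E h).exists_primeCompl_mul_eq_of_integer f hf
    have := congrArg v hst
    rw [map_mul] at this
    rw [hn _ t.2, mul_one] at this
    rw [this]
    exact hR s
  have hone : ∀ f, w f = 1 → v f = 1 := by
    intro f hf
    have hf0 : f ≠ 0 := by rintro rfl; simp at hf
    refine le_antisymm (hle f hf.le) ?_
    have := hle f⁻¹ (by rw [map_inv₀, hf, inv_one])
    rw [map_inv₀] at this
    exact (inv_le_one₀ (zero_lt_iff.mpr ((Valuation.ne_zero_iff _).mpr hf0))).mp this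
  obtain ⟨π, hπ⟩ := (ptSpec E h).valuation_exists_uniformizer (FF E F)
  have hπ0 : π ≠ 0 := by
    rintro rfl
    rw [map_zero] at hπ
    exact WithZero.exp_ne_zero hπ.symm
  have hpow : ∀ f, f ≠ 0 → v f = v π ^ (-(w f).log) := by
    intro f hf
    have h1 : w (f * π ^ ((w f).log)) = 1 := by
      rw [map_mul, map_zpow₀, hw, hπ, ← WithZero.exp_zsmul, ← hw]
      nth_rewrite 1 [← WithZero.exp_log ((Valuation.ne_zero_iff w).mpr hf)]
      rw [← WithZero.exp_add]
      simp
    have h2 := hone _ h1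
    rw [map_mul, map_zpow₀] at h2
    rw [zpow_neg]
    exact eq_inv_of_mul_eq_one_left h2
  have hvπ : v π ≠ 0 := (Valuation.ne_zero_iff _).mpr hπ0
  have hlog : (v π).log = -1 := by
    obtain ⟨g, hg⟩ := hs
    have hg0 : g ≠ 0 := by
      rintro rfl
      rw [map_zero] at hg
      exact WithZero.exp_ne_zero hg.symm
    have h1 := congrArg WithZero.log (hpow g hg0)
    rw [hg, WithZero.log_exp, WithZero.log_zpow, smul_eq_mul] at h1
    have h2 : (v π).log ≤ 0 := by
      have := hle π (by
        rw [hπ, ← WithZero.exp_zero]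
        exact WithZero.exp_le_exp.mpr (by norm_num))
      rw [← WithZero.log_one]
      exact (WithZero.log_le_log hvπ one_ne_zero).mpr this
    have h3 : (v π).log ∣ 1 := ⟨(w g).log, by linarith⟩
    rcases Int.isUnit_iff.mp (isUnit_of_dvd_one h3) with h4 | h4 <;> omega
  ext f
  by_cases hf : f = 0
  · simp [hf]
  rw [hpow f hf, ← WithZero.exp_log hvπ, hlog, ← WithZero.exp_zsmul, smul_eq_mul,
    show -(w f).log * -1 = (w f).log by ring, WithZero.exp_log ((Valuation.ne_zero_iff w).mpr hf)]

lemma exp_lt_one_aux {n : ℤ} (h : n < 0) : WithZero.exp n < (1 : ℤᵐ⁰) := by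
  rw [← WithZero.exp_zero]
  exact WithZero.exp_lt_exp.mpr h

lemma infVal_smul_le (c : F) {f : FF E F} {n m : ℤ} (hf : infVal E f ≤ WithZero.exp n) (hnm : n ≤ m) :
    infVal E (algebraMap F _ c * f) ≤ WithZero.exp m := by
  rw [map_mul]
  exact (mul_le_of_le_one_left' (infVal_const_le c)).trans (hf.trans (WithZero.exp_le_exp.mpr hnm))

lemma infVal_add_le {f g : FF E F} {n : ℤ} (hf : infVal E f ≤ WithZero.exp n) (hg : infVal E g ≤ WithZero.exp n) :
    infVal E (f + g) ≤ WithZero.exp n := ((infVal E).map_add _ _).trans (max_le hf hg)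

lemma infVal_bound3 (p q r : F) : infVal E (algebraMap F _ p * xF E F + algebraMap F _ q * 1 +
    algebraMap F _ r * yF E F) ≤ WithZero.exp 3 := by
  refine infVal_add_le (infVal_add_le ?_ ?_) ?_
  · exact infVal_smul_le p infVal_x.le (by norm_num)
  · exact infVal_smul_le q (n := 0) (by simp) (by norm_num)
  · exact infVal_smul_le r infVal_y.le (by norm_num)

lemma infVal_bound5 (p q r s t : F) : infVal E (algebraMap F _ p * (xF E F * yF E F) + algebraMap F _ q * xF E F ^ 2 +
    (algebraMap F _ r * xF E F + algebraMap F _ s * 1 + algebraMap F _ t * yF E F)) ≤ WithZero.exp 5 := by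
  refine infVal_add_le (infVal_add_le ?_ ?_) ?_
  · refine infVal_smul_le p (n := 5) ?_ (by norm_num)
    rw [map_mul, infVal_x, infVal_y, ← WithZero.exp_add]
    norm_num
  · refine infVal_smul_le q (n := 4) ?_ (by norm_num)
    rw [map_pow, infVal_x, ← WithZero.exp_nsmul]
    norm_num
  · exact (infVal_bound3 r s t).trans (WithZero.exp_le_exp.mpr (by norm_num))

lemma infVal_x_sub (a : F) : infVal E (xF E F - algebraMap F _ a) = WithZero.exp 2 := by
  rw [Valuation.map_sub_eq_of_lt_left, infVal_x]
  rw [infVal_x]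
  exact (infVal_const_le a).trans_lt (by rw [← WithZero.exp_zero]; exact WithZero.exp_lt_exp.mpr (by norm_num))

/-- As the generic point tends to the origin, its translate by an affine point `P` tends to `P`. -/
lemma infVal_transl_sub {a b : F} (h : (E.toAffine.baseChange F).Nonsingular a b) :
    infVal E (transl (Point.some a b h : Pts E F) (xF E F) - algebraMap F _ a) < 1 ∧
    infVal E (transl (Point.some a b h : Pts E F) (yF E F) - algebraMap F _ b) < 1 := by
  have hg := transl_gen (Point.some a b h : Pts E F)
  have hne : (IsScalarTower.toAlgHom k F (FF E F)) a ≠ xF E F := fun e => xF_ne_const a e.symm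
  rw [add_comm, const, Point.map_some, gen, Point.map_some, Point.add_of_X_ne hne] at hg
  obtain ⟨hx, hy⟩ := (Point.some.injEq ..).mp hg
  rw [slope_of_X_ne hne] at hx hy
  set x' := transl (Point.some a b h : Pts E F) (xF E F) with hx'
  set y' := transl (Point.some a b h : Pts E F) (yF E F) with hy'
  set x := xF E F with hxx
  set y := yF E F with hyy
  set α := algebraMap F (FF E F) a with hα
  set β := algebraMap F (FF E F) b with hβ
  set a₁ := algebraMap F (FF E F) (algebraMap k F E.a₁) with ha₁
  set a₂ := algebraMap F (FF E F) (algebraMap k F E.a₂) with ha₂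
  set a₃ := algebraMap F (FF E F) (algebraMap k F E.a₃) with ha₃
  set a₄ := algebraMap F (FF E F) (algebraMap k F E.a₄) with ha₄
  set a₆ := algebraMap F (FF E F) (algebraMap k F E.a₆) with ha₆
  set l := (β - y) / (α - x) with hl
  have hx2 : x' = l ^ 2 + a₁ * l - a₂ - α - x := hx
  have hy2 : y' = -(l * (x' - α) + β) - a₁ * x' - a₃ := by
    rw [hx2]
    exact hy
  have hW : y ^ 2 + a₁ * x * y + a₃ * y = x ^ 3 + a₂ * x ^ 2 + a₄ * x + a₆ := by
    have := equation_gen E F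
    rw [equation_iff] at this
    exact this
  have hD0 : x - α ≠ 0 := sub_ne_zero.mpr (xF_ne_const a)
  have hlD : l * (x - α) = y - β := by
    rw [hl, div_mul_eq_mul_div, div_eq_iff (show α - x ≠ 0 from sub_ne_zero.mpr hne)]
    ring
  -- the numerator of `x' - a`
  set ψ : F := 2 * b + algebraMap k F E.a₁ * a + algebraMap k F E.a₃ with hψ
  set B : F := algebraMap k F E.a₄ - algebraMap k F E.a₁ * b + 2 * a * algebraMap k F E.a₂ + 3 * a ^ 2 with hB
  set G : F := algebraMap k F E.a₆ + b ^ 2 + algebraMap k F E.a₁ * a * b - (algebraMap k F E.a₂ + 2 * a) * a ^ 2 with hG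
  set M := algebraMap F _ B * x + algebraMap F _ G * 1 + algebraMap F _ (-ψ) * y with hM
  have hMx : (x' - α) * (x - α) ^ 2 = M := by
    have e : (x' - α) * (x - α) ^ 2 = (y - β) ^ 2 + a₁ * (y - β) * (x - α) - (a₂ + 2 * α + x) * (x - α) ^ 2 := by
      rw [← hlD, hx2]; ring
    rw [e, hM, hB, hG, hψ]
    simp only [map_add, map_sub, map_mul, map_pow, map_neg, map_ofNat]
    rw [← ha₁, ← ha₂, ← ha₃, ← ha₄, ← ha₆, ← hα, ← hβ]
    linear_combination hW
  set M2 := algebraMap F (FF E F) B * (x * y) +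
      algebraMap F _ (-ψ * algebraMap k F E.a₂ + algebraMap k F E.a₁ * B - 3 * a * ψ) * x ^ 2 +
    (algebraMap F _ (-b * B - ψ * algebraMap k F E.a₄ + algebraMap k F E.a₁ * G - algebraMap k F E.a₁ * a * B + 3 * a ^ 2 * ψ) * x
      + algebraMap F _ (-b * G - ψ * algebraMap k F E.a₆ - algebraMap k F E.a₁ * a * G - a ^ 3 * ψ) * 1
      + algebraMap F _ (G + b * ψ + ψ * algebraMap k F E.a₃ + algebraMap k F E.a₁ * a * ψ) * y) with hM2
  have hMy : (y' - β) * (x - α) ^ 3 = - M2 := by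
    have e : (y' - β) * (x - α) ^ 3 = -((y - β) * M + a₁ * M * (x - α) + algebraMap F _ ψ * (x - α) ^ 3) := by
      rw [← hMx, ← hlD, hy2, hψ]
      simp only [map_add, map_mul, map_ofNat]
      rw [← ha₁, ← ha₃, ← hα, ← hβ]
      ring
    rw [e, hM, hM2]
    simp only [map_add, map_sub, map_mul, map_pow, map_neg, map_ofNat]
    rw [← ha₁, ← ha₂, ← ha₃, ← ha₄, ← ha₆, ← hα, ← hβ]
    linear_combination algebraMap F (FF E F) ψ * hW
  have hvD := infVal_x_sub (E := E) a
  constructor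
  · have h1 := infVal_bound3 (E := E) B G (-ψ)
    rw [← hxx, ← hyy, ← hM, ← hMx, map_mul, map_pow, hvD, ← WithZero.exp_nsmul] at h1
    by_contra hcon
    have h2 : WithZero.exp (2 • (2 : ℤ)) ≤ WithZero.exp (3 : ℤ) :=
      (le_mul_of_one_le_left' (not_lt.mp hcon)).trans h1
    have := WithZero.exp_le_exp.mp h2
    norm_num at this
  · have h1 := infVal_bound5 (E := E) B
      (-ψ * algebraMap k F E.a₂ + algebraMap k F E.a₁ * B - 3 * a * ψ)
      (-b * B - ψ * algebraMap k F E.a₄ + algebraMap k F E.a₁ * G - algebraMap k F E.a₁ * a * B + 3 * a ^ 2 * ψ)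
      (-b * G - ψ * algebraMap k F E.a₆ - algebraMap k F E.a₁ * a * G - a ^ 3 * ψ)
      (G + b * ψ + ψ * algebraMap k F E.a₃ + algebraMap k F E.a₁ * a * ψ)
    rw [← hxx, ← hyy, ← hM2, ← neg_neg M2, ← hMy, Valuation.map_neg, map_mul, map_pow, hvD, ← WithZero.exp_nsmul] at h1
    by_contra hcon
    have h2 : WithZero.exp (3 • (2 : ℤ)) ≤ WithZero.exp (5 : ℤ) :=
      (le_mul_of_one_le_left' (not_lt.mp hcon)).trans h1
    have := WithZero.exp_le_exp.mp h2
    norm_num at this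

/-- Translation by `T` carries the order at `P + T` to the order at `P`. -/
lemma ptVal_transl (P T : Pts E F) (f : FF E F) : ptVal E P (transl T f) = ptVal E (P + T) f := by
  have key : ∀ (Q : Pts E F) (g : FF E F), ptVal E Q g = infVal E (transl Q g) := by
    intro Q g
    rcases Q with _ | ⟨a, b, h⟩
    · have : transl (Point.zero : Pts E F) g = g := by
        rw [← Point.zero_def, transl_zero]; rfl
      rw [this]; rfl
    · have hlt := infVal_transl_sub h
      have := eq_ptVal ((infVal E).comap (transl (Point.some a b h : Pts E F) : FF E F →+* FF E F))
        (fun c hc => by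
          rw [Valuation.comap_apply]
          exact ((congrArg (infVal E) (AlgHom.commutes _ c)).trans (infVal_const hc))) (exists_infVal_transl _) h
        (by
          rw [Valuation.comap_apply, map_sub]
          have := hlt.1
          rwa [← AlgHom.commutes (transl (Point.some a b h : Pts E F)) a] at this)
        (by
          rw [Valuation.comap_apply, map_sub]
          have := hlt.2
          rwa [← AlgHom.commutes (transl (Point.some a b h : Pts E F)) b] at this)
      exact (DFunLike.congr_fun this g).symm
  rw [key, key, transl_transl]

lemma ord_transl (P T : Pts E F) (f : FF E F) : ord P (transl T f) = ord (P + T) f := by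
  rw [ord, ptVal_transl, ord]

end Order

end

/-! ### Riemann-Roch spaces and theta groups -/

section

open WeierstrassCurve WeierstrassCurve.Affine Polynomial
open scoped Polynomial.Bivariate nonZeroDivisors
open scoped WithZero

section Theta

variable {k : Type u} [Field k] (E : WeierstrassCurve k) (F : Type u) [Field F] [Algebra k F]
  [IsAlgClosed F] [E.IsElliptic]

/-- The divisor `n.O`. -/
def nO (n : ℕ) : Pts E F → ℤ := fun P => if P = 0 then n else 0

variable {E F} in
lemma neg_le_ord_iff {f : FF E F} (hf : f ≠ 0) (P : Pts E F) (d : ℤ) :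
    -d ≤ ord P f ↔ ptVal E P f ≤ WithZero.exp d := by
  rw [ord, neg_le_neg_iff, WithZero.log_le_iff_le_exp ((Valuation.ne_zero_iff _).mpr hf)]

/-- The Riemann-Roch space `L(n.O)`: zero, and the rational functions `f` with
`div f + n.O ≥ 0`. -/
def RR (n : ℕ) : Submodule F (FF E F) where
  carrier := {f | f ≠ 0 → ∀ P, -(nO E F n P) ≤ div f P}
  zero_mem' := fun h => absurd rfl h
  add_mem' {f g} hf hg := by
    intro h0 P
    by_cases hf0 : f = 0
    · subst hf0
      simp only [zero_add] at h0 ⊢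
      exact hg h0 P
    by_cases hg0 : g = 0
    · subst hg0
      simp only [add_zero] at h0 ⊢
      exact hf h0 P
    refine (neg_le_ord_iff h0 P _).mpr (((ptVal E P).map_add f g).trans (max_le ?_ ?_))
    · exact (neg_le_ord_iff hf0 P _).mp (hf hf0 P)
    · exact (neg_le_ord_iff hg0 P _).mp (hg hg0 P)
  smul_mem' c f hf := by
    intro h0 P
    have hc : c ≠ 0 := by rintro rfl; exact h0 (zero_smul _ _)
    have hf0 : f ≠ 0 := by rintro rfl; exact h0 (smul_zero _)
    have h1 : ptVal E P (algebraMap F _ c) = 1 := by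
      have := ptVal_transl 0 P (algebraMap F (FF E F) c)
      rw [AlgHom.commutes, zero_add] at this
      rw [← this]
      exact infVal_const hc
    have h2 : div (c • f) P = div f P := by
      rw [div, ord, Algebra.smul_def, map_mul, h1, one_mul]; rfl
    rw [h2]
    exact hf hf0 P

/-- Pairs of a function and a point. -/
@[ext]
structure PairOf (A B : Type u) where
  /-- the function -/
  fn : A
  /-- the point -/
  pt : B

/-- Pairs of a nonzero rational function on `E` and a point of `E`. -/
abbrev RatPair : Type u := PairOf (FF E F)ˣ (Pts E F)

namespace RatPair

variable {E F}

/-- The group law `(f, S) * (g, T) = ((τ_T^* f) g, S + T)`. -/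
instance : Mul (RatPair E F) :=
  ⟨fun a b => ⟨Units.map (transl b.pt : FF E F →* FF E F) a.fn * b.fn, a.pt + b.pt⟩⟩

instance : One (RatPair E F) := ⟨⟨1, 0⟩⟩

instance : Inv (RatPair E F) :=
  ⟨fun a => ⟨Units.map (transl (-a.pt) : FF E F →* FF E F) a.fn⁻¹, -a.pt⟩⟩

lemma mul_fn (a b : RatPair E F) : ((a * b).fn : FF E F) = transl b.pt (a.fn : FF E F) * b.fn := rfl
lemma mul_pt (a b : RatPair E F) : (a * b).pt = a.pt + b.pt := rfl
lemma one_fn : ((1 : RatPair E F).fn : FF E F) = 1 := rfl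
lemma one_pt : (1 : RatPair E F).pt = 0 := rfl
lemma inv_fn (a : RatPair E F) : ((a⁻¹).fn : FF E F) = transl (-a.pt) (a.fn : FF E F)⁻¹ := by
  rw [← Units.val_inv_eq_inv_val]; rfl
lemma inv_pt (a : RatPair E F) : (a⁻¹).pt = -a.pt := rfl

lemma ext' {a b : RatPair E F} (h1 : (a.fn : FF E F) = b.fn) (h2 : a.pt = b.pt) : a = b :=
  PairOf.ext (Units.ext h1) h2

instance : Group (RatPair E F) := Group.ofLeftAxioms
  (fun a b c => by
    apply ext'
    · rw [mul_fn, mul_fn, mul_fn, mul_fn, map_mul, transl_transl, mul_pt, mul_assoc, add_comm c.pt]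
    · rw [mul_pt, mul_pt, mul_pt, mul_pt, add_assoc])
  (fun a => by
    apply ext'
    · rw [mul_fn, one_fn, map_one, one_mul]
    · rw [mul_pt, one_pt, zero_add])
  (fun a => by
    apply ext'
    · rw [mul_fn, inv_fn, transl_transl, add_neg_cancel, transl_zero, AlgHom.id_apply, one_fn,
        inv_mul_cancel₀ a.fn.ne_zero]
    · rw [mul_pt, inv_pt, one_pt, neg_add_cancel])

/-- `(f, T) ↦ (f ^ N, T)`. -/
def powFn (a : RatPair E F) (N : ℕ) : RatPair E F := ⟨a.fn ^ N, a.pt⟩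

/-- The action `(f, T) : h ↦ τ_{-T}^* (h / f)` on rational functions. -/
def act : Representation F (RatPair E F) (FF E F) where
  toFun a := (transl (-a.pt)).toLinearMap ∘ₗ LinearMap.mulLeft F ((a.fn : FF E F)⁻¹)
  map_one' := by
    ext h
    rw [LinearMap.comp_apply, LinearMap.mulLeft_apply, one_fn, inv_one, one_mul, one_pt, neg_zero, transl_zero]
    rfl
  map_mul' a b := by
    ext h
    rw [LinearMap.comp_apply, LinearMap.mulLeft_apply, AlgHom.toLinearMap_apply]
    change _ = transl (-a.pt) ((a.fn : FF E F)⁻¹ * transl (-b.pt) ((b.fn : FF E F)⁻¹ * h))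
    have e : -(a.pt + b.pt) + b.pt = -a.pt := by abel
    have e' : -a.pt + -b.pt = -(a.pt + b.pt) := by abel
    rw [mul_fn, mul_pt, mul_inv, ← map_inv₀ (transl b.pt), map_mul, map_mul, transl_transl, e,
      map_mul (transl (-a.pt)), transl_transl, e', map_mul, mul_assoc]

lemma act_apply (a : RatPair E F) (h : FF E F) : act a h = transl (-a.pt) (h / a.fn) := by
  rw [div_eq_inv_mul]; rfl

end RatPair

/-- The theta group `Θ_n(F)`: pairs `(f, T)` with `T ∈ E[n]` and `div f = τ_T^*(n.O) - n.O`. -/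
def Theta (n : ℕ) : Subgroup (RatPair E F) where
  carrier := {a | n • a.pt = 0 ∧ ∀ P, div (a.fn : FF E F) P = nO E F n (P + a.pt) - nO E F n P}
  one_mem' := ⟨by rw [RatPair.one_pt, smul_zero], fun P => by
    rw [RatPair.one_fn, RatPair.one_pt, add_zero, sub_self]; exact ord_one P⟩
  mul_mem' {a b} ha hb := ⟨by rw [RatPair.mul_pt, smul_add, ha.1, hb.1, add_zero], fun P => by
    have h1 := ha.2 (P + b.pt)
    have h2 := hb.2 P
    rw [div] at h1 h2 ⊢
    rw [RatPair.mul_fn, ord_mul _ (by simp) b.fn.ne_zero, ord_transl, h1, h2, RatPair.mul_pt,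
      add_assoc P, add_comm b.pt]
    ring⟩
  inv_mem' {a} ha := ⟨by rw [RatPair.inv_pt, smul_neg, ha.1, neg_zero], fun P => by
    have h1 := ha.2 (P + -a.pt)
    rw [div] at h1 ⊢
    rw [RatPair.inv_fn, ord_transl, ord_inv, h1, RatPair.inv_pt, neg_add_cancel_right]
    ring⟩

variable {E F}

lemma act_mem {n : ℕ} (a : Theta E F n) {h : FF E F} (hh : h ∈ RR E F n) :
    RatPair.act (a : RatPair E F) h ∈ RR E F n := by
  intro h0 P
  rw [RatPair.act_apply] at h0 ⊢
  have hh0 : h ≠ 0 := by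
    rintro rfl
    exact h0 (by rw [zero_div, map_zero])
  have h1 := hh hh0 (P + -(a : RatPair E F).pt)
  have h2 := a.2.2 (P + -(a : RatPair E F).pt)
  rw [div] at h1 h2 ⊢
  rw [ord_transl, div_eq_mul_inv, ord_mul _ hh0 (inv_ne_zero (Units.ne_zero _)), ord_inv, h2, neg_add_cancel_right]
  linarith

/-- The action of the theta group on `L(n.O)`. -/
def thetaRR (n : ℕ) : Representation F (Theta E F n) (RR E F n) where
  toFun a := (RatPair.act (a : RatPair E F)).restrict fun _ => act_mem a
  map_one' := by
    ext h
    exact congrArg (fun φ : FF E F →ₗ[F] FF E F => φ (h : FF E F)) (map_one (RatPair.act (E := E) (F := F)))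
  map_mul' a b := by
    ext h
    exact congrArg (fun φ : FF E F →ₗ[F] FF E F => φ (h : FF E F)) (map_mul (RatPair.act (E := E) (F := F)) (a : RatPair E F) (b : RatPair E F))

lemma thetaRR_apply {n : ℕ} (a : Theta E F n) (h : RR E F n) :
    (thetaRR n a h : FF E F) = RatPair.act (a : RatPair E F) h := rfl

/-- The representation of the theta group on `V_n = L(n.O)^*`. -/
def thetaV (n : ℕ) : Representation F (Theta E F n) (Module.Dual F (RR E F n)) := (thetaRR n).dual

variable (E F) in
/-- The group `H_n(F)`: the elements of the theta group that lie in `SL(V_n)`. -/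
def Heis (n : ℕ) : Subgroup (Theta E F n) := (LinearMap.det.comp (thetaV n)).ker

end Theta

end

/-! ### The Galois action -/

section

open WeierstrassCurve WeierstrassCurve.Affine Polynomial
open scoped Polynomial.Bivariate nonZeroDivisors
open scoped WithZero

section Galois

variable {k : Type u} [Field k] {E : WeierstrassCurve k} {F : Type u} [Field F] [Algebra k F]
  [IsAlgClosed F] [E.IsElliptic]

lemma galFF_aeval (σ : F ≃ₐ[k] F) (p : F[X]) :
    galFF σ (algebraMap (CRing E F) (FF E F) (aeval (xR E F) p)) =
      algebraMap _ _ (aeval (xR E F) (p.map (σ : F →+* F))) := by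
  induction p using Polynomial.induction_on' with
  | add p q hp hq => simp only [map_add, Polynomial.map_add, hp, hq]
  | monomial n a =>
    rw [aeval_monomial, map_monomial, aeval_monomial, map_mul, map_mul, map_mul, map_pow, map_pow,
      ← IsScalarTower.algebraMap_apply, ← IsScalarTower.algebraMap_apply, galFF_const]
    exact congrArg (fun z => _ * z ^ n) (galFF_xF σ)

lemma galFF_CRing (σ : F ≃ₐ[k] F) (r : CRing E F) : ∃ s : CRing E F,
    galFF σ (algebraMap (CRing E F) (FF E F) r) = algebraMap _ _ s ∧
    (Algebra.norm F[X] s).degree = (Algebra.norm F[X] r).degree := by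
  obtain ⟨p, q, rfl⟩ := exists_eq E F r
  refine ⟨aeval (xR E F) (p.map (σ : F →+* F)) + aeval (xR E F) (q.map (σ : F →+* F)) * yR E F, ?_, ?_⟩
  · rw [map_add, map_add, map_mul, map_mul, galFF_aeval, galFF_aeval, map_add, map_mul]
    congr 2
    exact galFF_yF σ
  · rw [norm_degree, norm_degree, degree_map, degree_map]

lemma infVal_galFF (σ : F ≃ₐ[k] F) (f : FF E F) : infVal E (galFF σ f) = infVal E f := by
  have key : ∀ r : CRing E F, infVal E (galFF σ (algebraMap _ (FF E F) r)) = infVal E (algebraMap _ (FF E F) r) := by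
    intro r
    obtain ⟨s, hs, hd⟩ := galFF_CRing σ r
    by_cases hr : r = 0
    · simp [hr]
    have hs0 : s ≠ 0 := by
      rintro rfl
      rw [Algebra.norm_zero, degree_zero, eq_comm, degree_eq_bot] at hd
      exact norm_ne_zero E hr hd
    rw [hs, infVal_apply, infVal_apply, infValR_apply E hr, infValR_apply E hs0, poleDeg, poleDeg,
      natDegree_eq_of_degree_eq hd]
  obtain ⟨r, s, hs, rfl⟩ := IsFractionRing.div_surjective (CRing E F) f
  rw [map_div₀, map_div₀, map_div₀, key, key]

lemma ptVal_eq (P : Pts E F) (f : FF E F) : ptVal E P f = infVal E (transl P f) := by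
  have := ptVal_transl 0 P f
  rw [zero_add] at this
  exact this.symm

lemma ord_galFF (σ : F ≃ₐ[k] F) (P : Pts E F) (f : FF E F) :
    ord (galPt σ P) (galFF σ f) = ord P f := by
  rw [ord, ord, ptVal_eq, ptVal_eq, ← galFF_transl, infVal_galFF]

lemma galPt_surj (σ : F ≃ₐ[k] F) (P : Pts E F) : ∃ Q, galPt σ Q = P :=
  ⟨galPt σ⁻¹ P, by rw [← galPt_mul, mul_inv_cancel, galPt_one]⟩

lemma galPt_inj (σ : F ≃ₐ[k] F) : Function.Injective (galPt (E := E) σ) := fun P Q h => by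
  have := congrArg (galPt σ⁻¹) h
  rwa [← galPt_mul, ← galPt_mul, inv_mul_cancel, galPt_one, galPt_one] at this

lemma nO_galPt (n : ℕ) (σ : F ≃ₐ[k] F) (P : Pts E F) : nO E F n (galPt σ P) = nO E F n P := by
  rw [nO, nO]
  congr 1
  rw [eq_iff_iff]
  exact ⟨fun h => galPt_inj σ (h.trans (map_zero _).symm), fun h => by rw [h, map_zero]⟩

lemma galFF_mem {n : ℕ} (σ : F ≃ₐ[k] F) {f : FF E F} (hf : f ∈ RR E F n) : galFF σ f ∈ RR E F n := by
  intro h0 P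
  obtain ⟨Q, rfl⟩ := galPt_surj σ P
  rw [nO_galPt, div, ord_galFF]
  exact hf (by rintro rfl; exact h0 (map_zero _)) Q

/-- The Galois action on `L(n.O)`. -/
def galRR (n : ℕ) (σ : F ≃ₐ[k] F) (f : RR E F n) : RR E F n := ⟨galFF σ f, galFF_mem σ f.2⟩

lemma galRR_add {n : ℕ} (σ : F ≃ₐ[k] F) (f g : RR E F n) : galRR n σ (f + g) = galRR n σ f + galRR n σ g :=
  Subtype.ext (map_add (galFF σ) (f : FF E F) g)

lemma galRR_smul {n : ℕ} (σ : F ≃ₐ[k] F) (a : F) (f : RR E F n) : galRR n σ (a • f) = σ a • galRR n σ f :=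
  Subtype.ext (galFF_smul σ a (f : FF E F))

lemma galRR_sum {n : ℕ} (σ : F ≃ₐ[k] F) {ι : Type*} [Fintype ι] (f : ι → RR E F n) :
    galRR n σ (∑ i, f i) = ∑ i, galRR n σ (f i) :=
  map_sum (AddMonoidHom.mk' (galRR n σ) (galRR_add σ)) f _

/-- The Galois action on pairs. -/
def galPair (σ : F ≃ₐ[k] F) : RatPair E F →* RatPair E F where
  toFun a := ⟨Units.map ((galFF σ : FF E F →ₐ[k] FF E F) : FF E F →* FF E F) a.fn, galPt σ a.pt⟩
  map_one' := RatPair.ext' (map_one (galFF (E := E) σ)) (map_zero (galPt (E := E) σ))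
  map_mul' a b := RatPair.ext' (by
    change galFF σ (transl b.pt (a.fn : FF E F) * (b.fn : FF E F)) = transl (galPt σ b.pt) (galFF σ (a.fn : FF E F)) * galFF σ (b.fn : FF E F)
    rw [map_mul, galFF_transl]) (map_add _ _ _)

lemma galPair_fn (σ : F ≃ₐ[k] F) (a : RatPair E F) : ((galPair σ a).fn : FF E F) = galFF σ a.fn := rfl
lemma galPair_pt (σ : F ≃ₐ[k] F) (a : RatPair E F) : (galPair σ a).pt = galPt σ a.pt := rfl

lemma galPair_mem {n : ℕ} (σ : F ≃ₐ[k] F) {a : RatPair E F} (ha : a ∈ Theta E F n) :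
    galPair σ a ∈ Theta E F n := by
  refine ⟨by rw [galPair_pt, ← map_nsmul, ha.1, map_zero], fun P => ?_⟩
  obtain ⟨Q, rfl⟩ := galPt_surj σ P
  have := ha.2 Q
  rw [div] at this ⊢
  rw [galPair_fn, ord_galFF, galPair_pt, ← map_add, nO_galPt, nO_galPt, this]

/-- The Galois action on the theta group. -/
def galTheta (n : ℕ) (σ : F ≃ₐ[k] F) : Theta E F n →* Theta E F n where
  toFun a := ⟨galPair σ a, galPair_mem σ a.2⟩
  map_one' := Subtype.ext (map_one (galPair σ))
  map_mul' a b := Subtype.ext (map_mul (galPair σ) (a : RatPair E F) b)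

lemma thetaRR_gal {n : ℕ} (σ : F ≃ₐ[k] F) (a : Theta E F n) (f : RR E F n) :
    thetaRR n (galTheta n σ a) (galRR n σ f) = galRR n σ (thetaRR n a f) := by
  apply Subtype.ext
  change RatPair.act (galPair σ (a : RatPair E F)) (galFF σ f) = galFF σ (RatPair.act (a : RatPair E F) f)
  rw [RatPair.act_apply, RatPair.act_apply, galPair_pt, galPair_fn, galFF_transl, map_neg, map_div₀ (galFF σ)]

/-! ### A rational basis of the Riemann-Roch space -/

lemma ptVal_zero (f : FF E F) : ptVal E (0 : Pts E F) f = infVal E f := rfl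

lemma mem_RR_bound {n : ℕ} {f : FF E F} (hf : f ∈ RR E F n) :
    ∃ r : CRing E F, algebraMap _ _ r = f ∧ (Algebra.norm F[X] r).degree ≤ n := by
  by_cases h0 : f = 0
  · exact ⟨0, by simp [h0], by simp⟩
  have h1 := hf h0
  have h2 : f ∈ (algebraMap (CRing E F) (FF E F)).range := by
    refine IsDedekindDomain.HeightOneSpectrum.mem_integers_of_valuation_le_one _ _ fun v => ?_
    have := v.isMaximal
    obtain ⟨a, b, hab, hI⟩ := exists_pt v.asIdeal
    have hns := equation_iff_nonsingular.mp hab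
    have hv : v = ptSpec E hns := IsDedekindDomain.HeightOneSpectrum.ext hI
    subst hv
    have h3 := h1 (.some a b hns)
    rw [nO, if_neg (Point.some_ne_zero _), div, neg_le_ord_iff h0, WithZero.exp_zero] at h3
    exact h3
  obtain ⟨r, rfl⟩ := h2
  refine ⟨r, rfl, ?_⟩
  have hr : r ≠ 0 := by rintro rfl; exact h0 (map_zero _)
  have h3 := h1 0
  rw [nO, if_pos rfl, div, neg_le_ord_iff h0, ptVal_zero, infVal_apply, infValR_apply E hr, WithZero.exp_le_exp] at h3
  rw [degree_eq_natDegree (norm_ne_zero E hr)]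
  exact_mod_cast h3

/-- The rational functions `x ^ i` and `x ^ i y`. -/
def mono (j : ℕ × Bool) : FF E F := xF E F ^ j.1 * (if j.2 then yF E F else 1)

/-- The indices of the monomials with a pole of order at most `n` at the origin. -/
def monoIdx (n : ℕ) : Set (ℕ × Bool) := {j | 2 * j.1 + (if j.2 then 3 else 0) ≤ n}

lemma monoIdx_finite (n : ℕ) : (monoIdx n).Finite := by
  refine Set.Finite.subset ((Set.finite_Iic n).prod (Set.finite_univ (α := Bool))) ?_
  rintro ⟨i, b⟩ h
  have h' : 2 * i + (if b then 3 else 0) ≤ n := h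
  exact ⟨show i ≤ n by omega, trivial⟩

lemma galFF_mono (σ : F ≃ₐ[k] F) (j : ℕ × Bool) : galFF σ (mono (E := E) j) = mono j := by
  rw [mono, map_mul, map_pow, galFF_xF]
  congr 1
  split_ifs
  · exact galFF_yF σ
  · exact map_one _

lemma ptVal_CRing_le {a b : F} (h : (E.toAffine.baseChange F).Nonsingular a b) (r : CRing E F) :
    ptVal E (.some a b h) (algebraMap _ (FF E F) r) ≤ 1 := (ptSpec E h).valuation_le_one r

lemma mono_mem {n : ℕ} {j : ℕ × Bool} (hj : j ∈ monoIdx n) : mono j ∈ RR E F n := by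
  intro h0 P
  rcases P with _ | ⟨a, b, h⟩
  · have h1 : nO E F n (Point.zero) = n := if_pos rfl
    rw [h1, div, neg_le_ord_iff h0]
    change infVal E _ ≤ _
    have : infVal E (if j.2 then yF E F else 1) = WithZero.exp (if j.2 then 3 else 0 : ℤ) := by
      split_ifs
      · exact infVal_y
      · simp
    rw [mono, map_mul, map_pow, this, infVal_x, ← WithZero.exp_nsmul, ← WithZero.exp_add, WithZero.exp_le_exp]
    have h' : 2 * j.1 + (if j.2 then 3 else 0) ≤ n := hj
    split_ifs at h' ⊢ <;> simp <;> omega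
  · rw [nO, if_neg (Point.some_ne_zero _), div, neg_le_ord_iff h0, WithZero.exp_zero]
    have : mono (E := E) (F := F) j = algebraMap (CRing E F) _ (xR E F ^ j.1 * (if j.2 then yR E F else 1)) := by
      rw [mono, map_mul, map_pow]
      congr 1
      split_ifs
      · rfl
      · exact (map_one _).symm
    rw [this]
    exact ptVal_CRing_le h _

lemma aeval_mem_span {S : Submodule F (FF E F)} {g : FF E F} {p : F[X]}
    (hS : ∀ i ∈ p.support, xF E F ^ i * g ∈ S) :
    algebraMap (CRing E F) (FF E F) (aeval (xR E F) p) * g ∈ S := by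
  rw [aeval_def, eval₂_eq_sum, Polynomial.sum, map_sum, Finset.sum_mul]
  refine S.sum_mem fun i hi => ?_
  have := S.smul_mem (p.coeff i) (hS i hi)
  rw [Algebra.smul_def, ← mul_assoc] at this
  rwa [map_mul, map_pow, ← IsScalarTower.algebraMap_apply]

lemma RR_le_span (n : ℕ) : RR E F n ≤ Submodule.span F (mono '' monoIdx n) := by
  intro f hf
  obtain ⟨r, rfl, hr⟩ := mem_RR_bound hf
  obtain ⟨p, q, rfl⟩ := exists_eq E F r
  rw [norm_degree, max_le_iff] at hr
  rw [map_add, map_mul]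
  refine Submodule.add_mem _ ?_ ?_
  · rw [← mul_one (algebraMap _ _ _)]
    refine aeval_mem_span fun i hi => Submodule.subset_span ⟨(i, false), ?_, rfl⟩
    have h1 := (nsmul_le_nsmul_right (le_degree_of_mem_supp i hi) 2).trans hr.1
    have h2 : 2 * i ≤ n := by
      rw [nsmul_eq_mul] at h1
      exact_mod_cast h1
    exact h2
  · refine aeval_mem_span fun i hi => Submodule.subset_span ⟨(i, true), ?_, rfl⟩
    have h1 := (add_le_add_left (nsmul_le_nsmul_right (le_degree_of_mem_supp i hi) 2) 3).trans hr.2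
    have h2 : 2 * i + 3 ≤ n := by
      rw [nsmul_eq_mul] at h1
      exact_mod_cast h1
    exact h2

/-- The space `L(n.O)` has a basis of rational functions defined over `k`. -/
lemma exists_basis (n : ℕ) : ∃ (ι : Type) (_ : Fintype ι) (b : Module.Basis ι F (RR E F n)),
    ∀ i (σ : F ≃ₐ[k] F), galRR n σ (b i) = b i := by
  let v : monoIdx n → RR E F n := fun j => ⟨mono j, mono_mem j.2⟩
  have hv : ⊤ ≤ Submodule.span F (Set.range v) := by
    rintro ⟨f, hf⟩ -
    have h1 := RR_le_span n hf
    have h2 : mono (E := E) (F := F) '' monoIdx n = (RR E F n).subtype '' Set.range v := by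
      rw [← Set.range_comp]
      ext f
      constructor
      · rintro ⟨j, hj, rfl⟩
        exact ⟨⟨j, hj⟩, rfl⟩
      · rintro ⟨j, rfl⟩
        exact ⟨j, j.2, rfl⟩
    rw [h2, ← Submodule.map_span] at h1
    obtain ⟨g, hg, hgf⟩ := h1
    have : g = ⟨f, hf⟩ := Subtype.ext hgf
    rwa [← this]
  obtain ⟨κ, a, ha, hspan, hli⟩ := exists_linearIndependent' F v
  have : Finite (monoIdx n) := monoIdx_finite n
  have : Finite κ := Finite.of_injective a ha
  refine ⟨Fin (Nat.card κ), inferInstance, (Module.Basis.mk hli (by rw [hspan]; exact hv)).reindex (Finite.equivFin κ), ?_⟩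
  intro i σ
  rw [Module.Basis.reindex_apply, Module.Basis.mk_apply]
  exact Subtype.ext (galFF_mono σ _)

instance RR_finite (n : ℕ) : Module.Finite F (RR E F n) := by
  obtain ⟨ι, _, b, -⟩ := exists_basis (k := k) (E := E) (F := F) n
  exact Module.Finite.of_basis b

/-! ### The Galois action on the Heisenberg group -/

lemma det_gal {n : ℕ} (σ : F ≃ₐ[k] F) (a : Theta E F n) :
    LinearMap.det (thetaRR n (galTheta n σ a)) = σ (LinearMap.det (thetaRR n a)) := by
  obtain ⟨ι, _, b, hb⟩ := exists_basis (k := k) (E := E) (F := F) n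
  rw [← LinearMap.det_toMatrix b, ← LinearMap.det_toMatrix b]
  have : LinearMap.toMatrix b b (thetaRR n (galTheta n σ a)) =
      (σ : F →+* F).mapMatrix (LinearMap.toMatrix b b (thetaRR n a)) := by
    ext i j
    rw [RingHom.mapMatrix_apply, Matrix.map_apply, LinearMap.toMatrix_apply, LinearMap.toMatrix_apply]
    have h1 : thetaRR n (galTheta n σ a) (b j) = ∑ i, σ (b.repr (thetaRR n a (b j)) i) • b i := by
      nth_rewrite 1 [← hb j σ]
      rw [thetaRR_gal]
      nth_rewrite 1 [← b.sum_repr (thetaRR n a (b j))]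
      rw [galRR_sum]
      exact Finset.sum_congr rfl fun i _ => by rw [galRR_smul, hb]
    rw [h1, b.repr_sum_self]
    rfl
  rw [this, ← RingHom.map_det]
  rfl

lemma det_thetaV {n : ℕ} (a : Theta E F n) : LinearMap.det (thetaV n a) = LinearMap.det (thetaRR n a⁻¹) :=
  LinearMap.det_dualMap (thetaRR n a⁻¹)

lemma galTheta_mem {n : ℕ} (σ : F ≃ₐ[k] F) {a : Theta E F n} (ha : a ∈ Heis E F n) : galTheta n σ a ∈ Heis E F n := by
  have h1 : LinearMap.det (thetaV n a) = 1 := ha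
  change LinearMap.det (thetaV n (galTheta n σ a)) = (1 : F)
  rw [det_thetaV] at h1 ⊢
  rw [← map_inv, det_gal, h1, map_one]

/-- The Galois action on the Heisenberg group. -/
def galHeis (n : ℕ) (σ : F ≃ₐ[k] F) : Heis E F n →* Heis E F n where
  toFun a := ⟨galTheta n σ a, galTheta_mem σ a.2⟩
  map_one' := Subtype.ext (map_one (galTheta n σ))
  map_mul' a b := Subtype.ext (map_mul (galTheta n σ) (a : Theta E F n) b)

end Galois

end

/-! ### Hopf algebras of functions on a group with Galois action -/

section

open scoped TensorProduct

section Functions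

variable {k F : Type u} [Field k] [Field F] [Algebra k F]

/-- Pull-back of functions. -/
def pull (k : Type u) {F : Type u} [Field k] [Field F] [Algebra k F] {X Y : Type u} (f : Y → X) :
    (X → F) →ₐ[k] (Y → F) where
  toFun a := a ∘ f
  map_one' := rfl
  map_mul' _ _ := rfl
  map_zero' := rfl
  map_add' _ _ := rfl
  commutes' _ := rfl

/-- `a ⊗ b` as the function `(x, y) ↦ a x * b y`. -/
def tensEv {A B : Type u} [CommRing A] [CommRing B] [Algebra k A] [Algebra k B] {X Y : Type u}
    (φ : A →ₐ[k] (X → F)) (ψ : B →ₐ[k] (Y → F)) : A ⊗[k] B →ₐ[k] (X × Y → F) :=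
  Algebra.TensorProduct.productMap ((pull k Prod.fst).comp φ) ((pull k Prod.snd).comp ψ)

lemma tensEv_tmul {A B : Type u} [CommRing A] [CommRing B] [Algebra k A] [Algebra k B] {X Y : Type u}
    (φ : A →ₐ[k] (X → F)) (ψ : B →ₐ[k] (Y → F)) (a : A) (b : B) (p : X × Y) :
    tensEv φ ψ (a ⊗ₜ b) p = φ a p.1 * ψ b p.2 :=
  congrFun (Algebra.TensorProduct.productMap_apply_tmul _ _ a b) p

/-- Equivariant functions that are independent over the fixed field are independent. -/
lemma indep {X : Type u} (s : (F ≃ₐ[k] F) → X → X)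
    (hfix : ∀ c : F, (∀ σ : F ≃ₐ[k] F, σ c = c) → ∃ d : k, algebraMap k F d = c)
    {ι : Type*} (f : ι → X → F) (hf : ∀ i σ x, f i (s σ x) = σ (f i x)) (hli : LinearIndependent k f) :
    LinearIndependent F f := by
  classical
  rw [linearIndependent_iff']
  intro t
  induction t using Finset.induction_on with
  | empty => simp
  | insert j t hj ih =>
    have key : ∀ c : ι → F, c j = 1 → ∑ i ∈ insert j t, c i • f i ≠ 0 := by
      intro c hc h0
      have hσ : ∀ (σ : F ≃ₐ[k] F), ∑ i ∈ insert j t, σ (c i) • f i = 0 := by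
        intro σ
        funext x
        have h1 := congrFun h0 (s σ⁻¹ x)
        rw [Finset.sum_apply] at h1 ⊢
        have h2 := congrArg σ h1
        rw [map_sum] at h2
        simp only [Pi.smul_apply, Pi.zero_apply, hf, smul_eq_mul, map_mul, map_zero] at h2 ⊢
        rw [← h2]
        refine Finset.sum_congr rfl fun i _ => ?_
        congr 1
        exact (AlgEquiv.apply_symm_apply σ (f i x)).symm
      have hfixed : ∀ i ∈ t, ∀ σ : F ≃ₐ[k] F, σ (c i) = c i := by
        intro i hi σ
        have h1 : ∑ i ∈ t, (σ (c i) - c i) • f i = 0 := by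
          have h2 := (hσ σ).trans h0.symm
          rw [Finset.sum_insert hj, Finset.sum_insert hj, hc, map_one] at h2
          have h3 := add_left_cancel h2
          simp only [sub_smul, Finset.sum_sub_distrib, h3, sub_self]
        exact sub_eq_zero.mp (ih _ h1 i hi)
      have hex : ∀ i, ∃ d : k, i ∈ insert j t → algebraMap k F d = c i := by
        intro i
        by_cases hi : i ∈ insert j t
        · rcases Finset.mem_insert.mp hi with rfl | hi'
          · exact ⟨1, fun _ => by rw [map_one, hc]⟩
          · obtain ⟨d, hd⟩ := hfix _ (hfixed i hi')
            exact ⟨d, fun _ => hd⟩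
        · exact ⟨0, fun h => absurd h hi⟩
      choose d hd using hex
      have h1 : ∑ i ∈ insert j t, d i • f i = 0 := by
        rw [← h0]
        refine Finset.sum_congr rfl fun i hi => ?_
        rw [← hd i hi, algebraMap_smul]
      have h2 := linearIndependent_iff'.mp hli _ _ h1 j (Finset.mem_insert_self j t)
      have h3 := hd j (Finset.mem_insert_self j t)
      rw [h2, map_zero, hc] at h3
      exact zero_ne_one h3
    intro c hc
    have hj0 : c j = 0 := by
      by_contra hne
      refine key (fun i => (c j)⁻¹ * c i) (inv_mul_cancel₀ hne) ?_
      simp only [mul_smul]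
      rw [← Finset.smul_sum, hc, smul_zero]
    rw [Finset.sum_insert hj, hj0, zero_smul, zero_add] at hc
    intro i hi
    rcases Finset.mem_insert.mp hi with rfl | hi'
    · exact hj0
    · exact ih c hc i hi'

lemma tensEv_injective {A B : Type u} [CommRing A] [CommRing B] [Algebra k A] [Algebra k B] {X Y : Type u}
    {φ : A →ₐ[k] (X → F)} {ψ : B →ₐ[k] (Y → F)} (s : (F ≃ₐ[k] F) → X → X)
    (hfix : ∀ c : F, (∀ σ : F ≃ₐ[k] F, σ c = c) → ∃ d : k, algebraMap k F d = c)
    (hφ : ∀ a σ x, φ a (s σ x) = σ (φ a x))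
    (hi : Function.Injective φ) (hj : Function.Injective ψ) : Function.Injective (tensEv φ ψ) := by
  classical
  rw [injective_iff_map_eq_zero]
  intro t ht
  let b := Module.Basis.ofVectorSpace k A
  obtain ⟨c, rfl⟩ := TensorProduct.eq_repr_basis_left b t
  have hli : LinearIndependent k (fun i => φ (b i)) :=
    b.linearIndependent.map' φ.toLinearMap (LinearMap.ker_eq_bot.mpr hi)
  have hF := indep s hfix _ (fun i => hφ (b i)) hli
  have hc : ∀ i ∈ c.support, c i = 0 := by
    intro i hi'
    apply hj
    rw [map_zero]
    funext y
    refine linearIndependent_iff'.mp hF c.support (fun i => ψ (c i) y) ?_ i hi'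
    funext x
    have h1 := congrFun ht (x, y)
    rw [Finsupp.sum, map_sum, Finset.sum_apply] at h1
    rw [Finset.sum_apply, Pi.zero_apply]
    refine Eq.trans ?_ h1
    refine Finset.sum_congr rfl fun i _ => ?_
    rw [tensEv_tmul, Pi.smul_apply, smul_eq_mul, mul_comm]
  rw [Finsupp.sum]
  exact Finset.sum_eq_zero fun i hi' => by rw [hc i hi', TensorProduct.tmul_zero]

/-- The factorisation of `f` through the injective homomorphism `i`. -/
def through {A B C : Type u} [CommRing A] [CommRing B] [CommRing C] [Algebra k A] [Algebra k B] [Algebra k C]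
    (i : B →ₐ[k] C) (hi : Function.Injective i) (f : A →ₐ[k] C) (h : ∀ a, f a ∈ i.range) : A →ₐ[k] B :=
  ((AlgEquiv.ofInjective i hi).symm : i.range →ₐ[k] B).comp (f.codRestrict i.range h)

lemma through_apply {A B C : Type u} [CommRing A] [CommRing B] [CommRing C] [Algebra k A] [Algebra k B] [Algebra k C]
    (i : B →ₐ[k] C) (hi : Function.Injective i) (f : A →ₐ[k] C) (h : ∀ a, f a ∈ i.range) (a : A) :
    i (through i hi f h a) = f a :=
  congrArg Subtype.val ((AlgEquiv.ofInjective i hi).apply_symm_apply (f.codRestrict i.range h a))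

variable {X : Type u} [Group X] {A : Type u} [CommRing A] [Algebra k A]

/-- `a ⊗ b` as the function `(x, y) ↦ a x * b y`. -/
def ev2 (φ : A →ₐ[k] (X → F)) : A ⊗[k] A →ₐ[k] (X × X → F) := tensEv φ φ

/-- `a ⊗ (b ⊗ c)` as the function `(x, (y, z)) ↦ a x * (b y * c z)`. -/
def ev3 (φ : A →ₐ[k] (X → F)) : A ⊗[k] (A ⊗[k] A) →ₐ[k] (X × (X × X) → F) := tensEv φ (ev2 φ)

/-- The conditions on an algebra `A` of functions on a group under which it is a Hopf algebra over the
fixed field. -/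
structure IsFunHopf (φ : A →ₐ[k] (X → F)) : Prop where
  inj : Function.Injective φ
  fix : ∀ c : F, (∀ σ : F ≃ₐ[k] F, σ c = c) → ∃ d : k, algebraMap k F d = c
  equiv : ∃ s : (F ≃ₐ[k] F) → X → X, (∀ σ, s σ 1 = 1) ∧ ∀ a σ x, φ a (s σ x) = σ (φ a x)
  comul : ∀ a, ((pull k fun p : X × X => p.1 * p.2).comp φ) a ∈ (ev2 φ).range
  inv : ∀ a, ((pull k fun x : X => x⁻¹).comp φ) a ∈ φ.range

namespace IsFunHopf

variable {φ : A →ₐ[k] (X → F)}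

lemma ev2_tmul (a b : A) (x y : X) : ev2 φ (a ⊗ₜ b) (x, y) = φ a x * φ b y :=
  tensEv_tmul φ φ a b (x, y)

lemma ev3_tmul (a : A) (u : A ⊗[k] A) (x y z : X) : ev3 φ (a ⊗ₜ u) (x, (y, z)) = φ a x * ev2 φ u (y, z) :=
  tensEv_tmul φ (ev2 φ) a u (x, (y, z))

lemma ev2_add (t u : A ⊗[k] A) (p : X × X) : ev2 φ (t + u) p = ev2 φ t p + ev2 φ u p :=
  congrFun (map_add (ev2 φ) t u) p

lemma ev3_add (t u : A ⊗[k] (A ⊗[k] A)) (p : X × (X × X)) : ev3 φ (t + u) p = ev3 φ t p + ev3 φ u p :=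
  congrFun (map_add (ev3 φ) t u) p

lemma ev2_zero (p : X × X) : ev2 φ 0 p = 0 := congrFun (map_zero (ev2 φ)) p

lemma ev3_zero (p : X × (X × X)) : ev3 φ 0 p = 0 := congrFun (map_zero (ev3 φ)) p

lemma phi_add (a b : A) (x : X) : φ (a + b) x = φ a x + φ b x := congrFun (map_add φ a b) x

lemma phi_zero (x : X) : φ 0 x = 0 := congrFun (map_zero φ) x

lemma phi_mul (a b : A) (x : X) : φ (a * b) x = φ a x * φ b x := congrFun (map_mul φ a b) x

lemma phi_smul (c : k) (a : A) (x : X) : φ (c • a) x = algebraMap k F c * φ a x :=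
  (congrFun (map_smul φ c a) x).trans (Algebra.smul_def _ _)

lemma phi_algebraMap (c : k) (x : X) : φ (algebraMap k A c) x = algebraMap k F c :=
  congrFun (φ.commutes c) x

lemma ev3_assoc (u : A ⊗[k] A) (c : A) (x y z : X) :
    ev3 φ (Algebra.TensorProduct.assoc k k k A A A (u ⊗ₜ c)) (x, (y, z)) = ev2 φ u (x, y) * φ c z := by
  induction u with
  | zero => rw [TensorProduct.zero_tmul, map_zero, ev3_zero, ev2_zero, zero_mul]
  | add u v hu hv => rw [TensorProduct.add_tmul, map_add, ev3_add, hu, hv, ev2_add, add_mul]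
  | tmul a b => rw [Algebra.TensorProduct.assoc_tmul, ev3_tmul, ev2_tmul, ev2_tmul, mul_assoc]

variable (h : IsFunHopf φ)

lemma inj2 (h : IsFunHopf φ) : Function.Injective (ev2 φ) := by
  obtain ⟨s, -, hs⟩ := h.equiv
  exact tensEv_injective s h.fix hs h.inj h.inj

lemma inj3 (h : IsFunHopf φ) : Function.Injective (ev3 φ) := by
  obtain ⟨s, -, hs⟩ := h.equiv
  exact tensEv_injective s h.fix hs h.inj h.inj2

/-- The comultiplication, `a(x y) = ∑ a₁(x) a₂(y)`. -/
def comulHom : A →ₐ[k] A ⊗[k] A :=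
  through (ev2 φ) h.inj2 ((pull k fun p : X × X => p.1 * p.2).comp φ) h.comul

lemma comulHom_apply (a : A) (x y : X) : ev2 φ (h.comulHom a) (x, y) = φ a (x * y) :=
  congrFun (through_apply (ev2 φ) h.inj2 _ h.comul a) (x, y)

lemma eval_one_mem (h : IsFunHopf φ) (a : A) : ((Pi.evalAlgHom k (fun _ : X => F) 1).comp φ) a ∈ (Algebra.ofId k F).range := by
  obtain ⟨s, hs1, hs⟩ := h.equiv
  obtain ⟨d, hd⟩ := h.fix (φ a 1) fun σ => by rw [← hs, hs1]
  exact ⟨d, hd⟩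

/-- The counit, `a ↦ a(1)`. -/
def counitHom : A →ₐ[k] k :=
  through (Algebra.ofId k F) (algebraMap k F).injective ((Pi.evalAlgHom k (fun _ : X => F) 1).comp φ) h.eval_one_mem

lemma counitHom_apply (a : A) : algebraMap k F (h.counitHom a) = φ a 1 :=
  through_apply (Algebra.ofId k F) (algebraMap k F).injective _ h.eval_one_mem a

/-- The antipode, `a ↦ (x ↦ a(x⁻¹))`. -/
def antipodeHom : A →ₐ[k] A := through φ h.inj ((pull k fun x : X => x⁻¹).comp φ) h.inv

lemma antipodeHom_apply (a : A) (x : X) : φ (h.antipodeHom a) x = φ a x⁻¹ :=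
  congrFun (through_apply φ h.inj _ h.inv a) x

lemma ev3_left (t : A ⊗[k] A) (x y z : X) : ev3 φ (Algebra.TensorProduct.assoc k k k A A A
    (Algebra.TensorProduct.map h.comulHom (.id k A) t)) (x, (y, z)) = ev2 φ t (x * y, z) := by
  induction t with
  | zero => rw [map_zero, map_zero, ev3_zero, ev2_zero]
  | add u v hu hv => rw [map_add, map_add, ev3_add, hu, hv, ev2_add]
  | tmul a b =>
    rw [Algebra.TensorProduct.map_tmul, ev3_assoc, comulHom_apply, ev2_tmul, AlgHom.id_apply]

lemma ev3_right (t : A ⊗[k] A) (x y z : X) :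
    ev3 φ (Algebra.TensorProduct.map (.id k A) h.comulHom t) (x, (y, z)) = ev2 φ t (x, y * z) := by
  induction t with
  | zero => rw [map_zero, ev3_zero, ev2_zero]
  | add u v hu hv => rw [map_add, ev3_add, hu, hv, ev2_add]
  | tmul a b =>
    rw [Algebra.TensorProduct.map_tmul, ev3_tmul, comulHom_apply, ev2_tmul, AlgHom.id_apply]

lemma coassoc : (Algebra.TensorProduct.assoc k k k A A A).toAlgHom.comp
    ((Algebra.TensorProduct.map h.comulHom (.id k A)).comp h.comulHom) =
      (Algebra.TensorProduct.map (.id k A) h.comulHom).comp h.comulHom := by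
  apply AlgHom.ext
  intro a
  apply h.inj3
  funext p
  obtain ⟨x, y, z⟩ := p
  refine (h.ev3_left _ x y z).trans ((Eq.trans ?_ (h.ev3_right _ x y z).symm))
  exact (h.comulHom_apply a (x * y) z).trans
    ((congrArg (φ a) (mul_assoc x y z)).trans (h.comulHom_apply a x (y * z)).symm)

lemma lid_apply (t : A ⊗[k] A) (x : X) : φ (Algebra.TensorProduct.lid k A
    (Algebra.TensorProduct.map h.counitHom (.id k A) t)) x = ev2 φ t (1, x) := by
  induction t with
  | zero => rw [map_zero, map_zero, ev2_zero, phi_zero]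
  | add u v hu hv => rw [map_add, map_add, phi_add, hu, hv, ev2_add]
  | tmul a b =>
    rw [Algebra.TensorProduct.map_tmul, Algebra.TensorProduct.lid_tmul, ev2_tmul, phi_smul,
      counitHom_apply, AlgHom.id_apply]

lemma rid_apply (t : A ⊗[k] A) (x : X) : φ (Algebra.TensorProduct.rid k k A
    (Algebra.TensorProduct.map (.id k A) h.counitHom t)) x = ev2 φ t (x, 1) := by
  induction t with
  | zero => rw [map_zero, map_zero, ev2_zero, phi_zero]
  | add u v hu hv => rw [map_add, map_add, phi_add, hu, hv, ev2_add]
  | tmul a b =>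
    rw [Algebra.TensorProduct.map_tmul, Algebra.TensorProduct.rid_tmul, ev2_tmul, phi_smul,
      counitHom_apply, AlgHom.id_apply, mul_comm]

lemma counit_left : (Algebra.TensorProduct.map h.counitHom (.id k A)).comp h.comulHom =
    (Algebra.TensorProduct.lid k A).symm := by
  apply AlgHom.ext
  intro a
  apply (Algebra.TensorProduct.lid k A).injective
  apply h.inj
  funext x
  refine (h.lid_apply _ x).trans ?_
  refine (h.comulHom_apply a 1 x).trans ?_
  rw [one_mul]
  exact congrArg (fun b : A => φ b x) ((Algebra.TensorProduct.lid k A).apply_symm_apply a).symm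

lemma counit_right : (Algebra.TensorProduct.map (.id k A) h.counitHom).comp h.comulHom =
    (Algebra.TensorProduct.rid k k A).symm := by
  apply AlgHom.ext
  intro a
  apply (Algebra.TensorProduct.rid k k A).injective
  apply h.inj
  funext x
  refine (h.rid_apply _ x).trans ?_
  refine (h.comulHom_apply a x 1).trans ?_
  rw [mul_one]
  exact congrArg (fun b : A => φ b x) ((Algebra.TensorProduct.rid k k A).apply_symm_apply a).symm

lemma antipode_left (t : A ⊗[k] A) (x : X) :
    φ (LinearMap.mul' k A (h.antipodeHom.toLinearMap.rTensor A t)) x = ev2 φ t (x⁻¹, x) := by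
  induction t with
  | zero => rw [map_zero, map_zero, ev2_zero, phi_zero]
  | add u v hu hv => rw [map_add, map_add, phi_add, hu, hv, ev2_add]
  | tmul a b =>
    rw [LinearMap.rTensor_tmul, LinearMap.mul'_apply, ev2_tmul, phi_mul, AlgHom.toLinearMap_apply, antipodeHom_apply]

lemma antipode_right (t : A ⊗[k] A) (x : X) :
    φ (LinearMap.mul' k A (h.antipodeHom.toLinearMap.lTensor A t)) x = ev2 φ t (x, x⁻¹) := by
  induction t with
  | zero => rw [map_zero, map_zero, ev2_zero, phi_zero]
  | add u v hu hv => rw [map_add, map_add, phi_add, hu, hv, ev2_add]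
  | tmul a b =>
    rw [LinearMap.lTensor_tmul, LinearMap.mul'_apply, ev2_tmul, phi_mul, AlgHom.toLinearMap_apply, antipodeHom_apply]

/-- The bialgebra structure. -/
@[reducible]
def bialgebra : Bialgebra k A :=
  Bialgebra.ofAlgHom h.comulHom h.counitHom h.coassoc h.counit_left h.counit_right

/-- The Hopf algebra structure. -/
@[reducible]
def hopfAlgebra : HopfAlgebra k A :=
  { h.bialgebra with
    antipode := h.antipodeHom.toLinearMap
    mul_antipode_rTensor_comul := by
      apply LinearMap.ext
      intro a
      apply h.inj
      funext x
      refine (h.antipode_left _ x).trans ((h.comulHom_apply a x⁻¹ x).trans ?_)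
      rw [inv_mul_cancel]
      exact (h.counitHom_apply a).symm.trans (phi_algebraMap (h.counitHom a) x).symm
    mul_antipode_lTensor_comul := by
      apply LinearMap.ext
      intro a
      apply h.inj
      funext x
      refine (h.antipode_right _ x).trans ((h.comulHom_apply a x x⁻¹).trans ?_)
      rw [mul_inv_cancel]
      exact (h.counitHom_apply a).symm.trans (phi_algebraMap (h.counitHom a) x).symm }

end IsFunHopf
end Functions

end

/-! ### The Heisenberg group scheme -/

section

open scoped TensorProduct

section Scheme

variable {k : Type u} [Field k] (E : WeierstrassCurve k) (F : Type u) [Field F] [Algebra k F]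
  [IsAlgClosed F] [E.IsElliptic]

/-- The matrix coefficient `x ↦ ⟨x ℓ, v⟩` on `H_n(F)`, for `ℓ` in `V_n` and `v` in its dual `L(n.O)`. -/
def coef (n : ℕ) (ℓ : Module.Dual F (RR E F n)) (v : RR E F n) : Heis E F n → F :=
  fun x => thetaV n (x : Theta E F n) ℓ v

variable {E F} in
/-- An element of `L(n.O)` is defined over `k` if it is fixed by the Galois group. -/
def IsRat {n : ℕ} (v : RR E F n) : Prop := ∀ σ : F ≃ₐ[k] F, galRR n σ v = v

variable {E F} in
/-- An element of `V_n = L(n.O)^*` is defined over `k` if it commutes with the Galois group. -/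
def IsRatDual {n : ℕ} (ℓ : Module.Dual F (RR E F n)) : Prop :=
  ∀ (σ : F ≃ₐ[k] F) (v : RR E F n), ℓ (galRR n σ v) = σ (ℓ v)

/-- The coordinate ring of `H_n`, the closed subgroup scheme of `GL(V_n)` whose group of geometric
points is `H_n(F)`: the `k`-algebra of functions on `H_n(F)` generated by the matrix coefficients, over
`k`, of `x` and of `x⁻¹`. -/
def heisRing (n : ℕ) : Subalgebra k (Heis E F n → F) :=
  Algebra.adjoin k {a | ∃ (ℓ : Module.Dual F (RR E F n)) (v : RR E F n), IsRatDual ℓ ∧ IsRat v ∧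
    (a = coef E F n ℓ v ∨ a = fun x => coef E F n ℓ v x⁻¹)}

variable {E F}

lemma coef_apply {n : ℕ} (ℓ : Module.Dual F (RR E F n)) (v : RR E F n) (x : Heis E F n) :
    coef E F n ℓ v x = ℓ (thetaRR n (x : Theta E F n)⁻¹ v) := rfl

lemma coef_inv {n : ℕ} (ℓ : Module.Dual F (RR E F n)) (v : RR E F n) (x : Heis E F n) :
    coef E F n ℓ v x⁻¹ = ℓ (thetaRR n (x : Theta E F n) v) := by
  rw [coef_apply, Subgroup.coe_inv, inv_inv]

lemma coef_mem {n : ℕ} {ℓ : Module.Dual F (RR E F n)} {v : RR E F n} (hℓ : IsRatDual ℓ) (hv : IsRat v) :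
    coef E F n ℓ v ∈ heisRing E F n := Algebra.subset_adjoin ⟨ℓ, v, hℓ, hv, Or.inl rfl⟩

lemma coef_inv_mem {n : ℕ} {ℓ : Module.Dual F (RR E F n)} {v : RR E F n} (hℓ : IsRatDual ℓ) (hv : IsRat v) :
    (fun x => coef E F n ℓ v x⁻¹) ∈ heisRing E F n := Algebra.subset_adjoin ⟨ℓ, v, hℓ, hv, Or.inr rfl⟩

lemma coef_gal {n : ℕ} {ℓ : Module.Dual F (RR E F n)} {v : RR E F n} (hℓ : IsRatDual ℓ) (hv : IsRat v)
    (σ : F ≃ₐ[k] F) (x : Heis E F n) : coef E F n ℓ v (galHeis n σ x) = σ (coef E F n ℓ v x) := by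
  rw [coef_apply, coef_apply, ← hℓ, ← thetaRR_gal, hv, map_inv (galTheta (E := E) n σ)]; rfl

lemma heisRing_gal {n : ℕ} {a : Heis E F n → F} (ha : a ∈ heisRing E F n) (σ : F ≃ₐ[k] F) (x : Heis E F n) :
    a (galHeis n σ x) = σ (a x) := by
  revert x
  induction ha using Algebra.adjoin_induction with
  | mem a ha =>
    intro x
    obtain ⟨ℓ, v, hℓ, hv, rfl | rfl⟩ := ha
    · exact coef_gal hℓ hv σ x
    · change coef E F n ℓ v (galHeis n σ x)⁻¹ = _
      rw [← map_inv]
      exact coef_gal hℓ hv σ x⁻¹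
  | algebraMap r =>
    intro x
    exact (σ.commutes r).symm
  | add a b _ _ ha hb =>
    intro x
    rw [Pi.add_apply, Pi.add_apply, ha, hb, map_add]
  | mul a b _ _ ha hb =>
    intro x
    rw [Pi.mul_apply, Pi.mul_apply, ha, hb, map_mul]

lemma isRatDual_coord {n : ℕ} {ι : Type} [Fintype ι] (b : Module.Basis ι F (RR E F n))
    (hb : ∀ i, IsRat (b i)) (i : ι) : IsRatDual (b.coord i) := by
  intro σ v
  have h1 : galRR n σ v = ∑ i, σ (b.repr v i) • b i := by
    nth_rewrite 1 [← b.sum_repr v]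
    rw [galRR_sum]
    exact Finset.sum_congr rfl fun i _ => by rw [galRR_smul, hb]
  rw [Module.Basis.coord_apply, Module.Basis.coord_apply, h1, b.repr_sum_self]

lemma apply_eq_sum {n : ℕ} {ι : Type} [Fintype ι] (b : Module.Basis ι F (RR E F n))
    (ℓ : Module.Dual F (RR E F n)) (f : RR E F n →ₗ[F] RR E F n) (w : RR E F n) :
    ℓ (f w) = ∑ i, b.coord i w * ℓ (f (b i)) := by
  nth_rewrite 1 [← b.sum_repr w]
  rw [map_sum, map_sum]
  exact Finset.sum_congr rfl fun i _ => by
    rw [map_smul, map_smul, smul_eq_mul, Module.Basis.coord_apply]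

lemma heisRing_comul (n : ℕ) : heisRing E F n ≤
    (ev2 (heisRing E F n).val).range.comap (pull k fun p : Heis E F n × Heis E F n => p.1 * p.2) := by
  obtain ⟨ι, _, b, hb⟩ := exists_basis (k := k) (E := E) (F := F) n
  refine Algebra.adjoin_le ?_
  rintro a ⟨ℓ, v, hℓ, hv, rfl | rfl⟩
  · refine ⟨∑ i, ⟨_, coef_mem (isRatDual_coord b hb i) hv⟩ ⊗ₜ[k] ⟨_, coef_mem hℓ (hb i)⟩, ?_⟩
    funext p
    obtain ⟨x, y⟩ := p
    change ev2 (heisRing E F n).val _ (x, y) = coef E F n ℓ v (x * y)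
    rw [map_sum, Finset.sum_apply, coef_apply, Subgroup.coe_mul, mul_inv_rev, map_mul]
    refine Eq.trans ?_ (apply_eq_sum b ℓ (thetaRR n (y : Theta E F n)⁻¹) (thetaRR n (x : Theta E F n)⁻¹ v)).symm
    exact Finset.sum_congr rfl fun i _ => IsFunHopf.ev2_tmul _ _ _ _
  · refine ⟨∑ i, ⟨_, coef_inv_mem hℓ (hb i)⟩ ⊗ₜ[k] ⟨_, coef_inv_mem (isRatDual_coord b hb i) hv⟩, ?_⟩
    funext p
    obtain ⟨x, y⟩ := p
    change ev2 (heisRing E F n).val _ (x, y) = coef E F n ℓ v (x * y)⁻¹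
    rw [map_sum, Finset.sum_apply, coef_inv, Subgroup.coe_mul, map_mul]
    refine Eq.trans ?_ (apply_eq_sum b ℓ (thetaRR n (x : Theta E F n)) (thetaRR n (y : Theta E F n) v)).symm
    refine Finset.sum_congr rfl fun i _ => (IsFunHopf.ev2_tmul _ _ _ _).trans ?_
    change coef E F n ℓ (b i) x⁻¹ * coef E F n (b.coord i) v y⁻¹ = _
    rw [coef_inv, coef_inv, mul_comm]

lemma heisRing_inv (n : ℕ) : heisRing E F n ≤ (heisRing E F n).comap (pull k fun x : Heis E F n => x⁻¹) := by
  refine Algebra.adjoin_le ?_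
  rintro a ⟨ℓ, v, hℓ, hv, rfl | rfl⟩
  · exact coef_inv_mem hℓ hv
  · have : (pull k fun x : Heis E F n => x⁻¹) (fun x => coef E F n ℓ v x⁻¹) = coef E F n ℓ v := by
      funext x
      exact congrArg (coef E F n ℓ v) (inv_inv x)
    change (pull k fun x : Heis E F n => x⁻¹) (fun x => coef E F n ℓ v x⁻¹) ∈ heisRing E F n
    rw [this]
    exact coef_mem hℓ hv

variable [CharZero k] [Algebra.IsAlgebraic k F]

lemma heisRing_isFunHopf (n : ℕ) : IsFunHopf (heisRing E F n).val where
  inj := Subtype.val_injective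
  fix c hc := by
    have : IsAlgClosure k F := ⟨inferInstance, inferInstance⟩
    have := (InfiniteGalois.mem_bot_iff_fixed (k := k) c).mpr hc
    exact IntermediateField.mem_bot.mp this
  equiv := ⟨fun σ => galHeis n σ, fun σ => map_one _, fun a => heisRing_gal a.2⟩
  comul a := heisRing_comul n a.2
  inv a := ⟨⟨_, heisRing_inv n a.2⟩, rfl⟩

/-- The Hopf algebra structure of the coordinate ring: the comultiplication is `a(x y) = ∑ a₁(x) a₂(y)`. -/
instance heisRing_hopf (n : ℕ) : HopfAlgebra k (heisRing E F n) := (heisRing_isFunHopf n).hopfAlgebra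

end Scheme

section Points

open CategoryTheory AlgebraicGeometry Opposite

variable {k : Type u} [Field k] [CharZero k] (E : WeierstrassCurve k) [E.IsElliptic]
  (F : Type u) [Field F] [Algebra k F] [IsAlgClosed F] [Algebra.IsAlgebraic k F]

/-- The Heisenberg group `H_n`, as a `k`-group scheme. -/
def heisScheme (n : ℕ) : Grp (Over (Spec (CommRingCat.of k))) :=
  (hopfSpec (CommRingCat.of k)).obj (op (CommHopfAlgCat.of k (heisRing E F n)))

variable (k) in
/-- `Spec F` as a `k`-scheme. -/
abbrev geomPt : Over (Spec (CommRingCat.of k)) := (algSpec (CommRingCat.of k)).obj (op (CommAlgCat.of k F))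

variable {E F}

/-- The `F`-point of the scheme `H_n` given by an element of `H_n(F)`. -/
def heisPt {n : ℕ} (x : Heis E F n) : geomPt k F ⟶ (heisScheme E F n).X :=
  (algSpec (CommRingCat.of k)).map (CommAlgCat.ofHom
    ((Pi.evalAlgHom k (fun _ : Heis E F n => F) x).comp (heisRing E F n).val)).op

end Points

end

end
end EllHeis

open EllHeis CategoryTheory AlgebraicGeometry MonoidalCategory

namespace EllHeis
noncomputable section

open scoped Classical
set_option linter.unusedSectionVars false

section

open WeierstrassCurve WeierstrassCurve.Affine Polynomial
open scoped Polynomial.Bivariate nonZeroDivisors WithZero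

/-! ### Evaluation at points and zeros of regular functions -/

section Evaluation

variable {k : Type u} [Field k] {E : WeierstrassCurve k} {F : Type u} [Field F] [Algebra k F]

/-! A pair `(c, 0)` acts on `L(n.O)`, which has dimension `n`, as the scalar `c⁻¹`. Hence the group
of geometric points of `H_n` is an extension of `E[n]` by the `n`-th roots of unity. It is finite,
because `E[n]` is. Torsion points lift to the theta group because sending a point to the class of
its ideal in the affine coordinate ring is a homomorphism.

The crux is that `(f, T) ↦ (f ^ j, T)` carries `H_n` into the Heisenberg group of level `nj`: it
raises determinants to the power `j²` (`det_powTheta`). Both sides change in the same way under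
constants, so `(f, T)` may be assumed to have order `d`, the order of `T`. Its eigenvalues are then
`d`-th roots of unity, and each eigenspace has dimension at most `n/d` (`finrank_eigenspace_le`).
Indeed, an eigenfunction vanishing at `n/d` points in different orbits of translation by `T`
vanishes at all `n` points of these orbits. Its pole order is at most `n`, so these are all its
zeros, they are simple and they add up to zero; the orbits are chosen so that they do not. As the
eigenspaces must fill dimension `n`, every `d`-th root of unity has multiplicity exactly `n/d`. The
determinant is therefore the `(n/d)`-th power of the product of the `d`-th roots of unity, which is
a sign. At level `nj` the exponent is multiplied by `j`, and `j` and `j²` have the same parity.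

The rest on points is group theory. The images of `H_m` and `H_n` commute, since a commutator of
theta elements is a scalar and here it is killed by both `m` and `n`. Bijectivity follows from
Bézout's identity, applied to torsion points and to roots of unity.

For the schemes, the isomorphism on points is Galois equivariant. Since the groups are finite and
matrix coefficients separate points, Galois descent shows that each coordinate ring consists of all
equivariant functions (`mem_range_of_equivariant`). Pull-back along the two projections then
identifies the tensor product of the coordinate rings for `m` and `n` with that for `mn`, and `Spec`
gives the isomorphism. -/

/-- Evaluation of regular functions at an affine point. -/
def evalPt {a b : F} (h : (E.toAffine.baseChange F).Equation a b) : CRing E F →ₐ[F] F :=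
  { AdjoinRoot.lift (evalRingHom a) b (by
      have h' : (eval (C b) (E.toAffine.baseChange F).polynomial).eval a = 0 := h
      rw [← h', ← coe_evalRingHom, ← eval₂_hom, coe_evalRingHom, eval_C]) with
    commutes' := fun c => by
      change AdjoinRoot.lift (evalRingHom a) b _ (AdjoinRoot.of _ (C c)) = _
      rw [AdjoinRoot.lift_of]
      exact eval_C }

lemma evalPt_mk {a b : F} (h : (E.toAffine.baseChange F).Equation a b) (p : F[X][X]) :
    evalPt h (CoordinateRing.mk _ p) = p.eval₂ (evalRingHom a) b := rfl

lemma evalPt_xR {a b : F} (h : (E.toAffine.baseChange F).Equation a b) : evalPt h (xR E F) = a := by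
  rw [xR, evalPt_mk, eval₂_C, coe_evalRingHom, eval_X]

lemma evalPt_yR {a b : F} (h : (E.toAffine.baseChange F).Equation a b) : evalPt h (yR E F) = b := by
  rw [yR, evalPt_mk, eval₂_X]

/-- The kernel of evaluation is proper and contains the ideal of the point, which is maximal. -/
lemma evalPt_eq_zero {a b : F} (h : (E.toAffine.baseChange F).Equation a b) (r : CRing E F) :
    evalPt h r = 0 ↔ r ∈ ptIdeal E a b := by
  have : ptIdeal E a b = RingHom.ker (evalPt h) := by
    refine (ptIdeal_isMaximal h).eq_of_le (RingHom.ker_ne_top _) ?_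
    rw [ptIdeal_eq, Ideal.span_le]
    rintro r (rfl | rfl)
    · simp [RingHom.mem_ker, evalPt_xR]
    · simp [RingHom.mem_ker, evalPt_yR]
  rw [this, RingHom.mem_ker]

/-- The value of a regular function at a point, taken to be `0` at the origin. -/
def ev : Pts E F → CRing E F →ₗ[F] F
  | .zero => 0
  | .some _ _ h => (evalPt h.1).toLinearMap

/-- The ideal of regular functions vanishing at a point. -/
def vanIdeal : Pts E F → Ideal (CRing E F)
  -- The origin is not on the affine curve. The unit ideal fits both the value `0` that `ev` takes
  -- there and the trivial ideal class.
  | .zero => ⊤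
  | .some a b _ => ptIdeal E a b

lemma ev_eq_zero (P : Pts E F) (r : CRing E F) : ev P r = 0 ↔ r ∈ vanIdeal P := by
  rcases P with _ | ⟨a, b, h⟩
  · exact iff_of_true rfl trivial
  · exact evalPt_eq_zero h.1 r

lemma ev_algebraMap {P : Pts E F} (hP : P ≠ 0) (c : F) : ev P (algebraMap F (CRing E F) c) = c := by
  rcases P with _ | ⟨a, b, h⟩
  · exact absurd rfl hP
  · exact (evalPt h.1).commutes c

lemma vanIdeal_ne_bot (P : Pts E F) : vanIdeal P ≠ ⊥ := by
  rcases P with _ | ⟨a, b, h⟩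
  · exact top_ne_bot
  · exact ptIdeal_ne_bot

lemma vanIdeal_isMaximal {P : Pts E F} (hP : P ≠ 0) : (vanIdeal P).IsMaximal := by
  rcases P with _ | ⟨a, b, h⟩
  · exact absurd rfl hP
  · exact ptIdeal_isMaximal h.1

/-- Distinct maximal ideals are comaximal, and the unit ideal is comaximal with everything. The
ideal determines its point, because `x - a` and `y - b` both vanish at `(c, d)` only if the points
agree. -/
lemma vanIdeal_isCoprime {P Q : Pts E F} (h : P ≠ Q) : IsCoprime (vanIdeal P) (vanIdeal Q) := by
  by_cases hP : P = 0
  · subst hP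
    exact Ideal.isCoprime_iff_sup_eq.mpr (top_sup_eq _)
  by_cases hQ : Q = 0
  · subst hQ
    exact Ideal.isCoprime_iff_sup_eq.mpr (sup_top_eq _)
  refine Ideal.isCoprime_iff_sup_eq.mpr ((vanIdeal_isMaximal hP).coprime_of_ne (vanIdeal_isMaximal hQ) fun e => h ?_)
  rcases P with _ | ⟨a, b, hab⟩
  · exact absurd rfl hP
  rcases Q with _ | ⟨c, d, hcd⟩
  · exact absurd rfl hQ
  have e : ptIdeal E a b = ptIdeal E c d := e
  have hx : xR E F - algebraMap F _ a ∈ ptIdeal E c d := by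
    have : xR E F - algebraMap F _ a ∈ ptIdeal E a b := by
      rw [ptIdeal_eq]; exact Ideal.subset_span (by simp)
    exact e ▸ this
  have hy : yR E F - algebraMap F _ b ∈ ptIdeal E c d := by
    have : yR E F - algebraMap F _ b ∈ ptIdeal E a b := by
      rw [ptIdeal_eq]; exact Ideal.subset_span (by simp)
    exact e ▸ this
  rw [← evalPt_eq_zero hcd.1, map_sub, AlgHom.commutes, sub_eq_zero] at hx hy
  rw [evalPt_xR] at hx
  rw [evalPt_yR] at hy
  subst hx hy
  rfl

/-- The coordinate ring is free of rank two over `F[X]`, so by Smith normal form the quotient is a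
sum of two proper quotients of `F[X]`. -/
lemma finite_quotient {I : Ideal (CRing E F)} (h : I ≠ ⊥) : Module.Finite F (CRing E F ⧸ I) :=
  have := Fintype.ofFinite (Fin 2)
  Module.Finite.equiv (Ideal.quotientEquivDirectSum F (CoordinateRing.basis (E.toAffine.baseChange F)) h).symm

/-- The left side counts zeros with multiplicity: a function has as many zeros as its pole at the
origin demands. -/
lemma finrank_quotient {r : CRing E F} (hr : r ≠ 0) :
    Module.finrank F (CRing E F ⧸ Ideal.span {r}) = poleDeg E r :=
  finrank_quotient_span_eq_natDegree_norm (CoordinateRing.basis _) hr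

/-- The values of a regular function at a finite set of points. -/
def evFinset (A : Finset (Pts E F)) : CRing E F →ₗ[F] (A → F) := LinearMap.pi fun P => ev P.1

/-- Chinese remainder theorem for the ideals of the points, applied to the prescribed values as
constants. The origin is excluded because values there are `0` by convention. -/
lemma evFinset_surjective {A : Finset (Pts E F)} (hA : 0 ∉ A) : Function.Surjective (evFinset A) := by
  intro v
  obtain ⟨r, hr⟩ := Ideal.exists_forall_sub_mem_ideal (I := fun P : A => vanIdeal P.1)
    (fun P Q h => vanIdeal_isCoprime fun e => h (Subtype.ext e)) (fun P => algebraMap F _ (v P))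
  refine ⟨r, funext fun P => ?_⟩
  have h1 := (ev_eq_zero P.1 _).mpr (hr P)
  rw [map_sub, ev_algebraMap (fun h => hA (h ▸ P.2)), sub_eq_zero] at h1
  exact h1

lemma ker_evFinset (A : Finset (Pts E F)) (r : CRing E F) : evFinset A r = 0 ↔ r ∈ ∏ P ∈ A, vanIdeal P := by
  rw [Ideal.prod_eq_iInf_of_pairwise_isCoprime fun P _ Q _ h => vanIdeal_isCoprime h]
  simp only [Ideal.mem_iInf, ← ev_eq_zero]
  exact ⟨fun h P hP => congrFun h ⟨P, hP⟩, fun h => funext fun P => h P.1 P.2⟩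

/-- A regular function vanishing on `A`, as a map from the quotient by it. -/
def evQuot {A : Finset (Pts E F)} {r : CRing E F} (h : evFinset A r = 0) :
    (CRing E F ⧸ Ideal.span {r}) →ₗ[F] (A → F) :=
  Submodule.liftQ ((Ideal.span {r}).restrictScalars F) (evFinset A) (by
    intro s hs
    rw [Submodule.restrictScalars_mem, Ideal.mem_span_singleton'] at hs
    obtain ⟨t, rfl⟩ := hs
    rw [LinearMap.mem_ker, ker_evFinset] at *
    exact Ideal.mul_mem_left _ _ h)

lemma evQuot_mk {A : Finset (Pts E F)} {r : CRing E F} (h : evFinset A r = 0) (s : CRing E F) :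
    evQuot h (Ideal.Quotient.mk _ s) = evFinset A s := rfl

/-- A nonzero regular function has at most as many zeros as its pole order. -/
lemma card_le_poleDeg {A : Finset (Pts E F)} (hA : 0 ∉ A) {r : CRing E F} (hr : r ≠ 0)
    (h : ∀ P ∈ A, r ∈ vanIdeal P) : A.card ≤ poleDeg E r := by
  have h0 : evFinset A r = 0 := funext fun P => (ev_eq_zero _ _).mpr (h P.1 P.2)
  have := finite_quotient (E := E) (mt Ideal.span_singleton_eq_bot.mp hr)
  -- Evaluation on `A` factors through a quotient of dimension `poleDeg E r`, and it is onto a space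
  -- of dimension `A.card`.
  have hs : Function.Surjective (evQuot h0) := fun v =>
    (evFinset_surjective hA v).imp' (Ideal.Quotient.mk _) fun _ h => h
  have := LinearMap.finrank_le_finrank_of_surjective hs
  rwa [finrank_quotient hr, Module.finrank_fintype_fun_eq_card, Fintype.card_coe] at this

/-- When the number of zeros reaches the pole order, the surjection from the quotient by `r` to the
functions on `A` is between spaces of equal dimension. It is thus injective, so every function
vanishing on `A` is a multiple of `r`. -/
lemma prod_vanIdeal_eq {A : Finset (Pts E F)} (hA : 0 ∉ A) {r : CRing E F} (hr : r ≠ 0)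
    (h : ∀ P ∈ A, r ∈ vanIdeal P) (hd : poleDeg E r ≤ A.card) :
    ∏ P ∈ A, vanIdeal P = Ideal.span {r} := by
  have h0 : evFinset A r = 0 := funext fun P => (ev_eq_zero _ _).mpr (h P.1 P.2)
  have := finite_quotient (E := E) (mt Ideal.span_singleton_eq_bot.mp hr)
  have hs : Function.Surjective (evQuot h0) := fun v =>
    (evFinset_surjective hA v).imp' (Ideal.Quotient.mk _) fun _ h => h
  have hi : Function.Injective (evQuot h0) := by
    refine (LinearMap.injective_iff_surjective_of_finrank_eq_finrank ?_).mpr hs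
    rw [finrank_quotient hr, Module.finrank_fintype_fun_eq_card, Fintype.card_coe]
    exact le_antisymm hd (card_le_poleDeg hA hr h)
  apply le_antisymm
  · intro s hs
    rw [← ker_evFinset, ← evQuot_mk h0] at hs
    exact Ideal.Quotient.eq_zero_iff_mem.mp (hi (hs.trans (map_zero _).symm))
  · rw [Ideal.span_singleton_le_iff_mem, ← ker_evFinset]
    exact h0

variable [IsAlgClosed F] [E.IsElliptic]

/-- The vanishing ideal of a point, as a nonzero ideal. -/
def vanIdeal₀ (P : Pts E F) : (Ideal (CRing E F))⁰ :=
  ⟨vanIdeal P, mem_nonZeroDivisors_of_ne_zero (vanIdeal_ne_bot P)⟩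

/-- Rewrites the class of a point with integral ideals, so that products of vanishing ideals can be
compared with sums of points. -/
lemma toClass_eq_mk0 (P : Pts E F) : Point.toClass P =
    Additive.ofMul (ClassGroup.mk0 (vanIdeal₀ P)) := by
  rcases P with _ | ⟨a, b, h⟩
  · have : vanIdeal₀ (Point.zero : Pts E F) = 1 := Subtype.ext Ideal.one_eq_top.symm
    rw [this, map_one]
    rfl
  · rw [Point.toClass_some, ← ClassGroup.mk_mk0 (R := CRing E F) (FF E F)]
    refine congrArg (fun I => Additive.ofMul (ClassGroup.mk (FF E F) I)) (Units.ext ?_)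
    rw [CoordinateRing.XYIdeal'_eq]
    rfl

/-- One half of Abel's theorem: a principal product has trivial class, and the map from points to
ideal classes is an injective homomorphism. -/
lemma toClass_sum_eq_zero {ι : Type*} (s : Finset ι) (P : ι → Pts E F) {r : CRing E F}
    (h : ∏ i ∈ s, vanIdeal (P i) = Ideal.span {r}) : ∑ i ∈ s, P i = 0 := by
  apply Point.toClass_injective
  have h1 : ∏ i ∈ s, vanIdeal (P i) ≠ ⊥ := Finset.prod_ne_zero_iff.mpr fun i _ => vanIdeal_ne_bot (P i)
  have h2 : Point.toClass (∑ i ∈ s, P i) =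
      Additive.ofMul (ClassGroup.mk0 ⟨_, mem_nonZeroDivisors_of_ne_zero h1⟩) := by
    rw [map_sum]
    trans Additive.ofMul (ClassGroup.mk0 (∏ i ∈ s, vanIdeal₀ (P i)))
    · rw [map_prod, ofMul_prod]
      exact Finset.sum_congr rfl fun i _ => toClass_eq_mk0 (P i)
    · congr 2
      exact Subtype.ext (SubmonoidClass.coe_finsetProd _ _)
  rw [h2, map_zero]
  refine ofMul_eq_zero.mpr ((ClassGroup.mk0_eq_one_iff _).mpr ?_)
  rw [h]
  exact ⟨⟨r, rfl⟩⟩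

/-- The zeros of a regular function with simple zeros only sum up to `0`. -/
lemma sum_eq_zero_of_poleDeg_le {A : Finset (Pts E F)} (hA : 0 ∉ A) {r : CRing E F} (hr : r ≠ 0)
    (h : ∀ P ∈ A, r ∈ vanIdeal P) (hd : poleDeg E r ≤ A.card) : ∑ P ∈ A, P = 0 :=
  toClass_sum_eq_zero A id (prod_vanIdeal_eq hA hr h hd)

end Evaluation

/-! ### Regular functions and Riemann-Roch spaces -/

section RiemannRoch

variable {k : Type u} [Field k] {E : WeierstrassCurve k} {F : Type u} [Field F] [Algebra k F]
  [IsAlgClosed F] [E.IsElliptic]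

lemma algebraMap_FF_ne_zero {r : CRing E F} (hr : r ≠ 0) : algebraMap (CRing E F) (FF E F) r ≠ 0 :=
  fun h => hr (IsFractionRing.injective (CRing E F) (FF E F) (h.trans (map_zero _).symm))

lemma ord_nonneg {P : Pts E F} (hP : P ≠ 0) {r : CRing E F} (hr : r ≠ 0) :
    0 ≤ ord P (algebraMap (CRing E F) (FF E F) r) := by
  have h := neg_le_ord_iff (algebraMap_FF_ne_zero hr) P 0
  rw [neg_zero, WithZero.exp_zero] at h
  rw [h]
  rcases P with _ | ⟨a, b, hab⟩
  · exact absurd rfl hP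
  · exact ptVal_CRing_le hab r

/-- Away from the origin the order is the adic valuation of the maximal ideal of the point. -/
lemma le_ord_iff {P : Pts E F} (hP : P ≠ 0) {r : CRing E F} (hr : r ≠ 0) (n : ℕ) :
    (n : ℤ) ≤ ord P (algebraMap (CRing E F) (FF E F) r) ↔ r ∈ vanIdeal P ^ n := by
  rcases P with _ | ⟨a, b, h⟩
  · exact absurd rfl hP
  have h1 := neg_le_ord_iff (algebraMap_FF_ne_zero hr) (Point.some a b h : Pts E F) (-n)
  rw [neg_neg] at h1
  rw [h1]
  change (ptSpec E h).valuation (FF E F) _ ≤ _ ↔ r ∈ (ptSpec E h).asIdeal ^ n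
  rw [IsDedekindDomain.HeightOneSpectrum.valuation_of_algebraMap,
    IsDedekindDomain.HeightOneSpectrum.intValuation_le_pow_iff_mem]

lemma one_le_ord_iff {P : Pts E F} (hP : P ≠ 0) {r : CRing E F} (hr : r ≠ 0) :
    1 ≤ ord P (algebraMap (CRing E F) (FF E F) r) ↔ r ∈ vanIdeal P := by
  have := le_ord_iff hP hr 1
  rwa [pow_one] at this

lemma ord_zero_algebraMap {r : CRing E F} (hr : r ≠ 0) :
    ord (0 : Pts E F) (algebraMap (CRing E F) (FF E F) r) = -(poleDeg E r : ℤ) := by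
  rw [ord, ptVal_zero, infVal_apply, infValR_apply E hr, WithZero.log_exp]

lemma algebraMap_mem_RR {n : ℕ} {r : CRing E F} (hr : (Algebra.norm F[X] r).degree ≤ n) :
    algebraMap (CRing E F) (FF E F) r ∈ RR E F n := by
  intro h0 P
  have hr0 : r ≠ 0 := by rintro rfl; exact h0 (map_zero _)
  by_cases hP : P = 0
  · subst hP
    rw [nO, if_pos rfl, div, ord_zero_algebraMap hr0, neg_le_neg_iff]
    exact_mod_cast natDegree_le_of_degree_le hr
  · rw [nO, if_neg hP, neg_zero]
    exact ord_nonneg hP hr0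

lemma exists_of_mem_RR {n : ℕ} {f : FF E F} (hf : f ∈ RR E F n) :
    ∃ r : CRing E F, algebraMap _ _ r = f ∧ poleDeg E r ≤ n := by
  obtain ⟨r, h1, h2⟩ := mem_RR_bound hf
  exact ⟨r, h1, natDegree_le_of_degree_le h2⟩

/-- The functions without poles are constant. -/
lemma exists_const_of_mem_RR_zero {f : FF E F} (hf : f ∈ RR E F 0) : ∃ c : F, f = algebraMap F _ c := by
  have h := RR_le_span 0 hf
  -- Since `x` and `y` have poles of order 2 and 3, the only monomial without a pole is `1`.
  have h1 : mono (E := E) (F := F) '' monoIdx 0 ⊆ {1} := by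
    rintro _ ⟨⟨i, b⟩, hj, rfl⟩
    have hj' : 2 * i + (if b then 3 else 0) ≤ 0 := hj
    cases b
    · have : i = 0 := by simpa using hj'
      subst this
      simp [mono]
    · simp at hj'
  obtain ⟨c, hc⟩ := Submodule.mem_span_singleton.mp (Submodule.span_mono h1 h)
  exact ⟨c, by rw [← hc, Algebra.algebraMap_eq_smul_one]⟩

/-- The linear map `(p, q) ↦ p(x) + q(x) y`. -/
def polyMap : F[X] × F[X] →ₗ[F] CRing E F :=
  (aeval (xR E F)).toLinearMap.coprod ((LinearMap.mulRight F (yR E F)).comp (aeval (xR E F)).toLinearMap)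

lemma polyMap_apply (p q : F[X]) : polyMap (E := E) (p, q) = aeval (xR E F) p + aeval (xR E F) q * yR E F := rfl

/-- The norm of `p(x) + q(x) y` has degree `max (2 deg p) (2 deg q + 3)`, which is `⊥` only when
both polynomials vanish. -/
lemma polyMap_injective : Function.Injective (polyMap (E := E) (F := F)) := by
  rw [injective_iff_map_eq_zero]
  rintro ⟨p, q⟩ h
  rw [polyMap_apply] at h
  have h1 := norm_degree (E := E) p q
  rw [h, Algebra.norm_zero, degree_zero, eq_comm, max_eq_bot] at h1
  refine Prod.ext (degree_eq_bot.mp ?_) (degree_eq_bot.mp ?_)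
  · by_contra h2
    rw [degree_eq_natDegree (fun h => h2 (degree_eq_bot.mpr h))] at h1
    exact WithBot.coe_ne_bot h1.1
  · by_contra h2
    rw [degree_eq_natDegree (fun h => h2 (degree_eq_bot.mpr h))] at h1
    exact WithBot.coe_ne_bot h1.2

/-- Turns a bound on the pole order into a bound on degrees. It is used with `c = 0` for `p` and `c
= 3` for `q`; the zero polynomial satisfies both sides. -/
lemma degree_aux (p : F[X]) (c n a : ℕ) (h : ∀ i : ℕ, 2 * i + c ≤ n ↔ i < a) :
    2 • p.degree + c ≤ n ↔ p.degree < a := by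
  by_cases hp : p = 0
  · subst hp
    simp
  · rw [degree_eq_natDegree hp, nsmul_eq_mul]
    exact_mod_cast h p.natDegree

/-- The dimension of the Riemann-Roch space. -/
lemma finrank_RR {n : ℕ} (hn : 0 < n) : Module.finrank F (RR E F n) = n := by
  -- The bounds say `2 deg p ≤ n` and `2 deg q + 3 ≤ n`. The two dimensions add up to `n` for `n >
  -- 0`, whatever its parity.
  let S := Polynomial.degreeLT F (n / 2 + 1)
  let T := Polynomial.degreeLT F ((n - 1) / 2)
  let f : S × T →ₗ[F] FF E F := (IsScalarTower.toAlgHom F (CRing E F) (FF E F)).toLinearMap ∘ₗ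
    polyMap ∘ₗ S.subtype.prodMap T.subtype
  have hf : Function.Injective f := (IsFractionRing.injective (CRing E F) (FF E F)).comp
    (polyMap_injective.comp (Prod.map_injective.mpr ⟨Subtype.val_injective, Subtype.val_injective⟩))
  have hiff : ∀ p q : F[X], (Algebra.norm F[X] (aeval (xR E F) p + aeval (xR E F) q * yR E F)).degree ≤ n ↔
      p ∈ S ∧ q ∈ T := by
    intro p q
    rw [norm_degree, max_le_iff, Polynomial.mem_degreeLT, Polynomial.mem_degreeLT,
      ← degree_aux p 0 n _ fun i => by omega, ← degree_aux q 3 n _ fun i => by omega]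
    simp
  have hr : LinearMap.range f = RR E F n := by
    ext g
    constructor
    · rintro ⟨⟨p, q⟩, rfl⟩
      exact algebraMap_mem_RR ((hiff p q).mpr ⟨p.2, q.2⟩)
    · intro hg
      obtain ⟨r, rfl, hr⟩ := mem_RR_bound hg
      obtain ⟨p, q, rfl⟩ := exists_eq E F r
      exact ⟨(⟨p, ((hiff p q).mp hr).1⟩, ⟨q, ((hiff p q).mp hr).2⟩), rfl⟩
  have hd : ∀ j, Module.finrank F (Polynomial.degreeLT F j) = j := fun j => by
    rw [(Polynomial.degreeLTEquiv F j).finrank_eq, Module.finrank_fin_fun]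
  have := (Polynomial.degreeLTEquiv F (n / 2 + 1)).symm.finiteDimensional
  have := (Polynomial.degreeLTEquiv F ((n - 1) / 2)).symm.finiteDimensional
  rw [← hr, LinearMap.finrank_range_of_inj hf, Module.finrank_prod, hd, hd]
  omega

/-- A rational function invariant under infinitely many translations is constant. -/
lemma exists_const_of_transl {g : FF E F} (hg : {T : Pts E F | transl T g = g}.Infinite) :
    ∃ c : F, g = algebraMap F _ c := by
  refine exists_const_of_mem_RR_zero fun h0 P => ?_
  have h1 : nO E F 0 P = 0 := by rw [nO]; split_ifs <;> rfl
  rw [h1, neg_zero, div]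
  by_contra hneg
  rw [not_le] at hneg
  obtain ⟨r, s, hs, rfl⟩ := IsFractionRing.div_surjective (CRing E F) g
  have hs0 : s ≠ 0 := nonZeroDivisors.ne_zero hs
  have hr0 : r ≠ 0 := by rintro rfl; exact h0 (by rw [map_zero, zero_div])
  -- A pole at `P` reappears at `P + T` for every translation fixing `g`. Away from the origin a
  -- pole of `r / s` is a zero of `s`, and `s` has only finitely many. The value `T = -P`, which
  -- leads to the origin, is discarded.
  have hinf : {Q : Pts E F | Q ≠ 0 ∧ s ∈ vanIdeal Q}.Infinite := by
    have h2 := (hg.sdiff (Set.finite_singleton (-P))).image (f := fun T => P + T) (add_right_injective P).injOn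
    refine h2.mono ?_
    rintro _ ⟨T, ⟨hT, hTP⟩, rfl⟩
    have hne : P + T ≠ 0 := fun h => hTP (eq_neg_of_add_eq_zero_right h)
    refine ⟨hne, ?_⟩
    have h3 := ord_transl P T (algebraMap (CRing E F) (FF E F) r / algebraMap _ _ s)
    rw [hT] at h3
    rw [h3, div_eq_mul_inv, ord_mul _ (algebraMap_FF_ne_zero hr0) (inv_ne_zero (algebraMap_FF_ne_zero hs0)),
      ord_inv] at hneg
    rw [← one_le_ord_iff hne hs0]
    have := ord_nonneg hne hr0
    omega
  obtain ⟨A, hA, hc⟩ := hinf.exists_subset_card_eq (poleDeg E s + 1)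
  have := card_le_poleDeg (A := A) (fun h => (hA h).1 rfl) hs0 fun P hP => (hA hP).2
  omega

end RiemannRoch

/-! ### Torsion points -/

section Torsion

variable {k : Type u} [Field k] {E : WeierstrassCurve k} {F : Type u} [Field F] [Algebra k F]
  [IsAlgClosed F] [E.IsElliptic]

-- The second coordinate is a root of a monic quadratic, and on an elliptic curve every solution of
-- the equation is nonsingular.
variable (E) in
lemma exists_point_of_x (a : F) : ∃ b : F, (E.toAffine.baseChange F).Nonsingular a b := by
  set u := algebraMap k F E.a₁ * a + algebraMap k F E.a₃ with hu
  set v := a ^ 3 + algebraMap k F E.a₂ * a ^ 2 + algebraMap k F E.a₄ * a + algebraMap k F E.a₆ with hv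
  obtain ⟨b, hb⟩ := IsAlgClosed.exists_root (X ^ 2 + (C u * X - C v) : F[X]) (by
    have : (X ^ 2 + (C u * X - C v) : F[X]).degree = 2 := by compute_degree!
    rw [this]; decide)
  have hb' : b ^ 2 + u * b - v = 0 := by
    simpa [IsRoot, add_sub_assoc] using hb
  refine ⟨b, equation_iff_nonsingular.mp ?_⟩
  rw [equation_iff]
  change b ^ 2 + algebraMap k F E.a₁ * a * b + algebraMap k F E.a₃ * b =
    a ^ 3 + algebraMap k F E.a₂ * a ^ 2 + algebraMap k F E.a₄ * a + algebraMap k F E.a₆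
  linear_combination hb'

instance infinite_Pts : Infinite (Pts E F) := by
  choose b h using exists_point_of_x (F := F) E
  have := IsAlgClosed.instInfinite (K := F)
  exact Infinite.of_injective (fun a => (Point.some a (b a) (h a) : Pts E F)) fun a a' e =>
    ((Point.some.injEq ..).mp e).1

/-- A point is killed by 2 when it equals its negative, and negation sends `b` to `-b - a₁ a - a₃`.
-/
lemma two_nsmul_eq_zero_iff {a b : F} (h : (E.toAffine.baseChange F).Nonsingular a b) :
    2 • (Point.some a b h : Pts E F) = 0 ↔ 2 * b + algebraMap k F E.a₁ * a + algebraMap k F E.a₃ = 0 := by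
  rw [two_nsmul, add_eq_zero_iff_eq_neg, Point.neg_some, Point.some.injEq]
  have : (E.toAffine.baseChange F).negY a b = - b - algebraMap k F E.a₁ * a - algebraMap k F E.a₃ := rfl
  rw [this]
  constructor
  · rintro ⟨-, h⟩
    linear_combination h
  · intro h
    exact ⟨rfl, by linear_combination h⟩

variable (E F) in
/-- The cubic polynomial whose roots are the `x`-coordinates of the points of order 2. -/
def twoTors : F[X] := C 4 * X ^ 3 + C (algebraMap k F E.b₂) * X ^ 2 + C (2 * algebraMap k F E.b₄) * X +
  C (algebraMap k F E.b₆)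

lemma twoTors_eval (a : F) : (twoTors E F).eval a = 4 * a ^ 3 + algebraMap k F E.b₂ * a ^ 2 +
    2 * algebraMap k F E.b₄ * a + algebraMap k F E.b₆ := by
  simp [twoTors]

/-- This is the Weierstrass equation multiplied by 4, with the square in `y` completed. -/
lemma twoTors_eval_eq {a b : F} (h : (E.toAffine.baseChange F).Equation a b) :
    (twoTors E F).eval a = (2 * b + algebraMap k F E.a₁ * a + algebraMap k F E.a₃) ^ 2 := by
  rw [equation_iff] at h
  have h3 : b ^ 2 + algebraMap k F E.a₁ * a * b + algebraMap k F E.a₃ * b = a ^ 3 + algebraMap k F E.a₂ * a ^ 2 + algebraMap k F E.a₄ * a + algebraMap k F E.a₆ := h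
  rw [twoTors_eval, WeierstrassCurve.b₂, WeierstrassCurve.b₄, WeierstrassCurve.b₆]
  simp only [map_add, map_mul, map_pow, map_ofNat]
  linear_combination -4 * h3

lemma twoTors_degree [CharZero F] : (twoTors E F).degree = 3 := by
  rw [twoTors]; compute_degree!

lemma exists_two_torsion [CharZero F] : ∃ P : Pts E F, P ≠ 0 ∧ 2 • P = 0 := by
  obtain ⟨a, ha⟩ := IsAlgClosed.exists_root (twoTors E F) (by rw [twoTors_degree]; decide)
  obtain ⟨b, h⟩ := exists_point_of_x E a
  refine ⟨.some a b h, Point.some_ne_zero h, (two_nsmul_eq_zero_iff h).mpr ?_⟩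
  rw [IsRoot, twoTors_eval_eq h.1] at ha
  exact pow_eq_zero_iff two_ne_zero |>.mp ha

-- The `x`-coordinate of such a point is a root of a fixed cubic, and it determines the
-- `y`-coordinate.
variable (E F) in
lemma finite_two_torsion [CharZero F] : {P : Pts E F | 2 • P = 0}.Finite := by
  have h0 : twoTors E F ≠ 0 := fun h => by
    have := twoTors_degree (E := E) (F := F)
    rw [h, degree_zero] at this
    exact absurd this (by decide)
  let g : F → Pts E F := fun a => if h : (E.toAffine.baseChange F).Nonsingular a
    (-(algebraMap k F E.a₁ * a + algebraMap k F E.a₃) / 2) then .some _ _ h else 0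
  refine (((twoTors E F).roots.toFinset.finite_toSet.image g).insert 0).subset ?_
  rintro (_ | ⟨a, b, h⟩) hP
  · exact Or.inl rfl
  · have h1 := (two_nsmul_eq_zero_iff h).mp hP
    have hb : b = -(algebraMap k F E.a₁ * a + algebraMap k F E.a₃) / 2 := by
      field_simp
      linear_combination h1
    refine Or.inr ⟨a, ?_, ?_⟩
    · rw [SetLike.mem_coe, Multiset.mem_toFinset, mem_roots h0, IsRoot, twoTors_eval_eq h.1, h1]
      ring
    · subst hb
      exact dif_pos h

/-- A fibre of multiplication by `n` is empty or a coset of its kernel. -/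
lemma finite_fibre {G : Type*} [AddCommGroup G] {n : ℕ} (hn : {P : G | n • P = 0}.Finite) (Q : G) :
    {P : G | n • P = Q}.Finite := by
  by_cases h : ∃ P₀ : G, n • P₀ = Q
  · obtain ⟨P₀, rfl⟩ := h
    refine (hn.image (fun P => P + P₀)).subset fun P hP => ⟨P - P₀, ?_, sub_add_cancel _ _⟩
    rw [Set.mem_ofPred_eq, nsmul_sub, hP, sub_self]
  · exact Set.finite_empty.subset fun P hP => h ⟨P, hP⟩

lemma finite_torsion_mul {G : Type*} [AddCommGroup G] {m n : ℕ} (hm : {P : G | m • P = 0}.Finite)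
    (hn : {P : G | n • P = 0}.Finite) : {P : G | (m * n) • P = 0}.Finite := by
  refine (hm.preimage' (f := fun P => n • P) fun Q _ => finite_fibre hn Q).subset fun P hP => ?_
  rw [Set.mem_preimage, Set.mem_ofPred_eq, ← mul_smul]
  exact hP

lemma const_injective : Function.Injective (const (E := E) (F := F)) := Point.map_injective _

/-- Let `R` be `n` times the generic point. Translation by `T` moves `R` to `R + nT`, so every
`n`-torsion point fixes the coordinates of `R`. If there are infinitely many, the coordinates are
constant, hence fixed by all translations, which forces `nQ = 0` for every `Q`. This avoids division
polynomials. -/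
lemma nsmul_eq_zero_of_infinite {n : ℕ} (hn : {P : Pts E F | n • P = 0}.Infinite) (Q : Pts E F) :
    n • Q = 0 := by
  have key : ∀ T, Point.map ((transl T).restrictScalars k) (n • gen E F) = n • gen E F + const (n • T) := by
    intro T
    rw [map_nsmul, transl_gen, nsmul_add, map_nsmul]
  apply const_injective
  rw [map_zero]
  suffices Point.map ((transl Q).restrictScalars k) (n • gen E F) = n • gen E F by
    rw [key] at this
    exact add_eq_left.mp this
  have hinv : ∀ T : Pts E F, n • T = 0 →
      Point.map ((transl T).restrictScalars k) (n • gen E F) = n • gen E F := by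
    intro T hT
    rw [key, hT, map_zero, add_zero]
  generalize n • gen E F = R at hinv ⊢
  rcases R with _ | ⟨x, y, h⟩
  · rfl
  simp only [Point.map_some, Point.some.injEq] at hinv ⊢
  obtain ⟨c, rfl⟩ := exists_const_of_transl (hn.mono fun T hT => (hinv T hT).1)
  obtain ⟨d, rfl⟩ := exists_const_of_transl (hn.mono fun T hT => (hinv T hT).2)
  exact ⟨(transl Q).commutes c, (transl Q).commutes d⟩

/-- Otherwise `n` would kill every point, but an odd `n` fixes a point of order 2. -/
lemma finite_torsion_of_odd [CharZero F] {n : ℕ} (hn : Odd n) : {P : Pts E F | n • P = 0}.Finite := by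
  by_contra h
  obtain ⟨P, hP0, hP⟩ := exists_two_torsion (E := E) (F := F)
  have h1 := nsmul_eq_zero_of_infinite h P
  obtain ⟨j, rfl⟩ := hn
  rw [add_nsmul, one_nsmul, mul_comm, mul_nsmul', hP, nsmul_zero, zero_add] at h1
  exact hP0 h1

variable (E F) in
/-- The group `E[n]` is finite. -/
lemma finite_torsion [CharZero F] {n : ℕ} (hn : 0 < n) : {P : Pts E F | n • P = 0}.Finite := by
  obtain ⟨r, s, hs, rfl⟩ := Nat.exists_eq_two_pow_mul_odd hn.ne'
  refine finite_torsion_mul ?_ (finite_torsion_of_odd hs)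
  clear hn
  induction r with
  | zero => simp
  | succ r ih => exact pow_succ 2 r ▸ finite_torsion_mul ih (finite_two_torsion E F)

end Torsion

/-! ### Theta groups: scalars and lifts of torsion points -/

section ThetaLift

variable {k : Type u} [Field k] {E : WeierstrassCurve k} {F : Type u} [Field F] [Algebra k F]
  [IsAlgClosed F] [E.IsElliptic]

lemma ord_const (P : Pts E F) (c : F) : ord P (algebraMap F (FF E F) c) = 0 := by
  by_cases hc : c = 0
  · subst hc
    rw [map_zero, ord, map_zero, WithZero.log_zero, neg_zero]
  · rw [ord, ptVal_eq, AlgHom.commutes, infVal_const hc, WithZero.log_one, neg_zero]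

variable (E) in
/-- The element `(c, 0)` of the theta group. -/
def scal (n : ℕ) : Fˣ →* Theta E F n where
  toFun c := ⟨⟨Units.map (algebraMap F (FF E F) : F →* FF E F) c, 0⟩, smul_zero _, fun P => by
    rw [add_zero, sub_self]
    exact ord_const P c⟩
  map_one' := Subtype.ext (RatPair.ext' (by exact map_one (algebraMap F (FF E F))) rfl)
  map_mul' a b := Subtype.ext (RatPair.ext' (by
    change algebraMap F (FF E F) ((a * b : Fˣ) : F) = transl 0 (algebraMap F (FF E F) a) * algebraMap F _ b
    rw [AlgHom.commutes, Units.val_mul, map_mul]) (zero_add 0).symm)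

lemma scal_fn (n : ℕ) (c : Fˣ) : (((scal E n c : Theta E F n) : RatPair E F).fn : FF E F) = algebraMap F _ c := rfl

lemma scal_pt (n : ℕ) (c : Fˣ) : ((scal E n c : Theta E F n) : RatPair E F).pt = 0 := rfl

lemma scal_comm (n : ℕ) (c : Fˣ) (a : Theta E F n) : scal E n c * a = a * scal E n c := by
  refine Subtype.ext (RatPair.ext' ?_ ?_)
  · rw [Subgroup.coe_mul, Subgroup.coe_mul, RatPair.mul_fn, RatPair.mul_fn, scal_fn, scal_pt, AlgHom.commutes, transl_zero,
      AlgHom.id_apply, mul_comm]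
  · rw [Subgroup.coe_mul, Subgroup.coe_mul, RatPair.mul_pt, RatPair.mul_pt, scal_pt, add_zero, zero_add]

lemma scal_injective (n : ℕ) : Function.Injective (scal E (F := F) n) := by
  intro a b h
  have h1 := congrArg (fun x : Theta E F n => ((x : RatPair E F).fn : FF E F)) h
  simp only [scal_fn] at h1
  exact Units.ext ((algebraMap F (FF E F)).injective h1)

/-- Over the origin the prescribed divisor is zero, and a function without zeros or poles is
constant. -/
lemma exists_scal {n : ℕ} {a : Theta E F n} (ha : (a : RatPair E F).pt = 0) : ∃ c : Fˣ, a = scal E n c := by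
  have h1 : ((a : RatPair E F).fn : FF E F) ∈ RR E F 0 := by
    intro _ P
    rw [a.2.2 P, ha, add_zero, sub_self, nO]
    split_ifs <;> simp
  obtain ⟨c, hc⟩ := exists_const_of_mem_RR_zero h1
  have hc0 : c ≠ 0 := by
    rintro rfl
    exact (a : RatPair E F).fn.ne_zero (hc.trans (map_zero _))
  exact ⟨Units.mk0 c hc0, Subtype.ext (RatPair.ext' hc ha)⟩

/-- The inverse appears because the action divides by the function. -/
lemma thetaRR_scal (n : ℕ) (c : Fˣ) : thetaRR n (scal E n c) = (c⁻¹ : F) • LinearMap.id := by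
  ext h
  rw [thetaRR_apply, RatPair.act_apply, scal_pt, scal_fn, neg_zero, transl_zero, AlgHom.id_apply, LinearMap.smul_apply,
    LinearMap.id_apply, Submodule.coe_smul, Algebra.smul_def, map_inv₀, div_eq_inv_mul]

lemma det_scal {n : ℕ} (hn : 0 < n) (c : Fˣ) : LinearMap.det (thetaRR n (scal E n c)) = (c⁻¹ : F) ^ n := by
  rw [thetaRR_scal, LinearMap.det_smul, LinearMap.det_id, mul_one, finrank_RR hn]

/-- On the dual space an element acts by the transpose of its inverse, so the two determinants are
mutually inverse. -/
lemma mem_Heis_iff {n : ℕ} (a : Theta E F n) : a ∈ Heis E F n ↔ LinearMap.det (thetaRR n a) = 1 := by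
  rw [← inv_mem_iff (x := a)]
  change LinearMap.det (thetaV n a⁻¹) = 1 ↔ _
  rw [det_thetaV, inv_inv]

/-- The powers of a nonzero proper ideal in a Dedekind domain decrease strictly, so each step adds
at least one dimension. The lower bound suffices for the degree count in `poleDeg_of_vanIdeal_pow`.
-/
lemma finrank_quotient_pow {P : Pts E F} (hP : P ≠ 0) (n : ℕ) :
    n ≤ Module.finrank F (CRing E F ⧸ vanIdeal P ^ n) := by
  have hmax := vanIdeal_isMaximal hP
  induction n with
  | zero => exact Nat.zero_le _
  | succ n ih =>
    have h0 : vanIdeal P ^ (n + 1) ≠ ⊥ := pow_ne_zero _ (vanIdeal_ne_bot P)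
    have := finite_quotient h0
    let f := (Ideal.Quotient.factorₐ F (Ideal.pow_le_pow_right (I := vanIdeal P) (Nat.le_add_right n 1))).toLinearMap
    have hf : Function.Surjective f := Ideal.Quotient.factor_surjective (Ideal.pow_le_pow_right (Nat.le_add_right n 1))
    have hker : LinearMap.ker f ≠ ⊥ := by
      intro h
      have h1 := Ideal.pow_succ_lt_pow (vanIdeal_ne_bot P) n
      obtain ⟨s, hs, hs'⟩ := SetLike.exists_of_lt h1
      apply hs'
      rw [← Ideal.Quotient.eq_zero_iff_mem]
      refine LinearMap.ker_eq_bot.mp h ?_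
      rw [map_zero]
      exact Ideal.Quotient.eq_zero_iff_mem.mpr hs
    have h2 := LinearMap.finrank_range_add_finrank_ker f
    rw [LinearMap.range_eq_top.mpr hf, finrank_top] at h2
    have h3 : Module.finrank F (LinearMap.ker f) ≠ 0 := fun h => hker (Submodule.finrank_eq_zero.mp h)
    omega

/-- The class of the ideal of `T` is killed by `n`, because taking classes is additive in the point.
-/
lemma exists_span_eq_vanIdeal_pow {n : ℕ} {T : Pts E F} (hT : n • T = 0) :
    ∃ r : CRing E F, vanIdeal T ^ n = Ideal.span {r} := by
  have h0 : vanIdeal T ^ n ≠ ⊥ := pow_ne_zero _ (vanIdeal_ne_bot T)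
  have h1 : ClassGroup.mk0 ⟨_, mem_nonZeroDivisors_of_ne_zero h0⟩ = 1 := by
    have h2 : n • Additive.ofMul (ClassGroup.mk0 (vanIdeal₀ T)) = 0 := by
      rw [← toClass_eq_mk0, ← map_nsmul, hT, map_zero]
    rw [← ofMul_pow, ← map_pow] at h2
    exact ofMul_eq_zero.mp h2
  obtain ⟨⟨r, hr⟩⟩ := (ClassGroup.mk0_eq_one_iff _).mp h1
  exact ⟨r, hr⟩

/-- The function is `x - a`, whose zeros are `T` and `-T` and whose pole at the origin is double. -/
lemma vanIdeal_neg_mul {T : Pts E F} (hT : T ≠ 0) : ∃ r : CRing E F, r ≠ 0 ∧ poleDeg E r = 2 ∧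
    vanIdeal (-T) * vanIdeal T = Ideal.span {r} := by
  rcases T with _ | ⟨a, b, h⟩
  · exact absurd rfl hT
  have hr : CoordinateRing.XClass (E.toAffine.baseChange F) a ≠ 0 := CoordinateRing.XClass_ne_zero a
  refine ⟨CoordinateRing.XClass _ a, hr, ?_, CoordinateRing.XYIdeal_neg_mul h⟩
  have e : algebraMap (CRing E F) (FF E F) (CoordinateRing.XClass (E.toAffine.baseChange F) a) =
      xF E F - algebraMap F _ a := by
    rw [CoordinateRing.XClass, C_sub, map_sub, map_sub]
    rfl
  have h1 := infVal_x_sub (E := E) a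
  rw [← e, infVal_apply, infValR_apply E hr, WithZero.exp_inj] at h1
  exact_mod_cast h1

lemma poleDeg_of_span_eq {r s : CRing E F} (hr : r ≠ 0) (hs : s ≠ 0) (h : Ideal.span {r} = Ideal.span {s}) :
    poleDeg E r = poleDeg E s := by
  rw [← finrank_quotient hr, ← finrank_quotient hs, h]

lemma poleDeg_pow (r : CRing E F) (n : ℕ) : poleDeg E (r ^ n) = n * poleDeg E r := by
  rw [poleDeg, map_pow, natDegree_pow]; rfl

/-- The generators for `T` and `-T` each have pole order at least `n`. Their product generates the
same ideal as `(x - a) ^ n`, of pole order `2n`, so both bounds are equalities. -/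
lemma poleDeg_of_vanIdeal_pow {n : ℕ} {T : Pts E F} (hT : T ≠ 0) (hnT : n • T = 0) {r : CRing E F}
    (hr : vanIdeal T ^ n = Ideal.span {r}) : poleDeg E r = n := by
  have aux : ∀ (T : Pts E F) (r : CRing E F), T ≠ 0 → vanIdeal T ^ n = Ideal.span {r} →
      r ≠ 0 ∧ n ≤ poleDeg E r := by
    intro T r hT hr
    have hr0 : r ≠ 0 := by
      rintro rfl
      refine pow_ne_zero n (vanIdeal_ne_bot T) (hr.trans ?_)
      rw [Ideal.span_singleton_eq_bot.mpr rfl]; rfl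
    refine ⟨hr0, ?_⟩
    rw [← finrank_quotient hr0, ← hr]
    exact finrank_quotient_pow hT n
  obtain ⟨s, hs⟩ := exists_span_eq_vanIdeal_pow (n := n) (T := -T) (by rw [smul_neg, hnT, neg_zero])
  obtain ⟨hr0, h1⟩ := aux _ _ hT hr
  obtain ⟨hs0, h2⟩ := aux _ _ (neg_ne_zero.mpr hT) hs
  obtain ⟨t, ht0, ht2, ht⟩ := vanIdeal_neg_mul hT
  have h3 : Ideal.span {s * r} = Ideal.span {t ^ n} := by
    rw [← Ideal.span_singleton_mul_span_singleton, ← Ideal.span_singleton_pow, ← ht, mul_pow, hs, hr]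
  have h4 := poleDeg_of_span_eq (mul_ne_zero hs0 hr0) (pow_ne_zero n ht0) h3
  rw [poleDeg_mul E hs0 hr0, poleDeg_pow, ht2] at h4
  omega

/-- Every torsion point lifts to the theta group. -/
lemma exists_theta {n : ℕ} {T : Pts E F} (hT : n • T = 0) :
    ∃ a : Theta E F n, (a : RatPair E F).pt = T := by
  by_cases hT0 : T = 0
  · exact ⟨1, hT0.symm⟩
  have hT0' : -T ≠ 0 := neg_ne_zero.mpr hT0
  have hT' : n • -T = 0 := by rw [smul_neg, hT, neg_zero]
  -- The pull-back of `n.O` along translation by `T` is `n` times the point `-T`, so the function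
  -- sought generates the `n`-th power of the ideal of `-T`.
  obtain ⟨r, hr⟩ := exists_span_eq_vanIdeal_pow hT'
  have hd := poleDeg_of_vanIdeal_pow hT0' hT' hr
  have hr0 : r ≠ 0 := by
    rintro rfl
    refine pow_ne_zero n (vanIdeal_ne_bot (-T)) (hr.trans ?_)
    rw [Ideal.span_singleton_eq_bot.mpr rfl]; rfl
  refine ⟨⟨⟨Units.mk0 _ (algebraMap_FF_ne_zero hr0), T⟩, hT, fun P => ?_⟩, rfl⟩
  change ord P (algebraMap _ _ r) = nO E F n (P + T) - nO E F n P
  by_cases hP0 : P = 0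
  · subst hP0
    rw [zero_add, ord_zero_algebraMap hr0, hd, nO, nO, if_neg hT0, if_pos rfl, zero_sub]
  have hmax := vanIdeal_isMaximal hP0
  by_cases hPT : P = -T
  · subst hPT
    rw [neg_add_cancel, nO, nO, if_pos rfl, if_neg hP0, sub_zero]
    apply le_antisymm
    · by_contra hlt
      rw [not_le] at hlt
      -- A larger order would put the generator of the `n`-th power into the strictly smaller next
      -- power.
      have h1 := (le_ord_iff hP0 hr0 (n + 1)).mp (by push_cast; omega)
      have h2 := Ideal.pow_succ_lt_pow (vanIdeal_ne_bot (-T)) n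
      rw [hr] at h2
      exact h2.not_ge ((Ideal.span_singleton_le_iff_mem _).mpr h1)
    · rw [le_ord_iff hP0 hr0, hr]
      exact Ideal.mem_span_singleton_self r
  · have hPT' : P + T ≠ 0 := fun h => hPT (eq_neg_of_add_eq_zero_left h)
    rw [nO, nO, if_neg hPT', if_neg hP0, sub_zero]
    refine le_antisymm ?_ (ord_nonneg hP0 hr0)
    by_contra hlt
    -- A zero at another point `P` would place the ideal of `-T` inside that of `P`, against
    -- coprimality.
    have h1 := (one_le_ord_iff hP0 hr0).mp (by omega)
    rw [← Ideal.span_singleton_le_iff_mem, ← hr] at h1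
    have h2 := hmax.isPrime.le_of_pow_le h1
    have h3 := Ideal.isCoprime_iff_sup_eq.mp (vanIdeal_isCoprime hPT)
    rw [sup_eq_left.mpr h2] at h3
    exact hmax.ne_top h3

end ThetaLift

/-! ### Determinants of endomorphisms of finite order -/

section Determinant

variable {F : Type*} [Field F]

variable (F) in
/-- The product of the roots of unity of order dividing `d`. -/
def prodRoots (d : ℕ) : F := ∏ ζ ∈ nthRootsFinset d (1 : F), ζ

/-- Inversion permutes the roots of unity, so their product is its own inverse. -/
lemma prodRoots_sq {d : ℕ} (hd : 0 < d) : prodRoots F d ^ 2 = 1 := by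
  have h0 : ∀ ζ ∈ nthRootsFinset d (1 : F), ζ ≠ 0 := by
    rintro ζ hζ rfl
    rw [Polynomial.mem_nthRootsFinset hd, zero_pow hd.ne'] at hζ
    exact zero_ne_one hζ
  have h1 : prodRoots F d = (prodRoots F d)⁻¹ := by
    rw [prodRoots, ← Finset.prod_inv_distrib]
    refine Finset.prod_nbij' (·⁻¹) (·⁻¹) ?_ ?_ ?_ ?_ ?_
    · intro ζ hζ
      rw [Polynomial.mem_nthRootsFinset hd] at hζ ⊢
      rw [inv_pow, hζ, inv_one]
    · intro ζ hζ
      rw [Polynomial.mem_nthRootsFinset hd] at hζ ⊢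
      rw [inv_pow, hζ, inv_one]
    all_goals exact fun ζ _ => by simp
  rw [sq]
  nth_rewrite 1 [h1]
  exact inv_mul_cancel₀ (Finset.prod_ne_zero_iff.mpr h0)

/-- The eigenvalues are among the `d` roots of unity of order dividing `d`. Eigenspaces of dimension
at most `j` can fill a space of dimension `j * d` only if each of these occurs with multiplicity
exactly `j`. -/
lemma det_of_finrank_eigenspace_le [IsAlgClosed F] [CharZero F] {V : Type*} [AddCommGroup V] [Module F V]
    [FiniteDimensional F V] {d j : ℕ} (hd : 0 < d) {f : Module.End F V} (hf : f ^ d = 1)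
    (hV : Module.finrank F V = j * d) (hj : ∀ ζ : F, ζ ≠ 0 → Module.finrank F (f.eigenspace ζ) ≤ j) :
    LinearMap.det f = prodRoots F d ^ j := by
  have hd' : NeZero (d : F) := ⟨Nat.cast_ne_zero.mpr hd.ne'⟩
  have hd'' : NeZero d := ⟨hd.ne'⟩
  -- In characteristic zero `X ^ d - 1` is separable, so algebraic and geometric multiplicities
  -- agree.
  have hss : f.IsSemisimple := by
    refine Module.End.isSemisimple_of_squarefree_aeval_eq_zero (p := X ^ d - C 1) ?_ ?_
    · exact ((X_pow_sub_one_separable_iff (F := F) (n := d)).mpr hd'.ne).squarefree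
    · simp [hf]
  have hmult : ∀ ζ, f.charpoly.roots.count ζ = Module.finrank F (f.eigenspace ζ) := by
    intro ζ
    rw [count_roots, ← LinearMap.finrank_maxGenEigenspace_eq,
      hss.isFinitelySemisimple.maxGenEigenspace_eq_eigenspace]
  obtain ⟨ξ, hξ⟩ := HasEnoughRootsOfUnity.exists_primitiveRoot F d
  have hmem : ∀ ζ ∈ f.charpoly.roots, ζ ∈ nthRootsFinset d (1 : F) := by
    intro ζ hζ
    rw [Polynomial.mem_nthRootsFinset hd]
    have h1 : f.eigenspace ζ ≠ ⊥ := by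
      intro h
      rw [← Multiset.count_pos, hmult, h, finrank_bot] at hζ
      exact lt_irrefl _ hζ
    obtain ⟨v, hv, hv0⟩ := Submodule.exists_mem_ne_zero_of_ne_bot h1
    have h2 : (f ^ d) v = ζ ^ d • v :=
      Module.End.HasEigenvector.pow_apply ⟨hv, hv0⟩ d
    rw [hf, Module.End.one_apply] at h2
    by_contra hne
    have h3 : (ζ ^ d - 1) • v = 0 := by rw [sub_smul, one_smul, ← h2, sub_self]
    exact (smul_eq_zero.mp h3).elim (fun h => hne (sub_eq_zero.mp h)) hv0
  -- The bound on eigenspaces gives containment of multisets, and both sides have `j * d` elements.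
  have hroots : f.charpoly.roots = j • (nthRootsFinset d (1 : F)).val := by
    refine Multiset.eq_of_le_of_card_le (Multiset.le_iff_count.mpr fun ζ => ?_) ?_
    · rw [Multiset.count_nsmul]
      by_cases hζ : ζ ∈ f.charpoly.roots
      · rw [Multiset.count_eq_one_of_mem (nthRootsFinset d (1 : F)).nodup (hmem ζ hζ), mul_one, hmult]
        refine hj ζ ?_
        rintro rfl
        have := hmem 0 hζ
        rw [Polynomial.mem_nthRootsFinset hd, zero_pow hd.ne'] at this
        exact zero_ne_one this
      · rw [Multiset.count_eq_zero_of_notMem hζ]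
        exact Nat.zero_le _
    · rw [Multiset.card_nsmul, Finset.card_val, hξ.card_nthRootsFinset,
        IsAlgClosed.card_roots_eq_natDegree, LinearMap.charpoly_natDegree, hV]
  rw [Module.End.det_eq_prod_roots_charpoly_of_splits (IsAlgClosed.splits _), hroots, Multiset.prod_nsmul,
    Finset.prod_val]
  rfl

end Determinant

/-! ### Eigenspaces of the theta group on the Riemann-Roch space -/

section Eigenspaces

/-- In an infinite abelian group with finite `d`-torsion there are arbitrarily many translates of a
finite subgroup of order `d`, pairwise disjoint, avoiding the origin, with nonzero sum. -/
lemma exists_translates {G : Type*} [AddCommGroup G] [Infinite G] (S : G) {d : ℕ} (hd : 0 < d) (hS : addOrderOf S = d)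
    (hfin : {P : G | d • P = 0}.Finite) (j : ℕ) : ∃ T A : Finset G, T.card = j ∧ A.card = j * d ∧ 0 ∉ A ∧
      (0 < j → ∑ P ∈ A, P ≠ 0) ∧ (∀ P ∈ T, ∀ i : ℕ, P + i • S ∈ A) ∧ (∀ P ∈ A, ∃ Q ∈ T, ∃ i : ℕ, P = Q + i • S) ∧
      ∀ P ∈ A, P + S ∈ A := by
  have hdS : d • S = 0 := hS ▸ addOrderOf_nsmul_eq_zero S
  induction j with
  | zero => exact ⟨∅, ∅, by simp⟩
  | succ j ih =>
    obtain ⟨T, A, hT, hA, h0, -, hTA, hAT, hAS⟩ := ih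
    -- The cyclic subgroup generated by `S`; the new orbit will be `P + B`.
    let B : Finset G := (Finset.range d).image fun i => i • S
    have hB : ∀ i : ℕ, i • S ∈ B := fun i => by
      refine Finset.mem_image.mpr ⟨i % d, Finset.mem_range.mpr (Nat.mod_lt _ hd), ?_⟩
      rw [← hS, mod_addOrderOf_nsmul]
    have hBneg : ∀ i : ℕ, -(i • S) ∈ B := fun i => by
      have : -(i • S) = (i * (d - 1)) • S := by
        rw [neg_eq_iff_add_eq_zero, ← add_nsmul, show i + i * (d - 1) = i * d by
          obtain ⟨c, rfl⟩ := Nat.exists_eq_add_of_lt hd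
          simp only [zero_add, Nat.add_sub_cancel]
          ring, mul_nsmul', hdS, nsmul_zero]
      rw [this]
      exact hB _
    have hAS' : ∀ i : ℕ, ∀ P ∈ A, P + i • S ∈ A := by
      intro i P hP
      induction i with
      | zero => simpa using hP
      | succ i ih => rw [succ_nsmul, ← add_assoc]; exact hAS _ ih
    have hBcard : B.card = d := by
      rw [Finset.card_image_of_injOn, Finset.card_range]
      intro x hx y hy h
      rw [Finset.coe_range, Set.mem_Iio] at hx hy
      exact nsmul_injOn_Iio_addOrderOf (by rwa [hS]) (by rwa [hS]) h
    -- Avoiding `A` makes the new orbit disjoint from it, and avoiding `B` keeps the orbit off the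
    -- origin. The new total is `d • P` plus the sums over `A` and `B`, so excluding one fibre of
    -- multiplication by `d` makes it nonzero.
    obtain ⟨P, hP⟩ := ((A.finite_toSet.union B.finite_toSet).union
      (finite_fibre hfin (-(∑ P ∈ A, P + ∑ P ∈ B, P)))).exists_notMem
    simp only [Set.mem_union, Finset.mem_coe, Set.mem_ofPred_eq, not_or] at hP
    obtain ⟨⟨hPA, hPB⟩, hPs⟩ := hP
    have hnot : ∀ i : ℕ, P + i • S ∉ A := by
      intro i h
      obtain ⟨c, -, hc⟩ := Finset.mem_image.mp (hBneg i)
      have h1 := hAS' c _ h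
      rw [hc, add_neg_cancel_right] at h1
      exact hPA h1
    have hPT : P ∉ T := fun h => hnot 0 (by simpa using hTA P h 0)
    have hdisj : Disjoint A (B.map (addLeftEmbedding P)) := by
      rw [Finset.disjoint_right]
      intro Q hQ
      obtain ⟨b, hb, rfl⟩ := Finset.mem_map.mp hQ
      obtain ⟨i, -, rfl⟩ := Finset.mem_image.mp hb
      exact hnot i
    have hmem : ∀ i : ℕ, P + i • S ∈ B.map (addLeftEmbedding P) := fun i =>
      Finset.mem_map.mpr ⟨_, hB i, rfl⟩
    have hmem' : ∀ Q ∈ B.map (addLeftEmbedding P), ∃ i : ℕ, Q = P + i • S := by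
      intro Q hQ
      obtain ⟨b, hb, rfl⟩ := Finset.mem_map.mp hQ
      obtain ⟨i, -, rfl⟩ := Finset.mem_image.mp hb
      exact ⟨i, rfl⟩
    refine ⟨insert P T, A ∪ B.map (addLeftEmbedding P), ?_, ?_, ?_, ?_, ?_, ?_, ?_⟩
    · rw [Finset.card_insert_of_notMem hPT, hT]
    · rw [Finset.card_union_of_disjoint hdisj, Finset.card_map, hA, hBcard]; ring
    · rw [Finset.mem_union, not_or]
      refine ⟨h0, fun h => ?_⟩
      obtain ⟨i, hi⟩ := hmem' 0 h
      apply hPB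
      rw [eq_neg_of_add_eq_zero_left hi.symm]
      exact hBneg i
    · intro _ h
      rw [Finset.sum_union hdisj, Finset.sum_map] at h
      have h2 : ∑ b ∈ B, addLeftEmbedding P b = d • P + ∑ b ∈ B, b := by
        simp_rw [addLeftEmbedding_apply]
        rw [Finset.sum_add_distrib, Finset.sum_const, hBcard]
      rw [h2] at h
      apply hPs
      rw [eq_neg_iff_add_eq_zero, ← h]
      abel
    · intro Q hQ i
      rcases Finset.mem_insert.mp hQ with rfl | hQ
      · exact Finset.mem_union_right _ (hmem i)
      · exact Finset.mem_union_left _ (hTA Q hQ i)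
    · intro Q hQ
      rcases Finset.mem_union.mp hQ with hQ | hQ
      · obtain ⟨R, hR, i, hi⟩ := hAT Q hQ
        exact ⟨R, Finset.mem_insert_of_mem hR, i, hi⟩
      · obtain ⟨i, hi⟩ := hmem' Q hQ
        exact ⟨P, Finset.mem_insert_self _ _, i, hi⟩
    · intro Q hQ
      rcases Finset.mem_union.mp hQ with hQ | hQ
      · exact Finset.mem_union_left _ (hAS Q hQ)
      · obtain ⟨i, rfl⟩ := hmem' Q hQ
        rw [add_assoc, ← succ_nsmul]
        exact Finset.mem_union_right _ (hmem _)

variable {k : Type u} [Field k] {E : WeierstrassCurve k} {F : Type u} [Field F] [Algebra k F]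
  [IsAlgClosed F] [E.IsElliptic]

/-- The elements of the Riemann-Roch space as regular functions. -/
def toReg (n : ℕ) : RR E F n →ₗ[F] CRing E F where
  toFun f := (exists_of_mem_RR f.2).choose
  map_add' f g := by
    apply IsFractionRing.injective (CRing E F) (FF E F)
    rw [map_add, (exists_of_mem_RR f.2).choose_spec.1, (exists_of_mem_RR g.2).choose_spec.1,
      (exists_of_mem_RR (f + g).2).choose_spec.1]
    rfl
  map_smul' c f := by
    apply IsFractionRing.injective (CRing E F) (FF E F)
    rw [RingHom.id_apply, Algebra.smul_def, map_mul, (exists_of_mem_RR f.2).choose_spec.1,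
      (exists_of_mem_RR (c • f).2).choose_spec.1, ← IsScalarTower.algebraMap_apply, ← Algebra.smul_def]
    rfl

lemma algebraMap_toReg {n : ℕ} (f : RR E F n) : algebraMap (CRing E F) (FF E F) (toReg n f) = f :=
  (exists_of_mem_RR f.2).choose_spec.1

lemma poleDeg_toReg {n : ℕ} (f : RR E F n) : poleDeg E (toReg n f) ≤ n :=
  (exists_of_mem_RR f.2).choose_spec.2

lemma toReg_ne_zero {n : ℕ} {f : RR E F n} (hf : f ≠ 0) : toReg n f ≠ 0 := fun h =>
  hf (Subtype.ext (by rw [← algebraMap_toReg, h, map_zero]; rfl))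

/-- The order of an eigenfunction is constant along orbits away from the origin. -/
lemma ord_eigen {n : ℕ} {a : Theta E F n} {ζ : F} (hζ : ζ ≠ 0) {f : RR E F n} (hf : f ≠ 0)
    (h : thetaRR n a f = ζ • f) {P : Pts E F} (hP : P ≠ 0) (hP' : P + (a : RatPair E F).pt ≠ 0) :
    ord (P + (a : RatPair E F).pt) (f : FF E F) = ord P (f : FF E F) := by
  have hf0 : (f : FF E F) ≠ 0 := fun h => hf (Subtype.ext h)
  have h1 := congrArg (fun g : RR E F n => ord (P + (a : RatPair E F).pt) (g : FF E F)) h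
  simp only [thetaRR_apply, RatPair.act_apply, Submodule.coe_smul, Algebra.smul_def] at h1
  rw [ord_transl, add_neg_cancel_right, div_eq_mul_inv, ord_mul _ hf0 (inv_ne_zero (Units.ne_zero _)), ord_inv,
    ord_mul _ ((_root_.map_ne_zero _).mpr hζ) hf0, ord_const] at h1
  -- Since neither `P` nor `P + T` is the origin, the function of `a` has order zero at `P`.
  have h2 := a.2.2 P
  rw [div, nO, nO, if_neg hP, if_neg hP', sub_zero] at h2
  rw [h2, neg_zero, add_zero, zero_add] at h1
  exact h1.symm

/-- An eigenfunction is determined by its values at `j` points, one in each of `j` orbits of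
translation. If all these values vanish, the function has its zeros exactly at the `n` points of the
orbits, all simple, so the points add up to zero. The orbits come from `exists_translates` with
nonzero sum. -/
lemma finrank_eigenspace_le [CharZero F] {n d j : ℕ} (hj : 0 < j) (hd : 0 < d) (hn : n = j * d) (a : Theta E F n)
    (ha : addOrderOf (a : RatPair E F).pt = d) {ζ : F} (hζ : ζ ≠ 0) :
    Module.finrank F (Module.End.eigenspace (thetaRR n a) ζ) ≤ j := by
  obtain ⟨T, A, hT, hA, h0, hsum, hTA, hAT, -⟩ := exists_translates _ hd ha (finite_torsion E F hd) j
  let φ : Module.End.eigenspace (thetaRR n a) ζ →ₗ[F] (T → F) :=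
    evFinset T ∘ₗ toReg n ∘ₗ Submodule.subtype _
  suffices h : Function.Injective φ by
    have := LinearMap.finrank_le_finrank_of_injective h
    rwa [Module.finrank_fintype_fun_eq_card, Fintype.card_coe, hT] at this
  rw [injective_iff_map_eq_zero]
  rintro ⟨f, hf⟩ hφ
  by_contra hne
  have hf0 : f ≠ 0 := fun h => hne (Subtype.ext h)
  have hr := toReg_ne_zero hf0
  rw [Module.End.mem_eigenspace_iff] at hf
  refine hsum hj (sum_eq_zero_of_poleDeg_le h0 hr (fun P hP => ?_) (hA ▸ hn ▸ poleDeg_toReg f))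
  obtain ⟨Q, hQ, i, rfl⟩ := hAT P hP
  have hne0 : ∀ i : ℕ, Q + i • (a : RatPair E F).pt ≠ 0 := fun i h => h0 (h ▸ hTA Q hQ i)
  rw [← one_le_ord_iff (hne0 i) hr, algebraMap_toReg]
  clear hP
  -- The zero at the representative `Q` is carried along its orbit, since the order of an
  -- eigenfunction is constant there.
  induction i with
  | zero =>
    have hQ0 : Q ≠ 0 := by simpa using hne0 0
    have h1 := (ev_eq_zero Q (toReg n f)).mp (congrFun hφ ⟨Q, hQ⟩)
    rw [← one_le_ord_iff hQ0 hr, algebraMap_toReg] at h1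
    rwa [zero_nsmul, add_zero]
  | succ i ih =>
    have h1 := hne0 (i + 1)
    rw [succ_nsmul, ← add_assoc] at h1 ⊢
    rw [ord_eigen hζ hf0 hf (hne0 i) h1]
    exact ih

lemma pow_pt {n : ℕ} (a : Theta E F n) (i : ℕ) : ((a ^ i : Theta E F n) : RatPair E F).pt = i • (a : RatPair E F).pt := by
  induction i with
  | zero => rw [pow_zero, zero_nsmul]; rfl
  | succ i ih => rw [pow_succ, succ_nsmul, ← ih]; rfl

/-- The value depends only on `d` and `j`, not on the element. This is what allows determinants at
two different levels to be compared. -/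
lemma det_of_pow_eq_one [CharZero F] {n d j : ℕ} (hj : 0 < j) (hd : 0 < d) (hn : n = j * d) (a : Theta E F n)
    (ha : addOrderOf (a : RatPair E F).pt = d) (had : a ^ d = 1) :
    LinearMap.det (thetaRR n a) = prodRoots F d ^ j :=
  det_of_finrank_eigenspace_le hd (by rw [← map_pow, had, map_one])
    (by rw [finrank_RR (hn ▸ Nat.mul_pos hj hd), hn]) fun _ hζ => finrank_eigenspace_le hj hd hn a ha hζ

/-- The homomorphism `(f, T) ↦ (f ^ j, T)` of theta groups. -/
def powTheta {n j N : ℕ} (h : n * j = N) : Theta E F n →* Theta E F N where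
  toFun a := ⟨RatPair.powFn a j, by
    change N • (a : RatPair E F).pt = 0
    rw [← h, mul_comm, mul_smul, a.2.1, smul_zero], fun P => by
    have h1 : ∀ i : ℕ, ord P (((a : RatPair E F).fn : FF E F) ^ i) = i * ord P ((a : RatPair E F).fn : FF E F) := by
      intro i
      induction i with
      | zero => rw [pow_zero, ord_one]; simp
      | succ i ih =>
        rw [pow_succ, ord_mul _ (pow_ne_zero _ (Units.ne_zero _)) (Units.ne_zero _), ih]
        push_cast; ring
    have h2 := a.2.2 P
    have h3 : ∀ Q, nO E F N Q = j * nO E F n Q := fun Q => by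
      rw [nO, nO, ← h]
      split_ifs
      · push_cast; ring
      · rw [mul_zero]
    change ord P (((a : RatPair E F).fn ^ j : (FF E F)ˣ) : FF E F) = nO E F N (P + (a : RatPair E F).pt) - nO E F N P
    rw [div] at h2
    rw [Units.val_pow_eq_pow_val, h1, h2, h3, h3]
    ring⟩
  map_one' := Subtype.ext (RatPair.ext' (one_pow j) rfl)
  map_mul' a b := Subtype.ext (RatPair.ext' (by
    change (transl (b : RatPair E F).pt ((a : RatPair E F).fn : FF E F) * (b : RatPair E F).fn) ^ j =
      transl (b : RatPair E F).pt (((a : RatPair E F).fn : FF E F) ^ j) * ((b : RatPair E F).fn : FF E F) ^ j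
    rw [mul_pow, map_pow]) rfl)

lemma powTheta_scal {n j N : ℕ} (h : n * j = N) (c : Fˣ) : powTheta h (scal E n c) = scal E N (c ^ j) :=
  Subtype.ext (RatPair.ext' (map_pow (algebraMap F (FF E F)) (c : F) j).symm rfl)

/-- Up to a scalar, an element of the theta group has the order of the point it lies over. -/
lemma exists_scal_mul_pow_eq_one {n : ℕ} (a : Theta E F n) {d : ℕ} (hd : 0 < d) (h : d • (a : RatPair E F).pt = 0) :
    ∃ u : Fˣ, (scal E n u * a) ^ d = 1 := by
  obtain ⟨c, hc⟩ := exists_scal (a := a ^ d) (by rw [pow_pt, h])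
  -- The `d`-th power lies over the origin, hence is a scalar `c`; multiplying by the central scalar
  -- `u` with `u ^ d = c⁻¹` cancels it.
  obtain ⟨u, hu⟩ := IsAlgClosed.exists_pow_nat_eq ((c⁻¹ : Fˣ) : F) hd
  have hu0 : u ≠ 0 := by
    rintro rfl
    rw [zero_pow hd.ne'] at hu
    exact c⁻¹.ne_zero hu.symm
  refine ⟨Units.mk0 u hu0, ?_⟩
  have h1 : Units.mk0 u hu0 ^ d = c⁻¹ := Units.ext hu
  rw [(show Commute (scal E n (Units.mk0 u hu0)) a from scal_comm _ _ _).mul_pow, ← map_pow, h1, hc, ← map_mul,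
    inv_mul_cancel, map_one]

/-- Write the element as a scalar `c` times some `b` of order `d`, the order of its point. The
scalar contributes `c` to the power `-n * j ^ 2` on both sides. For `b` the two determinants are
powers of the same sign, with exponents `i * j` and `i * j ^ 2` of equal parity. -/
lemma det_powTheta [CharZero F] {n j N : ℕ} (h : n * j = N) (hn : 0 < n) (hj : 0 < j) (a : Theta E F n) :
    LinearMap.det (thetaRR N (powTheta h a)) = LinearMap.det (thetaRR n a) ^ (j ^ 2) := by
  obtain ⟨d, hd⟩ : ∃ d, addOrderOf (a : RatPair E F).pt = d := ⟨_, rfl⟩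
  obtain ⟨i, hi⟩ := hd ▸ addOrderOf_dvd_of_nsmul_eq_zero a.2.1
  have hd0 : 0 < d := Nat.pos_of_ne_zero fun h0 => by
    rw [h0, zero_mul] at hi; omega
  have hi0 : 0 < i := Nat.pos_of_ne_zero fun h0 => by
    rw [h0, mul_zero] at hi; omega
  obtain ⟨c, b, rfl, hb⟩ : ∃ (c : Fˣ) (b : Theta E F n), a = scal E n c * b ∧ b ^ d = 1 := by
    obtain ⟨u, hu⟩ := exists_scal_mul_pow_eq_one a hd0 (hd ▸ addOrderOf_nsmul_eq_zero _)
    exact ⟨u⁻¹, _, by rw [← mul_assoc, ← map_mul, inv_mul_cancel, map_one, one_mul], hu⟩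
  have hbd : addOrderOf (b : RatPair E F).pt = d := by
    rw [← hd, Subgroup.coe_mul, RatPair.mul_pt, scal_pt, zero_add]
  have h1 := det_of_pow_eq_one hi0 hd0 (by rw [hi, mul_comm]) b hbd hb
  have h2 := det_of_pow_eq_one (Nat.mul_pos hi0 hj) hd0 (by rw [← h, hi]; ring) (powTheta h b) hbd
    (by rw [← map_pow, hb, map_one])
  have h3 : ∃ e, j ^ 2 = j + 2 * e := by
    obtain ⟨e, he⟩ := Nat.even_mul_pred_self j
    refine ⟨e, ?_⟩
    obtain ⟨l, rfl⟩ := Nat.exists_eq_add_of_lt hj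
    simp only [zero_add, Nat.add_sub_cancel] at he ⊢
    linarith
  obtain ⟨e, he⟩ := h3
  rw [map_mul, map_mul, map_mul, map_mul, map_mul, powTheta_scal, det_scal hn, det_scal (h ▸ Nat.mul_pos hn hj), h1, h2,
    mul_pow]
  congr 1
  · rw [Units.val_pow_eq_pow_val, ← inv_pow, ← pow_mul, ← pow_mul, ← h]
    congr 1
    ring
  · rw [← pow_mul, he, mul_add, pow_add, show i * (2 * e) = 2 * (i * e) by ring, pow_mul _ 2, prodRoots_sq hd0, one_pow,
      mul_one]

end Eigenspaces

/-! ### The decomposition of the Heisenberg group -/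

section Decomposition

variable {k : Type u} [Field k] {E : WeierstrassCurve k} {F : Type u} [Field F] [Algebra k F]
  [IsAlgClosed F] [E.IsElliptic]

/-- The scalars of the Heisenberg group are thus the `n`-th roots of unity. -/
lemma scal_mem_Heis {n : ℕ} (hn : 0 < n) {c : Fˣ} : scal E n c ∈ Heis E F n ↔ c ^ n = 1 := by
  rw [mem_Heis_iff, det_scal hn, inv_pow, inv_eq_one, ← Units.val_pow_eq_pow_val, Units.val_eq_one]

lemma exists_eq_scal_mul {n : ℕ} {a b : Theta E F n} (h : (a : RatPair E F).pt = (b : RatPair E F).pt) :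
    ∃ c : Fˣ, a = scal E n c * b := by
  obtain ⟨c, hc⟩ := exists_scal (a := a * b⁻¹) (by
    rw [Subgroup.coe_mul, RatPair.mul_pt, Subgroup.coe_inv, RatPair.inv_pt, h, add_neg_cancel])
  exact ⟨c, by rw [← hc, inv_mul_cancel_right]⟩

/-- Every torsion point lifts to the Heisenberg group. -/
lemma exists_heis {n : ℕ} (hn : 0 < n) {T : Pts E F} (hT : n • T = 0) :
    ∃ a ∈ Heis E F n, (a : RatPair E F).pt = T := by
  obtain ⟨a, ha⟩ := exists_theta hT
  have h0 : LinearMap.det (thetaRR n a) ≠ 0 := by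
    have h1 : LinearMap.det (thetaRR n a) * LinearMap.det (thetaRR n a⁻¹) = 1 := by
      rw [← map_mul, ← map_mul, mul_inv_cancel, map_one, map_one]
    exact left_ne_zero_of_mul_eq_one h1
  -- Multiplying by the scalar `c` divides the determinant by `c ^ n`, so an `n`-th root of the
  -- determinant normalises it to 1.
  obtain ⟨c, hc⟩ := IsAlgClosed.exists_pow_nat_eq (LinearMap.det (thetaRR n a)) hn
  have hc0 : c ≠ 0 := by
    rintro rfl
    rw [zero_pow hn.ne'] at hc
    exact h0 hc.symm
  refine ⟨scal E n (Units.mk0 c hc0) * a, ?_, ?_⟩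
  · rw [mem_Heis_iff, map_mul, map_mul, det_scal hn, Units.val_mk0, inv_pow, hc, inv_mul_cancel₀ h0]
  · rw [Subgroup.coe_mul, RatPair.mul_pt, scal_pt, zero_add, ha]

/-- Over each of the finitely many torsion points, two elements differ by an `n`-th root of unity.
-/
lemma finite_Heis [CharZero F] {n : ℕ} (hn : 0 < n) : Finite (Heis E F n) := by
  have hn' : NeZero n := ⟨hn.ne'⟩
  let f : Heis E F n → Pts E F := fun a => ((a : Theta E F n) : RatPair E F).pt
  refine Set.finite_univ_iff.mp (Set.Finite.of_finite_fibers f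
    ((finite_torsion E F hn).subset ?_) fun T hT => ?_)
  · rintro _ ⟨a, -, rfl⟩
    exact a.1.2.1
  · obtain ⟨b, -, rfl⟩ := hT
    have hroots : {c : Fˣ | c ^ n = 1}.Finite := (inferInstance : Finite (rootsOfUnity n F))
    refine ((hroots.image fun c => scal E n c * (b : Theta E F n)).preimage Subtype.val_injective.injOn).subset ?_
    rintro a ⟨-, ha⟩
    obtain ⟨c, hc⟩ := exists_eq_scal_mul ha
    refine ⟨c, ?_, hc.symm⟩
    have h1 : scal E n c = (a : Theta E F n) * (b : Theta E F n)⁻¹ := by rw [hc, mul_inv_cancel_right]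
    exact (scal_mem_Heis hn).mp (h1 ▸ mul_mem a.2 (inv_mem b.2))

/-- Conjugation fixes `x ^ m`, which is a central scalar, but also multiplies it by `e ^ m`. -/
lemma pow_eq_one_of_conj {N m : ℕ} {x y : Theta E F N} {c e : Fˣ} (hx : x ^ m = scal E N c)
    (h : y * x * y⁻¹ = scal E N e * x) : e ^ m = 1 := by
  have h1 := congrArg (· ^ m) h
  simp only [conj_pow] at h1
  rw [(show Commute (scal E N e) x from scal_comm _ _ _).mul_pow, hx, ← scal_comm, mul_inv_cancel_right, eq_comm,
    mul_eq_right, ← map_pow] at h1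
  exact scal_injective N (h1.trans (map_one _).symm)

lemma powTheta_pow_eq_scal {n j N : ℕ} (h : n * j = N) (a : Theta E F n) : ∃ c, powTheta h a ^ n = scal E N c := by
  obtain ⟨c, hc⟩ := exists_scal (a := a ^ n) (by rw [pow_pt, a.2.1])
  exact ⟨c ^ j, by rw [← map_pow, hc, powTheta_scal]⟩

/-- The commutator lies over the origin, so it is a scalar `e`. The `m`-th power of the first image
and the `n`-th power of the second are scalars, so `e` is killed by both exponents and is trivial by
coprimality. -/
lemma powTheta_commute {m n N : ℕ} (hmn : m.Coprime n) (h : m * n = N) (h' : n * m = N) (a : Theta E F m) (b : Theta E F n) :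
    Commute (powTheta h a) (powTheta h' b) := by
  obtain ⟨c, hc⟩ := powTheta_pow_eq_scal h a
  obtain ⟨c', hc'⟩ := powTheta_pow_eq_scal h' b
  generalize powTheta h a = x at *
  generalize powTheta h' b = y at *
  obtain ⟨e, he⟩ := exists_eq_scal_mul (a := y * x) (b := x * y) (by
    rw [Subgroup.coe_mul, Subgroup.coe_mul, RatPair.mul_pt, RatPair.mul_pt, add_comm])
  have h1 : e ^ m = 1 := pow_eq_one_of_conj (y := y) hc (by rw [he, mul_assoc, mul_assoc, mul_inv_cancel, mul_one])
  have h2 : e ^ n = 1 := pow_eq_one_of_conj (y := x⁻¹) hc' (by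
    rw [inv_inv, mul_assoc, he, ← mul_assoc, ← scal_comm, mul_assoc, inv_mul_cancel_left])
  rw [(pow_eq_one_iff_of_coprime hmn).mp ⟨h1, h2⟩, map_one, one_mul] at he
  exact he.symm

variable [CharZero F]

/-- The homomorphism `(f, T) ↦ (f ^ j, T)` of Heisenberg groups. -/
def powHeis {n j N : ℕ} (h : n * j = N) (hn : 0 < n) (hj : 0 < j) : Heis E F n →* Heis E F N :=
  ((powTheta h).comp (Heis E F n).subtype).codRestrict (Heis E F N) fun a => by
    have ha := (mem_Heis_iff _).mp a.2
    rw [mem_Heis_iff, MonoidHom.comp_apply, det_powTheta h hn hj, Subgroup.subtype_apply, ha, one_pow]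

variable {m n : ℕ} (hm : 0 < m) (hn : 0 < n) (hmn : m.Coprime n)

/-- The homomorphism `((f, S), (g, T)) ↦ (f ^ n, S) * (g ^ m, T)`. -/
def heisHom : Heis E F m × Heis E F n →* Heis E F (m * n) :=
  (powHeis rfl hm hn).noncommCoprod (powHeis (mul_comm n m) hn hm) fun a b =>
    Subtype.ext (powTheta_commute hmn rfl (mul_comm n m) (a : Theta E F m) (b : Theta E F n))

lemma heisHom_coe (x : Heis E F m × Heis E F n) : (heisHom hm hn hmn x : Theta E F (m * n)) =
    powTheta rfl (x.1 : Theta E F m) * powTheta (mul_comm n m) (x.2 : Theta E F n) := rfl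

/-- In the kernel the two torsion points are opposite and of coprime orders, so both vanish. This
leaves roots of unity `α` and `β` with `α ^ n * β ^ m = 1`. -/
lemma heisHom_injective : Function.Injective (heisHom (E := E) (F := F) hm hn hmn) := by
  rw [injective_iff_map_eq_one]
  rintro ⟨⟨a, ha⟩, ⟨b, hb⟩⟩ h
  have h1 : powTheta rfl a * powTheta (mul_comm n m) b = 1 := congrArg Subtype.val h
  have h2 : (a : RatPair E F).pt + (b : RatPair E F).pt = 0 := congrArg (fun x : Theta E F (m * n) => (x : RatPair E F).pt) h1
  have h3 : (a : RatPair E F).pt = 0 := (nsmul_eq_zero_iff_of_coprime hmn).mp ⟨a.2.1, by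
    rw [eq_neg_of_add_eq_zero_left h2, smul_neg, b.2.1, neg_zero]⟩
  obtain ⟨α, rfl⟩ := exists_scal h3
  obtain ⟨β, rfl⟩ := exists_scal (a := b) (by rwa [h3, zero_add] at h2)
  rw [powTheta_scal, powTheta_scal, ← map_mul] at h1
  have h4 := scal_injective _ (h1.trans (map_one _).symm)
  rw [scal_mem_Heis hm] at ha
  rw [scal_mem_Heis hn] at hb
  -- It is killed by `m` because `α` is, and by `n` because it is the inverse of `β ^ m`.
  have h5 : α ^ n = 1 := by
    refine (pow_eq_one_iff_of_coprime hmn).mp ⟨by rw [← pow_mul, mul_comm, pow_mul, ha, one_pow], ?_⟩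
    rw [eq_inv_of_mul_eq_one_left h4, inv_pow, ← pow_mul, mul_comm, pow_mul, hb, one_pow, inv_one]
  rw [h5, one_mul] at h4
  have h6 := (pow_eq_one_iff_of_coprime hmn).mp ⟨ha, h5⟩
  have h7 := (pow_eq_one_iff_of_coprime hmn).mp ⟨h4, hb⟩
  subst h6 h7
  exact Prod.ext (Subtype.ext (map_one _)) (Subtype.ext (map_one _))

/-- Bézout's identity. It splits both the torsion point and the correcting root of unity in the
proof of surjectivity. -/
lemma exists_coprime_decomp {G : Type*} [CommGroup G] {m n : ℕ} (hmn : m.Coprime n) {g : G} (hg : g ^ (m * n) = 1) :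
    ∃ x y : G, x ^ m = 1 ∧ y ^ n = 1 ∧ x * y = g := by
  have hb : (m : ℤ) * m.gcdA n + n * m.gcdB n = 1 := by rw [← Nat.gcd_eq_gcd_ab, hmn.gcd_eq_one, Nat.cast_one]
  refine ⟨(g ^ n) ^ m.gcdB n, (g ^ m) ^ m.gcdA n, ?_, ?_, ?_⟩
  · rw [← zpow_natCast, zpow_comm, zpow_natCast, ← pow_mul, mul_comm n m, hg, one_zpow]
  · rw [← zpow_natCast, zpow_comm, zpow_natCast, ← pow_mul, hg, one_zpow]
  · rw [← zpow_natCast, ← zpow_natCast, ← zpow_mul, ← zpow_mul, ← zpow_add, add_comm, hb, zpow_one]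

/-- By Bézout's identity, raising to the power `n` is invertible on elements killed by `m`. -/
lemma exists_root_of_coprime {G : Type*} [CommGroup G] {m n : ℕ} (hmn : m.Coprime n) {g : G} (hg : g ^ m = 1) :
    ∃ x : G, x ^ m = 1 ∧ x ^ n = g := by
  have hb : (m : ℤ) * m.gcdA n + n * m.gcdB n = 1 := by rw [← Nat.gcd_eq_gcd_ab, hmn.gcd_eq_one, Nat.cast_one]
  refine ⟨g ^ m.gcdB n, ?_, ?_⟩
  · rw [← zpow_natCast, zpow_comm, zpow_natCast, hg, one_zpow]
  · have h1 : g ^ ((m : ℤ) * m.gcdA n + n * m.gcdB n) = g := by rw [hb, zpow_one]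
    rw [zpow_add, zpow_mul, zpow_natCast, hg, one_zpow, one_mul, zpow_mul, zpow_comm, zpow_natCast] at h1
    exact h1

/-- Split the torsion point into parts killed by `m` and `n` and lift both. The result is right up
to a root of unity of order dividing `mn`, which is split in turn and absorbed into the two lifts.
-/
lemma heisHom_surjective : Function.Surjective (heisHom (E := E) (F := F) hm hn hmn) := by
  rintro ⟨γ, hγ⟩
  obtain ⟨S, T, hS, hT, hST⟩ := exists_coprime_decomp (G := Multiplicative (Pts E F)) hmn
    (g := Multiplicative.ofAdd (γ : RatPair E F).pt) γ.2.1
  obtain ⟨a, ha, haS⟩ := exists_heis hm (T := Multiplicative.toAdd S) hS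
  obtain ⟨b, hb, hbT⟩ := exists_heis hn (T := Multiplicative.toAdd T) hT
  set x := heisHom hm hn hmn (⟨a, ha⟩, ⟨b, hb⟩) with hx
  obtain ⟨e, he⟩ := exists_eq_scal_mul (a := γ) (b := (x : Theta E F (m * n))) (by
    change _ = (a : RatPair E F).pt + (b : RatPair E F).pt
    rw [haS, hbT]
    exact hST.symm)
  have he1 : e ^ (m * n) = 1 := by
    rw [← scal_mem_Heis (E := E) (Nat.mul_pos hm hn), show scal E (m * n) e = γ * (x : Theta E F (m * n))⁻¹ by
      rw [he, mul_inv_cancel_right]]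
    exact mul_mem hγ (inv_mem x.2)
  obtain ⟨e₁, e₂, h1, h2, rfl⟩ := exists_coprime_decomp hmn he1
  -- The scalar `α` of `H_m` is sent to `α ^ n`, so an `n`-th root inside the `m`-th roots of unity
  -- is needed; likewise for `β`.
  obtain ⟨α, hα, rfl⟩ := exists_root_of_coprime hmn h1
  obtain ⟨β, hβ, rfl⟩ := exists_root_of_coprime hmn.symm h2
  refine ⟨(⟨scal E m α, (scal_mem_Heis hm).mpr hα⟩, ⟨scal E n β, (scal_mem_Heis hn).mpr hβ⟩) * (⟨a, ha⟩, ⟨b, hb⟩),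
    Subtype.ext ?_⟩
  rw [map_mul, Subgroup.coe_mul, ← hx, heisHom_coe, powTheta_scal, powTheta_scal, ← map_mul]
  exact he.symm

/-- The isomorphism `((f, S), (g, T)) ↦ (f ^ n, S) * (g ^ m, T)`. -/
def heisEquiv : Heis E F m × Heis E F n ≃* Heis E F (m * n) :=
  MulEquiv.ofBijective (heisHom hm hn hmn) ⟨heisHom_injective hm hn hmn, heisHom_surjective hm hn hmn⟩

lemma heisEquiv_coe (x : Heis E F m × Heis E F n) :
    ((heisEquiv hm hn hmn x : Theta E F (m * n)) : RatPair E F) =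
      RatPair.powFn ((x.1 : Theta E F m) : RatPair E F) n * RatPair.powFn ((x.2 : Theta E F n) : RatPair E F) m := rfl

lemma galPair_powFn (σ : F ≃ₐ[k] F) (a : RatPair E F) (j : ℕ) :
    galPair σ (RatPair.powFn a j) = RatPair.powFn (galPair σ a) j :=
  RatPair.ext' (map_pow (galFF σ) (a.fn : FF E F) j) rfl

/-- The formula uses only powers and the group law, both of which the Galois action respects. -/
lemma heisEquiv_gal (σ : F ≃ₐ[k] F) (x : Heis E F m × Heis E F n) :
    galHeis (m * n) σ (heisEquiv hm hn hmn x) = heisEquiv hm hn hmn (galHeis m σ x.1, galHeis n σ x.2) := by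
  refine Subtype.ext (Subtype.ext ?_)
  change galPair σ _ = _
  rw [heisEquiv_coe, heisEquiv_coe, map_mul, galPair_powFn, galPair_powFn]
  rfl

lemma heisEquiv_symm_gal (σ : F ≃ₐ[k] F) (x : Heis E F (m * n)) :
    (heisEquiv hm hn hmn).symm (galHeis (m * n) σ x) =
      (galHeis m σ ((heisEquiv hm hn hmn).symm x).1, galHeis n σ ((heisEquiv hm hn hmn).symm x).2) := by
  rw [MulEquiv.symm_apply_eq, ← heisEquiv_gal, MulEquiv.apply_symm_apply]

end Decomposition

end

section

open scoped TensorProduct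

/-! ### Algebras of equivariant functions on finite sets -/

section EquivariantFunctions

variable {k F : Type u} [Field k] [Field F] [Algebra k F]

/-- An algebra of functions on a finite set that separates the points contains all functions. -/
lemma subalgebra_eq_top_of_separates {X : Type*} [Finite X] (S : Subalgebra F (X → F))
    (hS : ∀ x y, x ≠ y → ∃ a ∈ S, a x ≠ a y) : S = ⊤ := by
  have := Fintype.ofFinite X
  -- Rescaling a separating function gives `p` with value 1 at `x` and 0 at `y`; products of these
  -- over `y` are the indicator functions of points.
  have hp : ∀ x y, ∃ p ∈ S, x ≠ y → p x = 1 ∧ p y = 0 := by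
    intro x y
    by_cases h : x = y
    · exact ⟨0, S.zero_mem, fun h' => absurd h h'⟩
    · obtain ⟨a, ha, hxy⟩ := hS x y h
      refine ⟨(a x - a y)⁻¹ • (a - algebraMap F _ (a y)), S.smul_mem (S.sub_mem ha (S.algebraMap_mem _)) _, fun _ => ⟨?_, ?_⟩⟩
      · exact inv_mul_cancel₀ (sub_ne_zero.mpr hxy)
      · change (a x - a y)⁻¹ * (a y - a y) = 0
        rw [sub_self, mul_zero]
  choose p hp hp' using hp
  have hsingle : ∀ x, Pi.single x (1 : F) ∈ S := by
    intro x
    have : Pi.single x (1 : F) = ∏ y ∈ Finset.univ.erase x, p x y := by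
      funext z
      rw [Finset.prod_apply]
      by_cases hz : z = x
      · subst hz
        rw [Pi.single_eq_same]
        exact (Finset.prod_eq_one fun y hy => (hp' z y (Finset.ne_of_mem_erase hy).symm).1).symm
      · rw [Pi.single_eq_of_ne hz]
        exact (Finset.prod_eq_zero (f := fun y => p x y z) (Finset.mem_erase.mpr ⟨hz, Finset.mem_univ z⟩)
          (hp' x z (Ne.symm hz)).2).symm
    rw [this]
    exact S.prod_mem fun y _ => hp x y
  rw [eq_top_iff]
  intro f _
  rw [pi_eq_sum_univ' f]
  exact S.sum_mem fun x _ => S.smul_mem (hsingle x) _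

/-- An algebra of equivariant functions on a finite set that separates the points contains all
equivariant functions. -/
lemma mem_range_of_equivariant {X : Type u} [Finite X] {A : Type u} [CommRing A] [Algebra k A] (φ : A →ₐ[k] (X → F))
    (s : (F ≃ₐ[k] F) → X → X)
    (hfix : ∀ c : F, (∀ σ : F ≃ₐ[k] F, σ c = c) → ∃ d : k, algebraMap k F d = c)
    (hφ : ∀ a σ x, φ a (s σ x) = σ (φ a x)) (hsep : ∀ x y, x ≠ y → ∃ a, φ a x ≠ φ a y)
    {f : X → F} (hf : ∀ σ x, f (s σ x) = σ (f x)) : f ∈ φ.range := by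
  by_contra hne
  let b := Module.Basis.ofVectorSpace k φ.range
  let v : _ → X → F := fun i => (b i : X → F)
  have hv : LinearIndependent k v :=
    b.linearIndependent.map' φ.range.val.toLinearMap (LinearMap.ker_eq_bot.mpr Subtype.val_injective)
  have hspan : Submodule.span k (Set.range v) = Subalgebra.toSubmodule φ.range := by
    have h1 : Set.range v = φ.range.val.toLinearMap '' Set.range b := by
      rw [← Set.range_comp]; rfl
    rw [h1, Submodule.span_image, b.span_eq, Submodule.map_top]
    ext g
    exact ⟨by rintro ⟨a, rfl⟩; exact a.2, fun hg => ⟨⟨g, hg⟩, rfl⟩⟩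
  -- A missing `f` extends a `k`-basis of the range. Galois descent (`indep`) keeps the extended
  -- family independent over `F`, although the range already spans all functions over `F`.
  have hli : LinearIndependent k (fun o : Option _ => Option.casesOn' o f v) :=
    linearIndependent_option'.mpr ⟨hv, by rw [hspan]; exact hne⟩
  have hF := indep s hfix _ (fun o σ x => by
    rcases o with _ | i
    · exact hf σ x
    · obtain ⟨a, ha⟩ := (b i).2
      change (b i : X → F) (s σ x) = σ ((b i : X → F) x)
      rw [← ha]
      exact hφ a σ x) hli
  refine (linearIndependent_option'.mp hF).2 ?_
  have htop : Algebra.adjoin F (φ.range : Set (X → F)) = ⊤ :=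
    subalgebra_eq_top_of_separates _ fun x y h => by
      obtain ⟨a, ha⟩ := hsep x y h
      exact ⟨φ a, Algebra.subset_adjoin ⟨a, rfl⟩, ha⟩
  have h2 : f ∈ Subalgebra.toSubmodule (Algebra.adjoin F (φ.range : Set (X → F))) := by
    rw [htop]; trivial
  rw [Algebra.adjoin_eq_span] at h2
  -- The range is closed under products, so the `F`-algebra it generates is just its `F`-span.
  have h3 : (Submonoid.closure (φ.range : Set (X → F)) : Set (X → F)) = φ.range :=
    congrArg SetLike.coe (Submonoid.closure_eq φ.range.toSubmonoid)
  rw [h3] at h2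
  refine Submodule.span_le.mpr ?_ h2
  intro g hg
  have h4 : g ∈ Submodule.span k (Set.range v) := by rw [hspan]; exact hg
  exact Submodule.span_subset_span k F _ h4

/-! ### Tensor products as functions on a product -/

section Tensor

variable {A B : Type u} [CommRing A] [CommRing B] [Algebra k A] [Algebra k B] {X Y : Type u}
  {φ : A →ₐ[k] (X → F)} {ψ : B →ₐ[k] (Y → F)}

lemma tensEv_equivariant {s : (F ≃ₐ[k] F) → X → X} {t : (F ≃ₐ[k] F) → Y → Y}
    (hφ : ∀ a σ x, φ a (s σ x) = σ (φ a x)) (hψ : ∀ b σ y, ψ b (t σ y) = σ (ψ b y)) (c : A ⊗[k] B) (σ : F ≃ₐ[k] F)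
    (p : X × Y) : tensEv φ ψ c (s σ p.1, t σ p.2) = σ (tensEv φ ψ c p) := by
  induction c with
  | zero => simp
  | add u v hu hv => rw [map_add, Pi.add_apply, Pi.add_apply, hu, hv, map_add]
  | tmul a b => rw [tensEv_tmul, tensEv_tmul, hφ, hψ, map_mul]

/-- Points of a product differ in some coordinate, and `a ⊗ 1` or `1 ⊗ b` sees that coordinate. -/
lemma tensEv_separates (hφ : ∀ x y, x ≠ y → ∃ a, φ a x ≠ φ a y) (hψ : ∀ x y, x ≠ y → ∃ b, ψ b x ≠ ψ b y)
    (p q : X × Y) (h : p ≠ q) : ∃ c, tensEv φ ψ c p ≠ tensEv φ ψ c q := by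
  by_cases h1 : p.1 = q.1
  · obtain ⟨b, hb⟩ := hψ p.2 q.2 fun h2 => h (Prod.ext h1 h2)
    refine ⟨1 ⊗ₜ b, ?_⟩
    rw [tensEv_tmul, tensEv_tmul, map_one]
    simpa using hb
  · obtain ⟨a, ha⟩ := hφ p.1 q.1 h1
    refine ⟨a ⊗ₜ 1, ?_⟩
    rw [tensEv_tmul, tensEv_tmul, map_one]
    simpa using ha

end Tensor

/-! ### Pull-back along group homomorphisms respects the coalgebra structure -/

section Bialgebra

variable {A B : Type u} [CommRing A] [CommRing B] [Algebra k A] [Algebra k B] {X Y : Type u} [Group X] [Group Y]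
  {φ : A →ₐ[k] (X → F)} {ψ : B →ₐ[k] (Y → F)} (f : A →ₐ[k] B)

lemma ev2_map {π : Y → X} (hf : ∀ a y, ψ (f a) y = φ a (π y)) (t : A ⊗[k] A) (x y : Y) :
    ev2 ψ (Algebra.TensorProduct.map f f t) (x, y) = ev2 φ t (π x, π y) := by
  induction t with
  | zero => rw [map_zero, IsFunHopf.ev2_zero, IsFunHopf.ev2_zero]
  | add u v hu hv => rw [map_add, IsFunHopf.ev2_add, IsFunHopf.ev2_add, hu, hv]
  | tmul a b =>
    rw [Algebra.TensorProduct.map_tmul, IsFunHopf.ev2_tmul, IsFunHopf.ev2_tmul, hf, hf]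

lemma counitHom_comp (hφ : IsFunHopf φ) (hψ : IsFunHopf ψ) (π : Y →* X) (hf : ∀ a y, ψ (f a) y = φ a (π y)) :
    hψ.counitHom.comp f = hφ.counitHom := by
  apply AlgHom.ext
  intro a
  apply (algebraMap k F).injective
  rw [hφ.counitHom_apply, AlgHom.comp_apply, hψ.counitHom_apply, hf, map_one]

/-- Evaluated at pairs of points, which is injective on the tensor square, this is the
multiplicativity of `π`. -/
lemma map_comp_comulHom (hφ : IsFunHopf φ) (hψ : IsFunHopf ψ) (π : Y →* X) (hf : ∀ a y, ψ (f a) y = φ a (π y)) :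
    (Algebra.TensorProduct.map f f).comp hφ.comulHom = hψ.comulHom.comp f := by
  apply AlgHom.ext
  intro a
  apply hψ.inj2
  funext ⟨x, y⟩
  rw [AlgHom.comp_apply, AlgHom.comp_apply, ev2_map f hf, hφ.comulHom_apply, hψ.comulHom_apply, hf, map_mul]

end Bialgebra

/-- If a finite set is the product of two others, through equivariant maps, then its algebra of equivariant
functions is the tensor product of theirs. -/
lemma productMap_bijective {A B C : Type u} [CommRing A] [CommRing B] [CommRing C] [Algebra k A] [Algebra k B]
    [Algebra k C] {X Y Z : Type u} [Finite X] [Finite Y] {φ : A →ₐ[k] (X → F)} {ψ : B →ₐ[k] (Y → F)}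
    {χ : C →ₐ[k] (Z → F)} (hφi : Function.Injective φ) (hψi : Function.Injective ψ) (hχi : Function.Injective χ)
    {s : (F ≃ₐ[k] F) → X → X} {t : (F ≃ₐ[k] F) → Y → Y} {r : (F ≃ₐ[k] F) → Z → Z}
    (hfix : ∀ c : F, (∀ σ : F ≃ₐ[k] F, σ c = c) → ∃ d : k, algebraMap k F d = c)
    (hφ : ∀ a σ x, φ a (s σ x) = σ (φ a x)) (hψ : ∀ b σ y, ψ b (t σ y) = σ (ψ b y))
    (hχ : ∀ c σ z, χ c (r σ z) = σ (χ c z))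
    (hφs : ∀ x y, x ≠ y → ∃ a, φ a x ≠ φ a y) (hψs : ∀ x y, x ≠ y → ∃ b, ψ b x ≠ ψ b y)
    (e : Z ≃ X × Y) (he : ∀ σ z, e (r σ z) = (s σ (e z).1, t σ (e z).2))
    {f : A →ₐ[k] C} {g : B →ₐ[k] C} (hf : ∀ a z, χ (f a) z = φ a (e z).1) (hg : ∀ b z, χ (g b) z = ψ b (e z).2) :
    Function.Bijective (Algebra.TensorProduct.productMap f g) := by
  -- Under `e` the product map becomes evaluation of tensors on `X × Y`, so both halves reduce to
  -- facts about `tensEv φ ψ`.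
  have hval : ∀ w z, χ (Algebra.TensorProduct.productMap f g w) z = tensEv φ ψ w (e z) := by
    intro w z
    induction w with
    | zero => simp
    | add u v hu hv => rw [map_add, map_add, map_add, Pi.add_apply, Pi.add_apply, hu, hv]
    | tmul a b =>
      rw [Algebra.TensorProduct.productMap_apply_tmul, tensEv_tmul, map_mul, Pi.mul_apply, hf, hg]
  constructor
  · intro u v huv
    refine tensEv_injective s hfix hφ hφi hψi (funext fun p => ?_)
    obtain ⟨z, rfl⟩ := e.surjective p
    rw [← hval, ← hval, huv]
  · intro c
    -- Transported to `X × Y`, the function of `c` is equivariant, and tensors already give every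
    -- equivariant function on that finite set.
    obtain ⟨w, hw⟩ := mem_range_of_equivariant (tensEv φ ψ) (fun σ p => (s σ p.1, t σ p.2)) hfix
      (tensEv_equivariant hφ hψ) (tensEv_separates hφs hψs) (f := fun p => χ c (e.symm p)) (fun σ p => by
        rw [← hχ]
        refine congrArg (χ c) (e.symm_apply_eq.mpr ?_)
        rw [he, e.apply_symm_apply])
    refine ⟨w, hχi (funext fun z => ?_)⟩
    rw [hval]
    exact (congrFun hw (e z)).trans (congrArg (χ c) (e.symm_apply_apply z))

end EquivariantFunctions

/-! ### The coordinate ring of the Heisenberg group -/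

section CoordinateRing

variable {k : Type u} [Field k] {E : WeierstrassCurve k} {F : Type u} [Field F] [Algebra k F]
  [IsAlgClosed F] [E.IsElliptic]

lemma one_mem_RR (n : ℕ) : (1 : FF E F) ∈ RR E F n := by
  intro _ P
  rw [div, ord_one, nO]
  split_ifs <;> simp

/-- An element acting trivially fixes the constant function `1`, which forces its function to be
`1`. Comparing orders at the origin then forces its point to be `0`, as `n > 0`. -/
lemma thetaRR_injective {n : ℕ} (hn : 0 < n) : Function.Injective (thetaRR (E := E) (F := F) n) := by
  rw [injective_iff_map_eq_one]
  intro a ha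
  have h1 := congrArg (fun φ : RR E F n →ₗ[F] RR E F n => (φ ⟨1, one_mem_RR n⟩ : FF E F)) ha
  simp only [thetaRR_apply, RatPair.act_apply, Module.End.one_apply] at h1
  have h2 : (a : RatPair E F).fn = 1 := by
    apply Units.ext
    have h3 := (transl (-(a : RatPair E F).pt)).injective (h1.trans (map_one _).symm)
    rw [one_div, inv_eq_one] at h3
    exact h3
  refine Subtype.ext (RatPair.ext' (congrArg Units.val h2) ?_)
  have h3 := a.2.2 0
  rw [h2, Units.val_one, div, ord_one, zero_add, nO, nO, if_pos rfl] at h3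
  by_contra hne
  have hne' : ¬ (a : RatPair E F).pt = 0 := hne
  rw [if_neg hne'] at h3
  omega

/-- The action is faithful, and matrix coefficients in a rational basis determine it. -/
lemma heisRing_separates {n : ℕ} (hn : 0 < n) (x y : Heis E F n) (hxy : x ≠ y) :
    ∃ a : heisRing E F n, (heisRing E F n).val a x ≠ (heisRing E F n).val a y := by
  by_contra! h
  obtain ⟨ι, _, b, hb⟩ := exists_basis (k := k) (E := E) (F := F) n
  apply hxy
  apply Subtype.ext
  -- A coefficient of `x` on the dual space is a coefficient of `x⁻¹` on `L(n.O)`.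
  apply inv_injective
  apply thetaRR_injective hn
  refine b.ext fun j => b.ext_elem fun i => ?_
  exact h ⟨_, coef_mem (isRatDual_coord b hb i) (hb j)⟩

variable [CharZero k] [Algebra.IsAlgebraic k F]

/-- The group is finite and its coordinate ring separates points, so nothing equivariant is left
out. Pull-backs along equivariant maps therefore stay within the coordinate rings, with no formula
for matrix coefficients needed. -/
lemma mem_heisRing_of_equivariant [CharZero F] {n : ℕ} (hn : 0 < n) {f : Heis E F n → F}
    (hf : ∀ (σ : F ≃ₐ[k] F) x, f (galHeis n σ x) = σ (f x)) : f ∈ heisRing E F n := by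
  have := finite_Heis (E := E) (F := F) hn
  have h := mem_range_of_equivariant (heisRing E F n).val (fun σ => galHeis n σ)
    (heisRing_isFunHopf (E := E) (F := F) n).fix (fun a σ x => heisRing_gal (E := E) a.2 σ x) (heisRing_separates hn) hf
  rwa [Subalgebra.range_val] at h

/-- Pull-back of functions on Heisenberg groups along an equivariant map. -/
def pullHeis [CharZero F] {m N : ℕ} (hN : 0 < N) (π : Heis E F N → Heis E F m)
    (hπ : ∀ (σ : F ≃ₐ[k] F) x, π (galHeis N σ x) = galHeis m σ (π x)) : heisRing E F m →ₐ[k] heisRing E F N :=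
  ((pull k π).comp (heisRing E F m).val).codRestrict (heisRing E F N) fun a =>
    mem_heisRing_of_equivariant hN fun σ x => by
      change (a : Heis E F m → F) (π (galHeis N σ x)) = σ ((a : Heis E F m → F) (π x))
      rw [hπ, heisRing_gal a.2]

/-- Pull-back of functions along an equivariant homomorphism, as a homomorphism of bialgebras. -/
def pullHeisBialg [CharZero F] {m N : ℕ} (hN : 0 < N) (π : Heis E F N →* Heis E F m)
    (hπ : ∀ (σ : F ≃ₐ[k] F) x, π (galHeis N σ x) = galHeis m σ (π x)) : heisRing E F m →ₐc[k] heisRing E F N :=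
  BialgHom.ofAlgHom (pullHeis hN π hπ)
    (counitHom_comp (pullHeis hN π hπ) (heisRing_isFunHopf (E := E) (F := F) m)
      (heisRing_isFunHopf (E := E) (F := F) N) π fun _ _ => rfl)
    (map_comp_comulHom (pullHeis hN π hπ) (heisRing_isFunHopf (E := E) (F := F) m)
      (heisRing_isFunHopf (E := E) (F := F) N) π fun _ _ => rfl)

/-- For an equivariant bijection, the tensor product of the coordinate rings is the coordinate ring. -/
lemma productMap_pullHeis_bijective [CharZero F] {m n N : ℕ} (hm : 0 < m) (hn : 0 < n) (hN : 0 < N)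
    (π₁ : Heis E F N → Heis E F m) (π₂ : Heis E F N → Heis E F n)
    (h₁ : ∀ (σ : F ≃ₐ[k] F) x, π₁ (galHeis N σ x) = galHeis m σ (π₁ x))
    (h₂ : ∀ (σ : F ≃ₐ[k] F) x, π₂ (galHeis N σ x) = galHeis n σ (π₂ x))
    (hπ : Function.Bijective fun x => (π₁ x, π₂ x)) :
    Function.Bijective (Algebra.TensorProduct.productMap (pullHeis hN π₁ h₁) (pullHeis hN π₂ h₂)) := by
  have := finite_Heis (E := E) (F := F) hm
  have := finite_Heis (E := E) (F := F) hn
  exact productMap_bijective (φ := (heisRing E F m).val) (ψ := (heisRing E F n).val) (χ := (heisRing E F N).val)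
    (s := fun σ => galHeis m σ) (t := fun σ => galHeis n σ) (r := fun σ => galHeis N σ)
    Subtype.val_injective Subtype.val_injective Subtype.val_injective
    (heisRing_isFunHopf (E := E) (F := F) m).fix
    (fun a σ x => heisRing_gal (E := E) a.2 σ x) (fun a σ x => heisRing_gal (E := E) a.2 σ x)
    (fun a σ x => heisRing_gal (E := E) a.2 σ x) (heisRing_separates hm) (heisRing_separates hn)
    (Equiv.ofBijective _ hπ) (fun σ x => Prod.ext (h₁ σ x) (h₂ σ x)) (fun _ _ => rfl) fun _ _ => rfl

end CoordinateRing

end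

section

open CategoryTheory AlgebraicGeometry MonoidalCategory Opposite

/-! ### The isomorphism of group schemes -/

section SpecProduct

/-- `Spec` takes a pair of algebra homomorphisms presenting `C` as the tensor product of `A` and `B` to the
projections of a product. -/
lemma isIso_lift_algSpec {k : Type u} [CommRing k] {A B C : Type u} [CommRing A] [CommRing B] [CommRing C]
    [Algebra k A] [Algebra k B] [Algebra k C] (f : A →ₐ[k] C) (g : B →ₐ[k] C)
    (h : Function.Bijective (Algebra.TensorProduct.productMap f g)) :
    IsIso (CartesianMonoidalCategory.lift ((algSpec (CommRingCat.of k)).map (CommAlgCat.ofHom f).op)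
      ((algSpec (CommRingCat.of k)).map (CommAlgCat.ofHom g).op)) := by
  -- In the opposite of the category of algebras the product is the tensor product, and the lift is
  -- the opposite of the product map.
  have h1 : IsIso (CartesianMonoidalCategory.lift (CommAlgCat.ofHom f).op (CommAlgCat.ofHom g).op) := by
    have h2 : CartesianMonoidalCategory.lift (CommAlgCat.ofHom f).op (CommAlgCat.ofHom g).op =
        (CommAlgCat.isoMk (AlgEquiv.ofBijective _ h)).op.hom := rfl
    rw [h2]
    infer_instance
  -- `Spec` preserves limits, so the two lifts differ by the comparison isomorphism of products.
  have h3 : CartesianMonoidalCategory.lift ((algSpec (CommRingCat.of k)).map (CommAlgCat.ofHom f).op)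
      ((algSpec (CommRingCat.of k)).map (CommAlgCat.ofHom g).op) =
      (algSpec (CommRingCat.of k)).map (CartesianMonoidalCategory.lift (CommAlgCat.ofHom f).op (CommAlgCat.ofHom g).op) ≫
        CartesianMonoidalCategory.prodComparison (algSpec (CommRingCat.of k)) _ _ := by
    apply CartesianMonoidalCategory.hom_ext
    · rw [CartesianMonoidalCategory.lift_fst, Category.assoc, CartesianMonoidalCategory.prodComparison_fst,
        ← Functor.map_comp, CartesianMonoidalCategory.lift_fst]
    · rw [CartesianMonoidalCategory.lift_snd, Category.assoc, CartesianMonoidalCategory.prodComparison_snd,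
        ← Functor.map_comp, CartesianMonoidalCategory.lift_snd]
  rw [h3]
  have : Limits.PreservesLimitsOfSize.{0, 0} (algSpec (CommRingCat.of k)) := preservesLimitsOfSize_algSpec
  have h4 := (CartesianMonoidalCategory.prodComparisonIso (algSpec (CommRingCat.of k)) (op (CommAlgCat.of k A))
    (op (CommAlgCat.of k B))).isIso_hom
  exact IsIso.comp_isIso' inferInstance h4

end SpecProduct

section HeisScheme

variable {k : Type u} [Field k] [CharZero k] {E : WeierstrassCurve k} [E.IsElliptic]
  {F : Type u} [Field F] [Algebra k F] [IsAlgClosed F] [Algebra.IsAlgebraic k F] [CharZero F]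

/-- The homomorphism of group schemes given by an equivariant homomorphism of the groups of points. -/
def heisSchemeHom {m N : ℕ} (hN : 0 < N) (π : Heis E F N →* Heis E F m)
    (hπ : ∀ (σ : F ≃ₐ[k] F) x, π (galHeis N σ x) = galHeis m σ (π x)) : heisScheme E F N ⟶ heisScheme E F m :=
  (hopfSpec (CommRingCat.of k)).map (CommHopfAlgCat.ofHom (pullHeisBialg hN π hπ)).op

/-- Evaluating a pulled-back function at `x` is evaluating the function at `π x`. -/
lemma heisPt_comp_heisSchemeHom {m N : ℕ} (hN : 0 < N) (π : Heis E F N →* Heis E F m)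
    (hπ : ∀ (σ : F ≃ₐ[k] F) x, π (galHeis N σ x) = galHeis m σ (π x)) (x : Heis E F N) :
    heisPt x ≫ (heisSchemeHom hN π hπ).hom.hom = heisPt (π x) :=
  ((algSpec (CommRingCat.of k)).map_comp _ _).symm

/-- An equivariant bijection `(π₁, π₂)` onto a product of groups of points is an isomorphism of group schemes. -/
lemma isIso_lift_heisSchemeHom {m n N : ℕ} (hm : 0 < m) (hn : 0 < n) (hN : 0 < N)
    (π₁ : Heis E F N →* Heis E F m) (π₂ : Heis E F N →* Heis E F n)
    (h₁ : ∀ (σ : F ≃ₐ[k] F) x, π₁ (galHeis N σ x) = galHeis m σ (π₁ x))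
    (h₂ : ∀ (σ : F ≃ₐ[k] F) x, π₂ (galHeis N σ x) = galHeis n σ (π₂ x))
    (hπ : Function.Bijective fun x => (π₁ x, π₂ x)) :
    IsIso (CartesianMonoidalCategory.lift (heisSchemeHom hN π₁ h₁) (heisSchemeHom hN π₂ h₂)) := by
  -- The forgetful functors from group objects to monoid objects and on to schemes reflect
  -- isomorphisms, so it suffices to treat the underlying map of schemes.
  have h : IsIso ((Mon.forget _).map ((Grp.forget₂Mon _).map <|
      CartesianMonoidalCategory.lift (heisSchemeHom hN π₁ h₁) (heisSchemeHom hN π₂ h₂))) :=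
    isIso_lift_algSpec (pullHeis hN π₁ h₁) (pullHeis hN π₂ h₂)
      (productMap_pullHeis_bijective hm hn hN π₁ π₂ h₁ h₂ hπ)
  have h' := isIso_of_reflects_iso ((Grp.forget₂Mon _).map <|
    CartesianMonoidalCategory.lift (heisSchemeHom hN π₁ h₁) (heisSchemeHom hN π₂ h₂))
    (Mon.forget (Over (Spec (CommRingCat.of k))))
  exact isIso_of_reflects_iso _ (Grp.forget₂Mon (Over (Spec (CommRingCat.of k))))

lemma heisPt_comp_lift {m n N : ℕ} (hN : 0 < N) (π₁ : Heis E F N →* Heis E F m) (π₂ : Heis E F N →* Heis E F n)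
    (h₁ : ∀ (σ : F ≃ₐ[k] F) x, π₁ (galHeis N σ x) = galHeis m σ (π₁ x))
    (h₂ : ∀ (σ : F ≃ₐ[k] F) x, π₂ (galHeis N σ x) = galHeis n σ (π₂ x)) (x : Heis E F N) :
    heisPt x ≫ (CartesianMonoidalCategory.lift (heisSchemeHom hN π₁ h₁) (heisSchemeHom hN π₂ h₂)).hom.hom =
      CartesianMonoidalCategory.lift (heisPt (π₁ x)) (heisPt (π₂ x)) := by
  rw [← heisPt_comp_heisSchemeHom hN π₁ h₁, ← heisPt_comp_heisSchemeHom hN π₂ h₂]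
  exact CartesianMonoidalCategory.comp_lift _ _ _

/-- An equivariant decomposition of the group of points as a product is a decomposition of the group scheme. -/
lemma exists_heisScheme_iso {m n N : ℕ} (hm : 0 < m) (hn : 0 < n) (hN : 0 < N)
    (π₁ : Heis E F N →* Heis E F m) (π₂ : Heis E F N →* Heis E F n)
    (h₁ : ∀ (σ : F ≃ₐ[k] F) x, π₁ (galHeis N σ x) = galHeis m σ (π₁ x))
    (h₂ : ∀ (σ : F ≃ₐ[k] F) x, π₂ (galHeis N σ x) = galHeis n σ (π₂ x))
    (hπ : Function.Bijective fun x => (π₁ x, π₂ x)) :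
    ∃ Φ : heisScheme E F m ⊗ heisScheme E F n ≅ heisScheme E F N, ∀ x,
      CartesianMonoidalCategory.lift (heisPt (π₁ x)) (heisPt (π₂ x)) ≫ Φ.hom.hom.hom = heisPt x := by
  have hiso := isIso_lift_heisSchemeHom hm hn hN π₁ π₂ h₁ h₂ hπ
  -- Pull-back of functions produces maps out of the large group scheme, so the required isomorphism
  -- is the inverse of the lift.
  refine ⟨(asIso (CartesianMonoidalCategory.lift (heisSchemeHom hN π₁ h₁) (heisSchemeHom hN π₂ h₂))).symm, fun x => ?_⟩
  rw [← heisPt_comp_lift hN π₁ π₂ h₁ h₂, Category.assoc]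
  refine Eq.trans ?_ (Category.comp_id _)
  exact congrArg (fun f : heisScheme E F N ⟶ heisScheme E F N => heisPt x ≫ f.hom.hom) (IsIso.hom_inv_id
    (CartesianMonoidalCategory.lift (heisSchemeHom hN π₁ h₁) (heisSchemeHom hN π₂ h₂)))

end HeisScheme

end

end
end EllHeis

open EllHeis CategoryTheory AlgebraicGeometry MonoidalCategory

theorem mainTheorem5 {k kbar : Type u} [Field k] [CharZero k] [Field kbar] [Algebra k kbar]
    [IsAlgClosed kbar] [Algebra.IsAlgebraic k kbar] (E : WeierstrassCurve k) [E.IsElliptic]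
    (m n : ℕ) (hm : 0 < m) (hn : 0 < n) (hmn : m.Coprime n) :
    ∃ Φ : heisScheme E kbar m ⊗ heisScheme E kbar n ≅ heisScheme E kbar (m * n),
      ∀ (a : Heis E kbar m) (b : Heis E kbar n), ∃ c : Heis E kbar (m * n),
        ((c : Theta E kbar (m * n)) : RatPair E kbar) =
          RatPair.powFn ((a : Theta E kbar m) : RatPair E kbar) n *
            RatPair.powFn ((b : Theta E kbar n) : RatPair E kbar) m ∧
        CartesianMonoidalCategory.lift (heisPt a) (heisPt b) ≫ Φ.hom.hom.hom = heisPt c := by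
  have : CharZero kbar := charZero_of_injective_algebraMap (algebraMap k kbar).injective
  -- The projections are the two components of the inverse of the isomorphism on points.
  obtain ⟨Φ, hΦ⟩ := exists_heisScheme_iso hm hn (Nat.mul_pos hm hn)
    ((MonoidHom.fst _ _).comp (heisEquiv (E := E) (F := kbar) hm hn hmn).symm.toMonoidHom)
    ((MonoidHom.snd _ _).comp (heisEquiv (E := E) (F := kbar) hm hn hmn).symm.toMonoidHom)
    (fun σ x => congrArg Prod.fst (heisEquiv_symm_gal hm hn hmn σ x))
    (fun σ x => congrArg Prod.snd (heisEquiv_symm_gal hm hn hmn σ x)) (heisEquiv hm hn hmn).symm.bijective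
  refine ⟨Φ, fun a b => ⟨heisEquiv hm hn hmn (a, b), heisEquiv_coe hm hn hmn (a, b), ?_⟩⟩
  have hab := (heisEquiv (E := E) (F := kbar) hm hn hmn).symm_apply_apply (a, b)
  -- Writing `a` and `b` as components of the inverse image of their product matches the form of
  -- `hΦ`.
  have ha : heisPt a = heisPt ((heisEquiv hm hn hmn).symm (heisEquiv hm hn hmn (a, b))).1 := by rw [hab]
  have hb : heisPt b = heisPt ((heisEquiv hm hn hmn).symm (heisEquiv hm hn hmn (a, b))).2 := by rw [hab]
  rw [ha, hb]
  exact hΦ (heisEquiv hm hn hmn (a, b))
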